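/- **Conventions.** Let $k$ be a field of characteristic $0$. All vector spaces are $\mathbb Z/2$-graded, with Koszul signs; $\Pi$ is parity reversion. Operads are symmetric and non-unital, given by partial compositions $\circ_i$, and may have operations of arity $0$. Fix a sign $\varepsilon\in\{1,-1\}$ (a choice of sign convention; the result holds for both). Let $l_\infty$ be the dg operad freely generated by odd symmetric operations $m_n$ of arity $n$, $n\ge 2$, with differential $$d(m_n)=\varepsilon\sum_{a+b=n,\;a\ge2,\;b\ge1}\ \sum_{\sigma\in \mathrm{Sh}(a,b)}\sigma\,(m_{b+1}\circ_1 m_a).$$ Let $\mathcal O$ be a dg operad with a map of dg operads $\phi: l_\infty\to\mathcal O$. **The operad $\mathrm{Tw}\,\mathcal O$.** Let $\mathcal O[[x]]=\varprojlim_N \mathcal O[x]/(x^N)$, where $x$ is a freely adjoined even operation of arity $0$. The operad $\mathcal O_{MC}$ is $\mathcal O[[x]]$ with the continuous derivation that extends the differential of $\mathcal O$ and satisfies $d(x)=\varepsilon\sum_{n\ge2}\frac1{n!}\phi(m_n)\circ x^{\otimes n}$. Put $\alpha=-\varepsilon\sum_{n\ge1}\frac1{n!}\phi(m_{n+1})\circ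 x^{\otimes n}\in\mathcal O_{MC}(1)$. Then $\mathrm{Tw}\,\mathcal O$ is the operad $\mathcal O[[x]]$ with differential $z\mapsto dz+\alpha\circ_1 z-(-1)^{|z|}\sum_i z\circ_i\alpha$. **Block algebras.** Let $A=k\oplus A_+$ be a formal cdga, i.e. $A_+$ is an inverse limit of finite-dimensional nilpotent cdgas, and let $(V,d_V)$ be a dg vector space. Write $A\otimes V$ for the completed tensor product $\varprojlim (A_i\otimes V)$, where $A=\varprojlim A_i$. A *formal Block module* $(A\otimes V,d)$ is given by a continuous odd map $d$ on $A\otimes V$ with $d^2=0$, $d(aw)=d_A(a)w+(-1)^{|a|}a\,d(w)$, and $d(v)-d_V(v)\in A_+\otimes V$ for $v\in V$. A *Block $\mathcal P$-algebra structure* on it, for a dg operad $\mathcal P$, is a (continuous, if $\mathcal P$ is topological) map of dg operads from $\mathcal P$ to the operad of continuous $A$-multilinear maps $(A\otimes\Pi V)^n\to A_+\otimes\Pi V$, $n\ge0$, with the differential induced by $d$. For a Block $\mathcal O$-algebra structure on $(A\otimes V,d')$, let $MC_\phi(V,A)$ be the set of even $\xi\in A_+\otimes\Pi V$ with $$d'(\xi)-\varepsilon\sum_{n\ge2}\frac1{n!}\,\phi(m_n)(\xi,\dots,\xi)=0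 .$$ **Theorem.** Let $(A\otimes V,d)$ be a formal Block module. Restriction to $\mathcal O\subset\mathrm{Tw}\,\mathcal O$, together with evaluation at $x$, gives a bijection between * Block $\mathrm{Tw}\,\mathcal O$-algebra structures on $(A\otimes V,d)$, and * triples consisting of a formal Block module $(A\otimes V,d')$, a Block $\mathcal O$-algebra structure on it, and $\xi\in MC_\phi(V,A)$ for this structure, such that $d$ is the MC-twisted differential $$d=d'-\varepsilon\sum_{n\ge1}\frac1{n!}\,\phi(m_{n+1})(\xi,\dots,\xi,-).$$ -/

import Mathlib

open scoped TensorProduct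

namespace BlockTw

universe u v w

/-- The sign `(-1)^p` for `p : ℤ/2`. -/
def sgn (p : ZMod 2) : ℤ := if p = 0 then 1 else -1

theorem sgn_add (p q : ZMod 2) : sgn (p + q) = sgn p * sgn q := by
  revert p q; decide

theorem sgn_aux₁ (p q t : ZMod 2) :
    sgn p * sgn ((q + 1) * t) = sgn (q * t) * (sgn p * sgn t) := by
  revert p q t; decide

theorem sgn_aux₂ (p q t : ZMod 2) :
    sgn p * sgn q * sgn (q * (t + 1)) = sgn (q * t) * sgn p := by
  revert p q t; decide

/-! ### Operads

All spaces are `ℤ/2`-graded; an operad has a space of operations for every parity and arity.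
Partial compositions are indexed by slots counted from `0`; the composite of operations of
arities `a` and `b` has arity `r = a + b - 1`, written `r + 1 = a + b`. -/

/-- The position, among the inputs of `f ∘_i g`, of the `b`-th input of `g`. -/
def innerIdx {a b r : ℕ} (i : Fin a) (h : r + 1 = a + b) (j : Fin b) : Fin r :=
  ⟨i + j, by have := i.2; have := j.2; omega⟩

/-- The position, among the inputs of `f ∘_i g`, of the input `j ≠ i` of `f`. -/
def outerIdx {a b r : ℕ} (i : Fin a) (h : r + 1 = a + b) (j : Fin a) (hj : j ≠ i) : Fin r :=
  if hlt : j < i then ⟨j, by have := i.2; have h2 : j.1 < i.1 := hlt; omega⟩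
  else ⟨j - 1 + b, by
    have := j.2
    have h2 : ¬ j.1 < i.1 := hlt
    have h3 : j.1 ≠ i.1 := fun e => hj (Fin.ext e)
    omega⟩

/-- The operations of a (non-unital, symmetric) operad in `ℤ/2`-graded vector spaces together with
an odd operator `d`, before any laws are imposed. -/
structure PreOperad (𝕜 : Type u) [Field 𝕜] where
  /-- the space of operations of parity `p` and arity `n` -/
  obj : ZMod 2 → ℕ → Type v
  [addCommGroup : ∀ p n, AddCommGroup (obj p n)]
  [module : ∀ p n, Module 𝕜 (obj p n)]
  /-- the action of the symmetric groups: `act σ f` has input `j` of `f` at position `σ j` -/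
  act : ∀ {p : ZMod 2} {n : ℕ}, Equiv.Perm (Fin n) → obj p n →ₗ[𝕜] obj p n
  /-- the partial composition `f ∘_i g` -/
  comp : ∀ {p q s : ZMod 2} {a b r : ℕ} (_ : Fin a) (_ : r + 1 = a + b) (_ : s = p + q),
    obj p a →ₗ[𝕜] obj q b →ₗ[𝕜] obj s r
  /-- the differential -/
  d : ∀ {p : ZMod 2} {n : ℕ}, obj p n →ₗ[𝕜] obj (p + 1) n

attribute [instance] PreOperad.addCommGroup PreOperad.module

/-- A dg operad (non-unital, symmetric, `ℤ/2`-graded). -/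
structure DGOperad (𝕜 : Type u) [Field 𝕜] extends PreOperad.{u, v} 𝕜 where
  act_one : ∀ {p n} (f : obj p n), act 1 f = f
  act_mul : ∀ {p n} (σ τ : Equiv.Perm (Fin n)) (f : obj p n), act (σ * τ) f = act σ (act τ f)
  /-- equivariance: `ρ` is the permutation of the inputs of `f ∘_i g` induced by `σ` and `τ` -/
  comp_act : ∀ {p q s a b r} (i : Fin a) (h : r + 1 = a + b) (hs : s = p + q)
    (σ : Equiv.Perm (Fin a)) (τ : Equiv.Perm (Fin b)) (ρ : Equiv.Perm (Fin r)),
    (∀ j, ρ (innerIdx i h j) = innerIdx (σ i) h (τ j)) →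
    (∀ j hj hj', ρ (outerIdx i h j hj) = outerIdx (σ i) h (σ j) hj') →
    ∀ (f : obj p a) (g : obj q b),
      comp (σ i) h hs (act σ f) (act τ g) = act ρ (comp i h hs f g)
  /-- sequential associativity `(f ∘_i g) ∘_{i+j} e = f ∘_i (g ∘_j e)` -/
  comp_seq : ∀ {p q t s₁ s₂ s a b c r₁ r₂ r} (i : Fin a) (j : Fin b) (l : Fin r₁)
    (h₁ : r₁ + 1 = a + b) (h₂ : r + 1 = r₁ + c) (h₃ : r₂ + 1 = b + c) (h₄ : r + 1 = a + r₂)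
    (e₁ : s₁ = p + q) (e₂ : s = s₁ + t) (e₃ : s₂ = q + t) (e₄ : s = p + s₂),
    l.1 = i.1 + j.1 → ∀ (f : obj p a) (g : obj q b) (e : obj t c),
      comp l h₂ e₂ (comp i h₁ e₁ f g) e = comp i h₄ e₄ f (comp j h₃ e₃ g e)
  /-- parallel associativity `(f ∘_i g) ∘_{j+b-1} e = (-1)^{|g||e|} (f ∘_j e) ∘_i g`, `i < j` -/
  comp_par : ∀ {p q t s₁ s₂ s a b c r₁ r₂ r} (i j : Fin a) (l : Fin r₁) (l' : Fin r₂)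
    (h₁ : r₁ + 1 = a + b) (h₂ : r + 1 = r₁ + c) (h₃ : r₂ + 1 = a + c) (h₄ : r + 1 = r₂ + b)
    (e₁ : s₁ = p + q) (e₂ : s = s₁ + t) (e₃ : s₂ = p + t) (e₄ : s = s₂ + q),
    i < j → l.1 + 1 = j.1 + b → l'.1 = i.1 → ∀ (f : obj p a) (g : obj q b) (e : obj t c),
      comp l h₂ e₂ (comp i h₁ e₁ f g) e
        = sgn (q * t) • comp l' h₄ e₄ (comp j h₃ e₃ f e) g
  d_act : ∀ {p n} (σ : Equiv.Perm (Fin n)) (f : obj p n), d (act σ f) = act σ (d f)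
  d_comp : ∀ {p q s a b r} (i : Fin a) (h : r + 1 = a + b) (hs : s = p + q)
    (e₁ : s + 1 = (p + 1) + q) (e₂ : s + 1 = p + (q + 1)) (f : obj p a) (g : obj q b),
    d (comp i h hs f g) = comp i h e₁ (d f) g + sgn p • comp i h e₂ f (d g)
  d_d : ∀ {p n} (f : obj p n), d (d f) = 0

/-- A map of dg operads. -/
structure PreOperad.Hom {𝕜 : Type u} [Field 𝕜] (P : PreOperad.{u, v} 𝕜)
    (Q : PreOperad.{u, w} 𝕜) where
  toFun : ∀ {p n}, P.obj p n →ₗ[𝕜] Q.obj p n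
  map_act : ∀ {p n} (σ : Equiv.Perm (Fin n)) (f : P.obj p n),
    toFun (P.act σ f) = Q.act σ (toFun f)
  map_comp : ∀ {p q s a b r} (i : Fin a) (h : r + 1 = a + b) (hs : s = p + q)
    (f : P.obj p a) (g : P.obj q b),
    toFun (P.comp i h hs f g) = Q.comp i h hs (toFun f) (toFun g)
  map_d : ∀ {p n} (f : P.obj p n), toFun (P.d f) = Q.d (toFun f)

/-- Twisting by an odd unary operation `α`: the new differential is `d + δ_α`, where
`δ_α z = α ∘ z - (-1)^{|z|} ∑ i, z ∘_i α`. -/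
def PreOperad.twist {𝕜 : Type u} [Field 𝕜] (P : PreOperad.{u, v} 𝕜) (α : P.obj 1 1) :
    PreOperad.{u, v} 𝕜 where
  obj := P.obj
  act := P.act
  comp := P.comp
  d {p n} := P.d + P.comp (0 : Fin 1) (Nat.add_comm n 1) (add_comm p 1) α
    - sgn p • ∑ i : Fin n, (P.comp i rfl rfl).flip α

/-! ### Operads given by generators and relations -/

/-- Formal composites of generators. -/
inductive OpTree (G : ZMod 2 → ℕ → Type v) : ZMod 2 → ℕ → Type v
  | gen {p : ZMod 2} {n : ℕ} (g : G p n) : OpTree G p n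
  | act {p : ZMod 2} {n : ℕ} (σ : Equiv.Perm (Fin n)) (t : OpTree G p n) : OpTree G p n
  | comp {p q s : ZMod 2} {a b r : ℕ} (i : Fin a) (h : r + 1 = a + b) (hs : s = p + q)
      (t : OpTree G p a) (t' : OpTree G q b) : OpTree G s r

section Presentation

variable (𝕜 : Type u) [Field 𝕜] (G : ZMod 2 → ℕ → Type v)

/-- Linear combinations of formal composites. -/
abbrev Free (p : ZMod 2) (n : ℕ) : Type (max u v) := OpTree G p n →₀ 𝕜

variable {G} in
/-- A formal composite as a linear combination. -/
noncomputable def tr {p : ZMod 2} {n : ℕ} (t : OpTree G p n) : Free 𝕜 G p n := Finsupp.single t 1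

/-- The action of permutations on linear combinations of formal composites. -/
noncomputable def freeAct {p : ZMod 2} {n : ℕ} (σ : Equiv.Perm (Fin n)) :
    Free 𝕜 G p n →ₗ[𝕜] Free 𝕜 G p n :=
  Finsupp.lmapDomain 𝕜 𝕜 (OpTree.act σ)

/-- The bilinear partial composition of linear combinations of formal composites. -/
noncomputable def freeComp {p q s : ZMod 2} {a b r : ℕ} (i : Fin a) (h : r + 1 = a + b)
    (hs : s = p + q) : Free 𝕜 G p a →ₗ[𝕜] Free 𝕜 G q b →ₗ[𝕜] Free 𝕜 G s r :=
  Finsupp.linearCombination 𝕜 fun t => Finsupp.lmapDomain 𝕜 𝕜 (OpTree.comp i h hs t)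

variable {𝕜 G}

/-- The consequences of the relations `x = 0`, for `R p n x`, and of the operad axioms. -/
inductive Rel (R : ∀ p n, Free 𝕜 G p n → Prop) : ∀ {p : ZMod 2} {n : ℕ}, Free 𝕜 G p n → Prop
  | base {p n} {x : Free 𝕜 G p n} (hx : R p n x) : Rel R x
  | act_one {p n} (t : OpTree G p n) : Rel R (tr 𝕜 (.act 1 t) - tr 𝕜 t)
  | act_mul {p n} (σ τ : Equiv.Perm (Fin n)) (t : OpTree G p n) :
      Rel R (tr 𝕜 (.act (σ * τ) t) - tr 𝕜 (.act σ (.act τ t)))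
  | comp_act {p q s a b r} (i : Fin a) (h : r + 1 = a + b) (hs : s = p + q)
      (σ : Equiv.Perm (Fin a)) (τ : Equiv.Perm (Fin b)) (ρ : Equiv.Perm (Fin r))
      (h₁ : ∀ j, ρ (innerIdx i h j) = innerIdx (σ i) h (τ j))
      (h₂ : ∀ j hj hj', ρ (outerIdx i h j hj) = outerIdx (σ i) h (σ j) hj')
      (t : OpTree G p a) (t' : OpTree G q b) :
      Rel R (tr 𝕜 (.comp (σ i) h hs (.act σ t) (.act τ t')) - tr 𝕜 (.act ρ (.comp i h hs t t')))
  | comp_seq {p q t s₁ s₂ s a b c r₁ r₂ r} (i : Fin a) (j : Fin b) (l : Fin r₁)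
      (h₁ : r₁ + 1 = a + b) (h₂ : r + 1 = r₁ + c) (h₃ : r₂ + 1 = b + c) (h₄ : r + 1 = a + r₂)
      (e₁ : s₁ = p + q) (e₂ : s = s₁ + t) (e₃ : s₂ = q + t) (e₄ : s = p + s₂)
      (hl : l.1 = i.1 + j.1) (x : OpTree G p a) (y : OpTree G q b) (z : OpTree G t c) :
      Rel R (tr 𝕜 (.comp l h₂ e₂ (.comp i h₁ e₁ x y) z)
        - tr 𝕜 (.comp i h₄ e₄ x (.comp j h₃ e₃ y z)))
  | comp_par {p q t s₁ s₂ s a b c r₁ r₂ r} (i j : Fin a) (l : Fin r₁) (l' : Fin r₂)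
      (h₁ : r₁ + 1 = a + b) (h₂ : r + 1 = r₁ + c) (h₃ : r₂ + 1 = a + c) (h₄ : r + 1 = r₂ + b)
      (e₁ : s₁ = p + q) (e₂ : s = s₁ + t) (e₃ : s₂ = p + t) (e₄ : s = s₂ + q)
      (hij : i < j) (hl : l.1 + 1 = j.1 + b) (hl' : l'.1 = i.1)
      (x : OpTree G p a) (y : OpTree G q b) (z : OpTree G t c) :
      Rel R (tr 𝕜 (.comp l h₂ e₂ (.comp i h₁ e₁ x y) z)
        - sgn (q * t) • tr 𝕜 (.comp l' h₄ e₄ (.comp j h₃ e₃ x z) y))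
  | act {p n} (σ : Equiv.Perm (Fin n)) {x : Free 𝕜 G p n} (hx : Rel R x) :
      Rel R (freeAct 𝕜 G σ x)
  | comp_left {p q s a b r} (i : Fin a) (h : r + 1 = a + b) (hs : s = p + q)
      {x : Free 𝕜 G p a} (hx : Rel R x) (t : OpTree G q b) :
      Rel R (freeComp 𝕜 G i h hs x (tr 𝕜 t))
  | comp_right {p q s a b r} (i : Fin a) (h : r + 1 = a + b) (hs : s = p + q)
      (t : OpTree G p a) {x : Free 𝕜 G q b} (hx : Rel R x) :
      Rel R (freeComp 𝕜 G i h hs (tr 𝕜 t) x)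

variable (R : ∀ p n, Free 𝕜 G p n → Prop)

/-- The operadic ideal generated by the relations. -/
noncomputable def presIdeal (p : ZMod 2) (n : ℕ) : Submodule 𝕜 (Free 𝕜 G p n) :=
  Submodule.span 𝕜 {x | Rel R x}

/-- The operad with generators `G` and relations `R`. -/
abbrev Pres (p : ZMod 2) (n : ℕ) : Type (max u v) := Free 𝕜 G p n ⧸ presIdeal R p n

variable {R}

/-- The class of a formal composite. -/
noncomputable def cls {p : ZMod 2} {n : ℕ} (t : OpTree G p n) : Pres R p n :=
  (presIdeal R p n).mkQ (tr 𝕜 t)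

theorem Pres.induct {p : ZMod 2} {n : ℕ} {M : Pres R p n → Prop} (x : Pres R p n)
    (h0 : M 0) (ha : ∀ x y, M x → M y → M (x + y)) (hs : ∀ (c : 𝕜) x, M x → M (c • x))
    (ht : ∀ t, M (cls t)) : M x := by
  obtain ⟨y, rfl⟩ := (presIdeal R p n).mkQ_surjective x
  induction y using Finsupp.induction_linear with
  | zero => simpa using h0
  | add f g hf hg => rw [map_add]; exact ha _ _ hf hg
  | single t c =>
    have : (Finsupp.single t c : Free 𝕜 G p n) = c • tr 𝕜 t := by simp [tr]
    rw [this, map_smul]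
    exact hs _ _ (ht t)

theorem freeAct_tr {p : ZMod 2} {n : ℕ} (σ : Equiv.Perm (Fin n)) (t : OpTree G p n) :
    freeAct 𝕜 G σ (tr 𝕜 t) = tr 𝕜 (.act σ t) := by
  simp [freeAct, tr]

theorem freeComp_tr {p q s : ZMod 2} {a b r : ℕ} (i : Fin a) (h : r + 1 = a + b)
    (hs : s = p + q) (t : OpTree G p a) (t' : OpTree G q b) :
    freeComp 𝕜 G i h hs (tr 𝕜 t) (tr 𝕜 t') = tr 𝕜 (.comp i h hs t t') := by
  simp [freeComp, tr]

theorem Free.induct {p : ZMod 2} {n : ℕ} {M : Free 𝕜 G p n → Prop} (x : Free 𝕜 G p n)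
    (h0 : M 0) (ha : ∀ x y, M x → M y → M (x + y)) (hs : ∀ (c : 𝕜) x, M x → M (c • x))
    (ht : ∀ t, M (tr 𝕜 t)) : M x := by
  induction x using Finsupp.induction_linear with
  | zero => exact h0
  | add f g hf hg => exact ha _ _ hf hg
  | single t c =>
    have : (Finsupp.single t c : Free 𝕜 G p n) = c • tr 𝕜 t := by simp [tr]
    rw [this]
    exact hs _ _ (ht t)

theorem mkQ_rel {p : ZMod 2} {n : ℕ} {x : Free 𝕜 G p n} (hx : Rel R x) :
    (presIdeal R p n).mkQ x = 0 := by
  rw [Submodule.mkQ_apply, Submodule.Quotient.mk_eq_zero]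
  exact Submodule.subset_span hx

theorem rel_comp_left {p q s : ZMod 2} {a b r : ℕ} (i : Fin a) (h : r + 1 = a + b)
    (hs : s = p + q) : presIdeal R p a ≤
      LinearMap.ker ((freeComp 𝕜 G i h hs).compr₂ (presIdeal R s r).mkQ) := by
  refine Submodule.span_le.2 fun x hx => ?_
  rw [SetLike.mem_coe, LinearMap.mem_ker]
  ext1 t
  ext1
  simpa [tr] using mkQ_rel (Rel.comp_left i h hs hx t)

theorem rel_comp_right {p q s : ZMod 2} {a b r : ℕ} (i : Fin a) (h : r + 1 = a + b)
    (hs : s = p + q) : presIdeal R q b ≤ LinearMap.ker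
      ((presIdeal R p a).liftQ ((freeComp 𝕜 G i h hs).compr₂ (presIdeal R s r).mkQ)
        (rel_comp_left i h hs)).flip := by
  refine Submodule.span_le.2 fun x hx => ?_
  rw [SetLike.mem_coe, LinearMap.mem_ker]
  ext1
  ext1 t
  ext1
  simpa [tr] using mkQ_rel (Rel.comp_right i h hs t hx)

theorem rel_act {p : ZMod 2} {n : ℕ} (σ : Equiv.Perm (Fin n)) :
    presIdeal R p n ≤ (presIdeal R p n).comap (freeAct 𝕜 G σ) :=
  Submodule.span_le.2 fun _ hx => Submodule.subset_span (Rel.act σ hx)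

/-- The action of permutations on a presented operad. -/
noncomputable def presAct {p : ZMod 2} {n : ℕ} (σ : Equiv.Perm (Fin n)) :
    Pres R p n →ₗ[𝕜] Pres R p n :=
  (presIdeal R p n).mapQ (presIdeal R p n) (freeAct 𝕜 G σ) (rel_act σ)

/-- The partial composition of a presented operad. -/
noncomputable def presComp {p q s : ZMod 2} {a b r : ℕ} (i : Fin a) (h : r + 1 = a + b)
    (hs : s = p + q) : Pres R p a →ₗ[𝕜] Pres R q b →ₗ[𝕜] Pres R s r :=
  ((presIdeal R q b).liftQ
    ((presIdeal R p a).liftQ ((freeComp 𝕜 G i h hs).compr₂ (presIdeal R s r).mkQ)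
      (rel_comp_left i h hs)).flip (rel_comp_right i h hs)).flip

theorem presAct_mkQ {p : ZMod 2} {n : ℕ} (σ : Equiv.Perm (Fin n)) (x : Free 𝕜 G p n) :
    presAct σ ((presIdeal R p n).mkQ x) = (presIdeal R p n).mkQ (freeAct 𝕜 G σ x) := rfl

theorem presComp_mkQ {p q s : ZMod 2} {a b r : ℕ} (i : Fin a) (h : r + 1 = a + b)
    (hs : s = p + q) (x : Free 𝕜 G p a) (y : Free 𝕜 G q b) :
    presComp i h hs ((presIdeal R p a).mkQ x) ((presIdeal R q b).mkQ y)
      = (presIdeal R s r).mkQ (freeComp 𝕜 G i h hs x y) := rfl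

theorem presAct_cls {p : ZMod 2} {n : ℕ} (σ : Equiv.Perm (Fin n)) (t : OpTree G p n) :
    presAct σ (cls (R := R) t) = cls (.act σ t) := by
  rw [cls, presAct_mkQ, freeAct_tr, cls]

theorem presComp_cls {p q s : ZMod 2} {a b r : ℕ} (i : Fin a) (h : r + 1 = a + b)
    (hs : s = p + q) (t : OpTree G p a) (t' : OpTree G q b) :
    presComp i h hs (cls (R := R) t) (cls t') = cls (.comp i h hs t t') := by
  rw [cls, cls, presComp_mkQ, freeComp_tr, cls]

theorem presAct_one {p : ZMod 2} {n : ℕ} (x : Pres R p n) : presAct 1 x = x := by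
  induction x using Pres.induct with
  | h0 => simp
  | ha x y hx hy => rw [map_add, hx, hy]
  | hs c x hx => rw [map_smul, hx]
  | ht t =>
    rw [presAct_cls]
    simpa [cls, sub_eq_zero] using mkQ_rel (Rel.act_one (R := R) t)

theorem presAct_mul {p : ZMod 2} {n : ℕ} (σ τ : Equiv.Perm (Fin n)) (x : Pres R p n) :
    presAct (σ * τ) x = presAct σ (presAct τ x) := by
  induction x using Pres.induct with
  | h0 => simp
  | ha x y hx hy => simp only [map_add, hx, hy]
  | hs c x hx => simp only [map_smul, hx]
  | ht t =>
    simp only [presAct_cls]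
    simpa [cls, sub_eq_zero] using mkQ_rel (Rel.act_mul (R := R) σ τ t)

theorem presComp_act {p q s : ZMod 2} {a b r : ℕ} (i : Fin a) (h : r + 1 = a + b)
    (hs : s = p + q) (σ : Equiv.Perm (Fin a)) (τ : Equiv.Perm (Fin b)) (ρ : Equiv.Perm (Fin r))
    (h₁ : ∀ j, ρ (innerIdx i h j) = innerIdx (σ i) h (τ j))
    (h₂ : ∀ j hj hj', ρ (outerIdx i h j hj) = outerIdx (σ i) h (σ j) hj')
    (x : Pres R p a) (y : Pres R q b) :
    presComp (σ i) h hs (presAct σ x) (presAct τ y) = presAct ρ (presComp i h hs x y) := by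
  induction x using Pres.induct with
  | h0 => simp
  | ha x y hx hy => simp only [map_add, LinearMap.add_apply, hx, hy]
  | hs c x hx => simp only [map_smul, LinearMap.smul_apply, hx]
  | ht t =>
    induction y using Pres.induct with
    | h0 => simp
    | ha x y hx hy => simp only [map_add, hx, hy]
    | hs c x hx => simp only [map_smul, hx]
    | ht t' =>
      simp only [presAct_cls, presComp_cls]
      simpa [cls, sub_eq_zero] using mkQ_rel (Rel.comp_act (R := R) i h hs σ τ ρ h₁ h₂ t t')

theorem presComp_seq {p q t s₁ s₂ s : ZMod 2} {a b c r₁ r₂ r : ℕ} (i : Fin a) (j : Fin b)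
    (l : Fin r₁)
    (h₁ : r₁ + 1 = a + b) (h₂ : r + 1 = r₁ + c) (h₃ : r₂ + 1 = b + c) (h₄ : r + 1 = a + r₂)
    (e₁ : s₁ = p + q) (e₂ : s = s₁ + t) (e₃ : s₂ = q + t) (e₄ : s = p + s₂)
    (hl : l.1 = i.1 + j.1) (x : Pres R p a) (y : Pres R q b) (z : Pres R t c) :
    presComp l h₂ e₂ (presComp i h₁ e₁ x y) z = presComp i h₄ e₄ x (presComp j h₃ e₃ y z) := by
  induction x using Pres.induct with
  | h0 => simp
  | ha x y hx hy => simp only [map_add, LinearMap.add_apply, hx, hy]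
  | hs c x hx => simp only [map_smul, LinearMap.smul_apply, hx]
  | ht x =>
    induction y using Pres.induct with
    | h0 => simp
    | ha x y hx hy => simp only [map_add, LinearMap.add_apply, hx, hy]
    | hs c x hx => simp only [map_smul, LinearMap.smul_apply, hx]
    | ht y =>
      induction z using Pres.induct with
      | h0 => simp
      | ha x y hx hy => simp only [map_add, hx, hy]
      | hs c x hx => simp only [map_smul, hx]
      | ht z =>
        simp only [presComp_cls]
        simpa [cls, sub_eq_zero] using
          mkQ_rel (Rel.comp_seq (R := R) i j l h₁ h₂ h₃ h₄ e₁ e₂ e₃ e₄ hl x y z)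

theorem presComp_par {p q t s₁ s₂ s : ZMod 2} {a b c r₁ r₂ r : ℕ} (i j : Fin a) (l : Fin r₁)
    (l' : Fin r₂)
    (h₁ : r₁ + 1 = a + b) (h₂ : r + 1 = r₁ + c) (h₃ : r₂ + 1 = a + c) (h₄ : r + 1 = r₂ + b)
    (e₁ : s₁ = p + q) (e₂ : s = s₁ + t) (e₃ : s₂ = p + t) (e₄ : s = s₂ + q)
    (hij : i < j) (hl : l.1 + 1 = j.1 + b) (hl' : l'.1 = i.1)
    (x : Pres R p a) (y : Pres R q b) (z : Pres R t c) :
    presComp l h₂ e₂ (presComp i h₁ e₁ x y) z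
      = sgn (q * t) • presComp l' h₄ e₄ (presComp j h₃ e₃ x z) y := by
  induction x using Pres.induct with
  | h0 => simp
  | ha x y hx hy => simp only [map_add, LinearMap.add_apply, hx, hy, smul_add]
  | hs c x hx => simp only [map_smul, LinearMap.smul_apply, hx, smul_comm c]
  | ht x =>
    induction y using Pres.induct with
    | h0 => simp
    | ha x y hx hy => simp only [map_add, LinearMap.add_apply, hx, hy, smul_add]
    | hs c x hx => simp only [map_smul, LinearMap.smul_apply, hx, smul_comm c]
    | ht y =>
      induction z using Pres.induct with
      | h0 => simp
      | ha x y hx hy => simp only [map_add, LinearMap.add_apply, hx, hy, smul_add]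
      | hs c x hx => simp only [map_smul, LinearMap.smul_apply, hx, smul_comm c]
      | ht z =>
        simp only [presComp_cls]
        simpa [cls, sub_eq_zero] using
          mkQ_rel (Rel.comp_par (R := R) i j l l' h₁ h₂ h₃ h₄ e₁ e₂ e₃ e₄ hij hl hl' x y z)

/-- The derivation with prescribed values `D` on generators, on formal composites. -/
noncomputable def treeD (D : ∀ {p n}, G p n → Pres R (p + 1) n) :
    ∀ {p n}, OpTree G p n → Pres R (p + 1) n
  | _, _, .gen g => D g
  | _, _, .act σ t => presAct σ (treeD D t)
  | _, _, .comp (p := p) (q := q) i h hs t t' =>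
      presComp i h (by rw [hs, add_right_comm]) (treeD D t) (cls t')
        + sgn p • presComp i h (by rw [hs, add_assoc]) (cls t) (treeD D t')

/-- The linear extension of `treeD`. -/
noncomputable def freeD (D : ∀ {p n}, G p n → Pres R (p + 1) n) {p : ZMod 2} {n : ℕ} :
    Free 𝕜 G p n →ₗ[𝕜] Pres R (p + 1) n :=
  Finsupp.linearCombination 𝕜 fun t => treeD D t

theorem freeD_tr (D : ∀ {p n}, G p n → Pres R (p + 1) n) {p : ZMod 2} {n : ℕ}
    (t : OpTree G p n) : freeD D (tr 𝕜 t) = treeD D t := by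
  simp [freeD, tr]

theorem freeD_act (D : ∀ {p n}, G p n → Pres R (p + 1) n) {p : ZMod 2} {n : ℕ}
    (σ : Equiv.Perm (Fin n)) (x : Free 𝕜 G p n) :
    freeD D (freeAct 𝕜 G σ x) = presAct σ (freeD D x) := by
  induction x using Free.induct with
  | h0 => simp
  | ha x y hx hy => simp only [map_add, hx, hy]
  | hs c x hx => simp only [map_smul, hx]
  | ht t => rw [freeAct_tr, freeD_tr, freeD_tr, treeD]

theorem freeD_comp (D : ∀ {p n}, G p n → Pres R (p + 1) n) {p q s : ZMod 2} {a b r : ℕ}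
    (i : Fin a) (h : r + 1 = a + b) (hs : s = p + q)
    (e₁ : s + 1 = (p + 1) + q) (e₂ : s + 1 = p + (q + 1))
    (x : Free 𝕜 G p a) (y : Free 𝕜 G q b) :
    freeD D (freeComp 𝕜 G i h hs x y)
      = presComp i h e₁ (freeD D x) ((presIdeal R q b).mkQ y)
        + sgn p • presComp i h e₂ ((presIdeal R p a).mkQ x) (freeD D y) := by
  induction x using Free.induct with
  | h0 => simp
  | ha x y hx hy => simp only [map_add, LinearMap.add_apply, hx, hy, smul_add]; abel
  | hs c x hx =>
    simp only [map_smul, LinearMap.smul_apply, hx, smul_add]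
    rw [smul_comm c (sgn p)]
  | ht t =>
    induction y using Free.induct with
    | h0 => simp
    | ha x y hx hy => simp only [map_add, hx, hy, smul_add]; abel
    | hs c x hx =>
      simp only [map_smul, hx, smul_add]
      rw [smul_comm c (sgn p)]
    | ht t' =>
      rw [freeComp_tr, freeD_tr, freeD_tr, freeD_tr, treeD]
      rfl

theorem freeD_rel (D : ∀ {p n}, G p n → Pres R (p + 1) n)
    (hD : ∀ p n x, R p n x → freeD D x = 0) {p : ZMod 2} {n : ℕ} {x : Free 𝕜 G p n}
    (hx : Rel R x) : freeD D x = 0 := by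
  induction hx with
  | base hx => exact hD _ _ _ hx
  | act_one t => simp only [map_sub, freeD_tr, treeD, presAct_one, sub_self]
  | act_mul σ τ t => simp only [map_sub, freeD_tr, treeD, presAct_mul, sub_self]
  | comp_act i h hs σ τ ρ h₁ h₂ t t' =>
    simp only [map_sub, freeD_tr, treeD, ← presAct_cls, map_add, map_zsmul,
      presComp_act i h _ σ τ ρ h₁ h₂, sub_self]
  | comp_seq i j l h₁ h₂ h₃ h₄ e₁ e₂ e₃ e₄ hl x y z =>
    rename_i p q t s₁ s₂ s a b c r₁ r₂ r
    subst e₁ e₃ e₂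
    simp only [map_sub, freeD_tr, treeD, ← presComp_cls, map_add, map_zsmul,
      LinearMap.add_apply, LinearMap.smul_apply, sgn_add]
    rw [presComp_seq (s₂ := q + t) i j l h₁ h₂ h₃ h₄ _ _ rfl (by ring) hl,
      presComp_seq (s₂ := q + t + 1) i j l h₁ h₂ h₃ h₄ _ _ (by ring) (by ring) hl,
      presComp_seq (s₂ := q + t + 1) i j l h₁ h₂ h₃ h₄ _ _ (by ring) (by ring) hl, sub_eq_zero]
    simp only [smul_add, mul_smul, add_assoc]
  | comp_par i j l l' h₁ h₂ h₃ h₄ e₁ e₂ e₃ e₄ hij hl hl' x y z =>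
    rename_i p q t s₁ s₂ s a b c r₁ r₂ r
    subst e₁ e₃ e₂
    simp only [map_sub, freeD_tr, treeD, ← presComp_cls, map_add, map_zsmul,
      LinearMap.add_apply, LinearMap.smul_apply, sgn_add]
    rw [presComp_par (s₂ := p + t + 1) i j l l' h₁ h₂ h₃ h₄ _ _ (by ring) (by ring) hij hl hl',
      presComp_par (s₂ := p + t) i j l l' h₁ h₂ h₃ h₄ _ _ rfl (by ring) hij hl hl',
      presComp_par (s₂ := p + t + 1) i j l l' h₁ h₂ h₃ h₄ _ _ (by ring) (by ring) hij hl hl',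
      sub_eq_zero]
    simp only [smul_add, smul_smul]
    rw [sgn_aux₁, sgn_aux₂]
    abel
  | act σ hx ih => rw [freeD_act, ih, map_zero]
  | comp_left i h hs hx t ih =>
    rw [freeD_comp D i h hs (by rw [hs, add_right_comm]) (by rw [hs, add_assoc]), ih,
      mkQ_rel hx]
    simp
  | comp_right i h hs t hx ih =>
    rw [freeD_comp D i h hs (by rw [hs, add_right_comm]) (by rw [hs, add_assoc]), ih,
      mkQ_rel hx]
    simp

/-- The derivation of a presented operad with prescribed values `D` on the generators; it exists
when `D` is compatible with the relations. -/
noncomputable def presD (D : ∀ {p n}, G p n → Pres R (p + 1) n)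
    (hD : ∀ p n x, R p n x → freeD D x = 0) {p : ZMod 2} {n : ℕ} :
    Pres R p n →ₗ[𝕜] Pres R (p + 1) n :=
  (presIdeal R p n).liftQ (freeD D) (Submodule.span_le.2 fun _ hx => freeD_rel D hD hx)

theorem presD_cls (D : ∀ {p n}, G p n → Pres R (p + 1) n)
    (hD : ∀ p n x, R p n x → freeD D x = 0) {p : ZMod 2} {n : ℕ} (t : OpTree G p n) :
    presD D hD (cls t) = treeD D t := by
  rw [← freeD_tr D t]; rfl

end Presentation

/-- The operad with generators `G` and relations `R`, with the derivation prescribed by `D`. -/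
noncomputable def presOperad {𝕜 : Type u} [Field 𝕜] {G : ZMod 2 → ℕ → Type v}
    {R : ∀ p n, Free 𝕜 G p n → Prop} (D : ∀ {p n}, G p n → Pres R (p + 1) n)
    (hD : ∀ p n x, R p n x → freeD D x = 0) : PreOperad.{u, max u v} 𝕜 where
  obj := Pres R
  act := presAct
  comp := presComp
  d := presD D hD

theorem Rel.mono {𝕜 : Type u} [Field 𝕜] {G : ZMod 2 → ℕ → Type v}
    {R R' : ∀ p n, Free 𝕜 G p n → Prop} (hR : ∀ p n x, R p n x → R' p n x)
    {p : ZMod 2} {n : ℕ} {x : Free 𝕜 G p n} (hx : Rel R x) : Rel R' x := by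
  induction hx with
  | base hx => exact .base (hR _ _ _ hx)
  | act_one t => exact .act_one t
  | act_mul σ τ t => exact .act_mul σ τ t
  | comp_act i h hs σ τ ρ h₁ h₂ t t' => exact .comp_act i h hs σ τ ρ h₁ h₂ t t'
  | comp_seq i j l h₁ h₂ h₃ h₄ e₁ e₂ e₃ e₄ hl x y z =>
    exact .comp_seq i j l h₁ h₂ h₃ h₄ e₁ e₂ e₃ e₄ hl x y z
  | comp_par i j l l' h₁ h₂ h₃ h₄ e₁ e₂ e₃ e₄ hij hl hl' x y z =>
    exact .comp_par i j l l' h₁ h₂ h₃ h₄ e₁ e₂ e₃ e₄ hij hl hl' x y z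
  | act σ hx ih => exact .act σ ih
  | comp_left i h hs hx t ih => exact .comp_left i h hs ih t
  | comp_right i h hs t hx ih => exact .comp_right i h hs t ih

/-! ### The operad `l_∞` -/

/-- The generators of `l_∞`: one odd operation `m_n` for every arity `n ≥ 2`. -/
inductive LGen : ZMod 2 → ℕ → Type
  | m {p : ZMod 2} {n : ℕ} (hp : p = 1) (hn : 2 ≤ n) : LGen p n

/-- The generators of `l_∞` are symmetric. -/
inductive LRel (𝕜 : Type u) [Field 𝕜] : ∀ p n, Free 𝕜 LGen p n → Prop
  | symm {p : ZMod 2} {n : ℕ} (hp : p = 1) (hn : 2 ≤ n) (σ : Equiv.Perm (Fin n)) :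
      LRel 𝕜 p n (tr 𝕜 (.act σ (.gen (.m hp hn))) - tr 𝕜 (.gen (.m hp hn)))

/-- The cobar differential
`d m_n = ε ∑ σ (m_{b+1} ∘_1 m_a)`, over `a + b = n` with `a ≥ 2`, `b ≥ 1` and all
`(a, b)`-shuffles `σ`. As the `m_n` are symmetric, the sum over shuffles is written as the sum over
all permutations divided by `a! b!`. -/
noncomputable def lInfD (𝕜 : Type u) [Field 𝕜] (ε : ℤˣ) :
    ∀ {p n}, LGen p n → Pres (LRel 𝕜) (p + 1) n
  | p, n, .m hp _ => (ε : ℤ) • ∑ a ∈ Finset.range n, if h : 2 ≤ a ∧ a < n then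
      ((a.factorial * (n - a).factorial : ℕ) : 𝕜)⁻¹ • ∑ σ : Equiv.Perm (Fin n),
        cls (.act σ (.comp (p := 1) (q := 1) (a := n - a + 1) (b := a) 0 (by omega) (by rw [hp])
          (.gen (.m rfl (by omega))) (.gen (.m rfl h.1))))
      else 0

theorem lInfD_rel (𝕜 : Type u) [Field 𝕜] (ε : ℤˣ) (p : ZMod 2) (n : ℕ) (x : Free 𝕜 LGen p n)
    (hx : LRel 𝕜 p n x) : freeD (lInfD 𝕜 ε) x = 0 := by
  obtain ⟨hp, hn, τ⟩ := hx
  rw [map_sub, freeD_tr, freeD_tr, sub_eq_zero]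
  simp only [treeD, lInfD, map_zsmul, map_sum]
  congr 1
  refine Finset.sum_congr rfl fun a _ => ?_
  split_ifs with h
  · simp only [map_smul, map_sum, ← presAct_cls, ← presAct_mul]
    congr 1
    exact Fintype.sum_equiv (Equiv.mulLeft τ) _ _ fun σ => rfl
  · simp

/-- The dg operad `l_∞`, for either sign `ε` of the cobar differential. -/
noncomputable def lInf (𝕜 : Type u) [Field 𝕜] (ε : ℤˣ) : PreOperad.{u, u} 𝕜 :=
  presOperad (lInfD 𝕜 ε) (lInfD_rel 𝕜 ε)

/-- The operation `m_n` of `l_∞`; its parity `p` is odd. -/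
noncomputable def lInfM (𝕜 : Type u) [Field 𝕜] (ε : ℤˣ) {p : ZMod 2} (n : ℕ) (hp : p = 1)
    (hn : 2 ≤ n) : (lInf 𝕜 ε).obj p n :=
  cls (R := LRel 𝕜) (.gen (.m hp hn))

/-! ### The operads `O_MC` and `Tw O` -/

section Adjoin

/-- The operations of `O`, and an even operation `x` of arity `0`. -/
inductive AdjGen (E : ZMod 2 → ℕ → Type v) : ZMod 2 → ℕ → Type v
  | old {p : ZMod 2} {n : ℕ} (f : E p n) : AdjGen E p n
  | x : AdjGen E 0 0

/-- The number of occurrences of `x`. -/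
def OpTree.weight {E : ZMod 2 → ℕ → Type v} : ∀ {p n}, OpTree (AdjGen E) p n → ℕ
  | _, _, .gen (.old _) => 0
  | _, _, .gen .x => 1
  | _, _, .act _ t => t.weight
  | _, _, .comp _ _ _ t t' => t.weight + t'.weight

/-- The formal composite `f ∘ (x ⊗ ⋯ ⊗ x)`, with `x` in the first `j` slots. -/
def plug {E : ZMod 2 → ℕ → Type v} {p : ZMod 2} :
    ∀ (j : ℕ) {r : ℕ}, OpTree (AdjGen E) p (r + j) → OpTree (AdjGen E) p r
  | 0, _, t => t
  | j + 1, r, t => plug j (r := r) (.comp (⟨j, by omega⟩ : Fin (r + (j + 1))) rfl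
      (add_zero p).symm t (.gen .x))

theorem weight_plug {E : ZMod 2 → ℕ → Type v} {p : ZMod 2} (j : ℕ) {r : ℕ}
    (t : OpTree (AdjGen E) p (r + j)) : (plug j t).weight = t.weight + j := by
  induction j with
  | zero => rfl
  | succ j ih => rw [plug, ih, OpTree.weight, OpTree.weight]; omega

variable {𝕜 : Type u} [Field 𝕜] (O : DGOperad.{u, v} 𝕜)

/-- The relations of `O[x]/(x^N)`: those of `O`, and the vanishing of all composites in which `x`
occurs at least `N` times. -/
inductive AdjRel (N : ℕ) : ∀ p n, Free 𝕜 (AdjGen O.obj) p n → Prop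
  | add {p n} (f g : O.obj p n) : AdjRel N p n
      (tr 𝕜 (.gen (.old (f + g))) - (tr 𝕜 (.gen (.old f)) + tr 𝕜 (.gen (.old g))))
  | smul {p n} (c : 𝕜) (f : O.obj p n) : AdjRel N p n
      (tr 𝕜 (.gen (.old (c • f))) - c • tr 𝕜 (.gen (.old f)))
  | act {p n} (σ : Equiv.Perm (Fin n)) (f : O.obj p n) : AdjRel N p n
      (tr 𝕜 (.gen (.old (O.act σ f))) - tr 𝕜 (.act σ (.gen (.old f))))
  | comp {p q s a b r} (i : Fin a) (h : r + 1 = a + b) (hs : s = p + q)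
      (f : O.obj p a) (g : O.obj q b) : AdjRel N s r
      (tr 𝕜 (.gen (.old (O.comp i h hs f g))) - tr 𝕜 (.comp i h hs (.gen (.old f)) (.gen (.old g))))
  | pow {p n} (t : OpTree (AdjGen O.obj) p n) (ht : N ≤ t.weight) : AdjRel N p n (tr 𝕜 t)

/-- The underlying spaces of `O[x]/(x^N)`. -/
abbrev Adj (N : ℕ) (p : ZMod 2) (n : ℕ) : Type (max u v) := Pres (AdjRel O N) p n

variable {O}

/-- The image of an operation of `O`. -/
noncomputable def old {N : ℕ} {p : ZMod 2} {n : ℕ} : O.obj p n →ₗ[𝕜] Adj O N p n where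
  toFun f := cls (.gen (.old f))
  map_add' f g := by
    simpa [cls, sub_eq_zero] using mkQ_rel (Rel.base (AdjRel.add (N := N) f g))
  map_smul' c f := by
    simpa [cls, sub_eq_zero] using mkQ_rel (Rel.base (AdjRel.smul (N := N) c f))

theorem old_act {N : ℕ} {p : ZMod 2} {n : ℕ} (σ : Equiv.Perm (Fin n)) (f : O.obj p n) :
    old (N := N) (O.act σ f) = presAct σ (old f) := by
  have := mkQ_rel (Rel.base (AdjRel.act (N := N) σ f))
  rw [map_sub, sub_eq_zero] at this
  exact this.trans (presAct_cls σ _).symm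

theorem old_comp {N : ℕ} {p q s : ZMod 2} {a b r : ℕ} (i : Fin a) (h : r + 1 = a + b)
    (hs : s = p + q) (f : O.obj p a) (g : O.obj q b) :
    old (N := N) (O.comp i h hs f g) = presComp i h hs (old f) (old g) := by
  have := mkQ_rel (Rel.base (AdjRel.comp (N := N) i h hs f g))
  rw [map_sub, sub_eq_zero] at this
  exact this.trans (presComp_cls i h hs _ _).symm

theorem cls_pow {N : ℕ} {p : ZMod 2} {n : ℕ} (t : OpTree (AdjGen O.obj) p n)
    (ht : N ≤ t.weight) : (cls t : Adj O N p n) = 0 :=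
  mkQ_rel (Rel.base (AdjRel.pow t ht))

variable {ε : ℤˣ} (φ : PreOperad.Hom (lInf 𝕜 ε) O.toPreOperad)

/-- The derivation of `O[x]/(x^N)` on generators: it is that of `O` on the operations of `O`, and
`d x = ε ∑_{k ≥ 2} (1/k!) φ(m_k) ∘ (x ⊗ ⋯ ⊗ x)`, where the terms with `k ≥ N` vanish. -/
noncomputable def adjD (N : ℕ) : ∀ {p n}, AdjGen O.obj p n → Adj O N (p + 1) n
  | _, _, .old f => old (O.d f)
  | _, _, .x => (ε : ℤ) • ∑ j ∈ Finset.range N, ((j + 2).factorial : 𝕜)⁻¹ •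
      cls (plug (j + 2) (.gen (.old (φ.toFun (lInfM 𝕜 ε (0 + (j + 2)) (zero_add 1)
        (by omega))))))

/-- The span of the composites in which `x` occurs at least `w` times. -/
noncomputable def wspan (O : DGOperad.{u, v} 𝕜) (N w : ℕ) (p : ZMod 2) (n : ℕ) :
    Submodule 𝕜 (Adj O N p n) :=
  Submodule.span 𝕜 (cls '' {t : OpTree (AdjGen O.obj) p n | w ≤ t.weight})

theorem wspan_act {N w : ℕ} {p : ZMod 2} {n : ℕ} (σ : Equiv.Perm (Fin n)) {y : Adj O N p n}
    (hy : y ∈ wspan O N w p n) : presAct σ y ∈ wspan O N w p n := by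
  suffices wspan O N w p n ≤ (wspan O N w p n).comap (presAct σ) from this hy
  refine Submodule.span_le.2 ?_
  rintro _ ⟨t, ht, rfl⟩
  exact Submodule.subset_span ⟨.act σ t, ht, (presAct_cls σ t).symm⟩

theorem wspan_comp_left {N w : ℕ} {p q s : ZMod 2} {a b r : ℕ} (i : Fin a) (h : r + 1 = a + b)
    (hs : s = p + q) {y : Adj O N p a} (hy : y ∈ wspan O N w p a)
    (t : OpTree (AdjGen O.obj) q b) :
    presComp i h hs y (cls t) ∈ wspan O N (w + t.weight) s r := by
  suffices wspan O N w p a ≤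
    (wspan O N (w + t.weight) s r).comap ((presComp i h hs).flip (cls t)) from this hy
  refine Submodule.span_le.2 ?_
  rintro _ ⟨u, hu, rfl⟩
  exact Submodule.subset_span ⟨.comp i h hs u t, Nat.add_le_add_right hu _,
    (presComp_cls i h hs u t).symm⟩

theorem wspan_comp_right {N w : ℕ} {p q s : ZMod 2} {a b r : ℕ} (i : Fin a) (h : r + 1 = a + b)
    (hs : s = p + q) (t : OpTree (AdjGen O.obj) p a) {y : Adj O N q b}
    (hy : y ∈ wspan O N w q b) :
    presComp i h hs (cls t) y ∈ wspan O N (t.weight + w) s r := by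
  suffices wspan O N w q b ≤
    (wspan O N (t.weight + w) s r).comap (presComp i h hs (cls t)) from this hy
  refine Submodule.span_le.2 ?_
  rintro _ ⟨u, hu, rfl⟩
  exact Submodule.subset_span ⟨.comp i h hs t u, Nat.add_le_add_left hu _,
    (presComp_cls i h hs t u).symm⟩

theorem treeD_mem (N : ℕ) {p : ZMod 2} {n : ℕ} (t : OpTree (AdjGen O.obj) p n) :
    treeD (adjD φ N) t ∈ wspan O N t.weight (p + 1) n := by
  induction t with
  | gen g =>
    cases g with
    | old f => exact Submodule.subset_span ⟨_, Nat.zero_le _, rfl⟩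
    | x =>
      simp only [treeD, adjD]
      refine zsmul_mem (Submodule.sum_mem _ fun j _ => Submodule.smul_mem _ _ ?_) _
      refine Submodule.subset_span ⟨_, ?_, rfl⟩
      change _ ≤ OpTree.weight _
      rw [weight_plug, OpTree.weight, OpTree.weight]
      omega
  | act σ t ih => exact wspan_act σ ih
  | comp i h hs t t' ih ih' =>
    simp only [treeD]
    exact add_mem (wspan_comp_left i h _ ih t') (zsmul_mem (wspan_comp_right i h _ t ih') _)

theorem wspan_eq_bot {N w : ℕ} (h : N ≤ w) (p : ZMod 2) (n : ℕ) : wspan O N w p n = ⊥ := by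
  rw [eq_bot_iff]
  refine Submodule.span_le.2 ?_
  rintro _ ⟨t, ht, rfl⟩
  exact cls_pow t (h.trans ht)

theorem adjD_rel (N : ℕ) (p : ZMod 2) (n : ℕ) (x : Free 𝕜 (AdjGen O.obj) p n)
    (hx : AdjRel O N p n x) : freeD (adjD φ N) x = 0 := by
  induction hx with
  | add f g => simp only [map_sub, map_add, freeD_tr, treeD, adjD, sub_self]
  | smul c f => simp only [map_sub, map_smul, freeD_tr, treeD, adjD, sub_self]
  | act σ f => simp only [map_sub, freeD_tr, treeD, adjD, O.d_act, old_act, sub_self]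
  | comp i h hs f g =>
    simp only [map_sub, freeD_tr, treeD, adjD]
    rw [O.d_comp i h hs (by rw [hs, add_right_comm]) (by rw [hs, add_assoc]), map_add, map_zsmul,
      old_comp, old_comp]
    exact sub_self _
  | pow t ht =>
    have := treeD_mem φ N t
    rw [wspan_eq_bot ht, Submodule.mem_bot] at this
    rw [freeD_tr, this]

theorem adj_le {N M : ℕ} (h : N ≤ M) (p : ZMod 2) (n : ℕ) :
    presIdeal (AdjRel O M) p n ≤ presIdeal (AdjRel O N) p n := by
  refine Submodule.span_mono fun x hx => Rel.mono (fun p n x hx => ?_) hx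
  cases hx with
  | add f g => exact .add f g
  | smul c f => exact .smul c f
  | act σ f => exact .act σ f
  | comp i h hs f g => exact .comp i h hs f g
  | pow t ht => exact .pow t (h.trans ht)

/-- The projection `O[x]/(x^M) → O[x]/(x^N)`, for `N ≤ M`. -/
noncomputable def adjProj {N M : ℕ} (h : N ≤ M) {p : ZMod 2} {n : ℕ} :
    Adj O M p n →ₗ[𝕜] Adj O N p n :=
  Submodule.factor (adj_le h p n)

theorem adjProj_cls {N M : ℕ} (h : N ≤ M) {p : ZMod 2} {n : ℕ}
    (t : OpTree (AdjGen O.obj) p n) : adjProj h (cls t) = cls t := rfl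

theorem adjProj_old {N M : ℕ} (h : N ≤ M) {p : ZMod 2} {n : ℕ} (f : O.obj p n) :
    adjProj h (old f) = old f := rfl

theorem adjProj_act {N M : ℕ} (h : N ≤ M) {p : ZMod 2} {n : ℕ} (σ : Equiv.Perm (Fin n))
    (y : Adj O M p n) : adjProj h (presAct σ y) = presAct σ (adjProj h y) := by
  induction y using Pres.induct with
  | h0 => simp
  | ha x y hx hy => simp only [map_add, hx, hy]
  | hs c x hx => simp only [map_smul, hx]
  | ht t => simp only [adjProj_cls, presAct_cls]

theorem adjProj_comp {N M : ℕ} (hNM : N ≤ M) {p q s : ZMod 2} {a b r : ℕ} (i : Fin a)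
    (h : r + 1 = a + b) (hs : s = p + q) (y : Adj O M p a) (z : Adj O M q b) :
    adjProj hNM (presComp i h hs y z) = presComp i h hs (adjProj hNM y) (adjProj hNM z) := by
  induction y using Pres.induct with
  | h0 => simp
  | ha x y hx hy => simp only [map_add, LinearMap.add_apply, hx, hy]
  | hs c x hx => simp only [map_smul, LinearMap.smul_apply, hx]
  | ht t =>
    induction z using Pres.induct with
    | h0 => simp
    | ha x y hx hy => simp only [map_add, hx, hy]
    | hs c x hx => simp only [map_smul, hx]
    | ht t' => simp only [adjProj_cls, presComp_cls]

theorem sum_range_pow {N M : ℕ} (h : N ≤ M) {p : ZMod 2} {n : ℕ} (k : ℕ → ℕ)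
    (hk : ∀ j, j ≤ k j) (c : ℕ → 𝕜) (t : ℕ → OpTree (AdjGen O.obj) p n)
    (ht : ∀ j, k j ≤ (t j).weight) :
    ∑ j ∈ Finset.range M, c j • (cls (t j) : Adj O N p n)
      = ∑ j ∈ Finset.range N, c j • (cls (t j) : Adj O N p n) := by
  symm
  refine Finset.sum_subset (Finset.range_mono h) fun j _ hj => ?_
  rw [Finset.mem_range, not_lt] at hj
  rw [cls_pow _ (hj.trans ((hk j).trans (ht j))), smul_zero]

theorem adjProj_treeD {N M : ℕ} (h : N ≤ M) {p : ZMod 2} {n : ℕ}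
    (t : OpTree (AdjGen O.obj) p n) :
    adjProj h (treeD (adjD φ M) t) = treeD (adjD φ N) t := by
  induction t with
  | gen g =>
    cases g with
    | old f => rfl
    | x =>
      simp only [treeD, adjD, map_zsmul, map_sum, map_smul, adjProj_cls]
      congr 1
      exact sum_range_pow h (fun j => j + 2) (fun j => by omega) _ _
        fun j => by rw [weight_plug]; omega
  | act σ t ih => simp only [treeD, adjProj_act, ih]
  | comp i h' hs t t' ih ih' =>
    simp only [treeD, map_add, map_zsmul, adjProj_comp, ih, ih', adjProj_cls]

theorem adjProj_d {N M : ℕ} (h : N ≤ M) {p : ZMod 2} {n : ℕ} (y : Adj O M p n) :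
    adjProj h (presD (adjD φ M) (adjD_rel φ M) y)
      = presD (adjD φ N) (adjD_rel φ N) (adjProj h y) := by
  induction y using Pres.induct with
  | h0 => simp
  | ha x y hx hy => simp only [map_add, hx, hy]
  | hs c x hx => simp only [map_smul, hx]
  | ht t => rw [presD_cls, adjProj_treeD, adjProj_cls, presD_cls]

/-- Sequences of elements of the `O[x]/(x^N)`. -/
def AdjSeq (O : DGOperad.{u, v} 𝕜) (p : ZMod 2) (n : ℕ) : Type (max u v) := ∀ N, Adj O N p n

noncomputable instance (p : ZMod 2) (n : ℕ) : AddCommGroup (AdjSeq O p n) :=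
  inferInstanceAs (AddCommGroup (∀ N, Adj O N p n))

noncomputable instance (p : ZMod 2) (n : ℕ) : Module 𝕜 (AdjSeq O p n) :=
  inferInstanceAs (Module 𝕜 (∀ N, Adj O N p n))

/-- The spaces of `O[[x]] = lim O[x]/(x^N)`: the compatible sequences. -/
noncomputable def powObj (O : DGOperad.{u, v} 𝕜) (p : ZMod 2) (n : ℕ) :
    Submodule 𝕜 (AdjSeq O p n) where
  carrier := {y | ∀ N M (h : N ≤ M), adjProj h (y M) = y N}
  zero_mem' _ _ _ := map_zero _
  add_mem' {y z} hy hz N M h :=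
    (map_add (adjProj h) (y M) (z M)).trans (congrArg₂ (· + ·) (hy N M h) (hz N M h))
  smul_mem' c y hy N M h :=
    (map_smul (adjProj h) c (y M)).trans (congrArg (c • ·) (hy N M h))

/-- The action of permutations on `O[[x]]`. -/
noncomputable def powAct {p : ZMod 2} {n : ℕ} (σ : Equiv.Perm (Fin n)) :
    powObj O p n →ₗ[𝕜] powObj O p n where
  toFun y := ⟨fun N => presAct σ (y.1 N), fun N M h => by rw [adjProj_act, y.2 N M h]⟩
  map_add' y z := Subtype.ext (funext fun N => map_add (presAct σ) (y.1 N) (z.1 N))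
  map_smul' c y := Subtype.ext (funext fun N => map_smul (presAct σ) c (y.1 N))

/-- The partial composition of `O[[x]]`. -/
noncomputable def powComp {p q s : ZMod 2} {a b r : ℕ} (i : Fin a) (h : r + 1 = a + b)
    (hs : s = p + q) : powObj O p a →ₗ[𝕜] powObj O q b →ₗ[𝕜] powObj O s r :=
  LinearMap.mk₂ 𝕜
    (fun y z => ⟨fun N => presComp i h hs (y.1 N) (z.1 N), fun N M hNM => by
      rw [adjProj_comp, y.2 N M hNM, z.2 N M hNM]⟩)
    (fun y y' z => Subtype.ext (funext fun N =>
      LinearMap.map_add₂ (presComp i h hs) (y.1 N) (y'.1 N) (z.1 N)))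
    (fun c y z => Subtype.ext (funext fun N =>
      LinearMap.map_smul₂ (presComp i h hs) c (y.1 N) (z.1 N)))
    (fun y z z' => Subtype.ext (funext fun N =>
      map_add (presComp i h hs (y.1 N)) (z.1 N) (z'.1 N)))
    (fun c y z => Subtype.ext (funext fun N =>
      map_smul (presComp i h hs (y.1 N)) c (z.1 N)))

/-- The differential of `O_MC`. -/
noncomputable def powD {p : ZMod 2} {n : ℕ} : powObj O p n →ₗ[𝕜] powObj O (p + 1) n where
  toFun y := ⟨fun N => presD (adjD φ N) (adjD_rel φ N) (y.1 N),
    fun N M h => by rw [adjProj_d, y.2 N M h]⟩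
  map_add' y z := Subtype.ext (funext fun N =>
    map_add (presD (adjD φ N) (adjD_rel φ N)) (y.1 N) (z.1 N))
  map_smul' c y := Subtype.ext (funext fun N =>
    map_smul (presD (adjD φ N) (adjD_rel φ N)) c (y.1 N))

/-- The operad `O_MC`: the operad `O[[x]]` with the derivation that extends that of `O` and has
`d x = ε ∑_{k ≥ 2} (1/k!) φ(m_k) ∘ (x ⊗ ⋯ ⊗ x)`. All operations are computed in the
quotients `O[x]/(x^N)`. -/
noncomputable def mcOperad : PreOperad.{u, max u v} 𝕜 where
  obj p n := powObj O p n
  act σ := powAct σ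
  comp i h hs := powComp i h hs
  d := powD φ

/-- The element `α = -ε ∑_{k ≥ 1} (1/k!) φ(m_{k+1}) ∘ (x ⊗ ⋯ ⊗ x)` of `O_MC(1)`, with `x` in the
first `k` slots. -/
noncomputable def twistElt : (mcOperad φ).obj 1 1 :=
  ⟨fun N => -((ε : ℤ) • ∑ j ∈ Finset.range N, ((j + 1).factorial : 𝕜)⁻¹ •
      cls (plug (j + 1) (.gen (.old (φ.toFun (lInfM 𝕜 ε (1 + (j + 1)) rfl (by omega))))))),
    fun N M h => by
      simp only [map_neg, map_zsmul, map_sum, map_smul, adjProj_cls]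
      congr 2
      exact sum_range_pow h (fun j => j + 1) (fun j => by omega) _ _
        fun j => by rw [weight_plug]; omega⟩

/-- The operad `Tw O`, the twist of `O_MC` by `α`. -/
noncomputable def twOperad : PreOperad.{u, max u v} 𝕜 := (mcOperad φ).twist (twistElt φ)

/-- The inclusion of the operations of `O`. -/
noncomputable def twOld {p : ZMod 2} {n : ℕ} (f : O.obj p n) : (twOperad φ).obj p n :=
  (⟨fun _ => old f, fun _ _ _ => rfl⟩ : powObj O p n)

/-- The operation `x`. -/
noncomputable def twX : (twOperad φ).obj 0 0 :=
  (⟨fun _ => cls (.gen .x), fun _ _ _ => rfl⟩ : powObj O 0 0)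

end Adjoin

/-! ### Formal cdgas, dg vector spaces and Block modules -/

/-- A dg vector space (`ℤ/2`-graded). -/
structure DGSpace (𝕜 : Type u) [Field 𝕜] where
  carrier : Type v
  [addCommGroup : AddCommGroup carrier]
  [module : Module 𝕜 carrier]
  gr : ZMod 2 → Submodule 𝕜 carrier
  [decomposition : DirectSum.Decomposition gr]
  d : carrier →ₗ[𝕜] carrier
  d_mem : ∀ {p v}, v ∈ gr p → d v ∈ gr (p + 1)
  d_d : ∀ v, d (d v) = 0

attribute [instance] DGSpace.addCommGroup DGSpace.module DGSpace.decomposition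

/-- A formal (unital) cdga: `A = 𝕜 ⊕ A_+`, and the non-unital cdga `A_+` is the inverse limit of
the finite-dimensional nilpotent cdgas `A_+ / K i`, for a directed family of dg ideals `K i`. -/
structure FormalCDGA (𝕜 : Type u) [Field 𝕜] where
  carrier : Type v
  [ring : Ring carrier]
  [nontrivial : Nontrivial carrier]
  [algebra : Algebra 𝕜 carrier]
  gr : ZMod 2 → Submodule 𝕜 carrier
  [graded : GradedAlgebra gr]
  comm : ∀ {p q a b}, a ∈ gr p → b ∈ gr q → a * b = sgn (p * q) • (b * a)
  d : carrier →ₗ[𝕜] carrier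
  d_mem : ∀ {p a}, a ∈ gr p → d a ∈ gr (p + 1)
  d_mul : ∀ {p a b}, a ∈ gr p → d (a * b) = d a * b + sgn p • (a * d b)
  d_d : ∀ a, d (d a) = 0
  /-- the augmentation ideal `A_+` -/
  aug : Ideal carrier
  aug_homogeneous : aug.IsHomogeneous gr
  aug_isCompl : IsCompl (1 : Submodule 𝕜 carrier) (aug.restrictScalars 𝕜)
  aug_d : ∀ a ∈ aug, d a ∈ aug
  /-- the indices of the inverse system -/
  index : Type w
  [nonempty : Nonempty index]
  /-- the kernels of the projections of `A` to the terms of the inverse system -/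
  K : index → Ideal carrier
  K_directed : Directed (· ≥ ·) K
  K_le : ∀ i, K i ≤ aug
  K_homogeneous : ∀ i, (K i).IsHomogeneous gr
  K_d : ∀ i, ∀ a ∈ K i, d a ∈ K i
  K_finite : ∀ i, FiniteDimensional 𝕜 (carrier ⧸ (K i).restrictScalars 𝕜)
  K_nilpotent : ∀ i, ∃ m : ℕ, ∀ l : List carrier, l.length = m → (∀ a ∈ l, a ∈ aug) →
    l.prod ∈ K i
  separated : ∀ a, (∀ i, a ∈ K i) → a = 0
  complete : ∀ b : index → carrier, (∀ i j, K j ≤ K i → b j - b i ∈ K i) →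
    ∃ a, ∀ i, a - b i ∈ K i

attribute [instance] FormalCDGA.ring FormalCDGA.nontrivial FormalCDGA.algebra FormalCDGA.graded
  FormalCDGA.nonempty

section Block

variable {𝕜 : Type u} [Field 𝕜]

/-- The terms `A/K i ⊗ V` of the inverse system that defines `A ⊗ V`. -/
abbrev Level (A : FormalCDGA 𝕜) (V : DGSpace 𝕜) (i : A.index) : Type _ :=
  (A.carrier ⧸ A.K i) ⊗[𝕜] V.carrier

/-- Families of elements of the `A/K i ⊗ V`. -/
def LevelSeq (A : FormalCDGA 𝕜) (V : DGSpace 𝕜) : Type _ := ∀ i, Level A V i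

variable (A : FormalCDGA 𝕜) (V : DGSpace 𝕜)

noncomputable instance : AddCommGroup (LevelSeq A V) :=
  inferInstanceAs (AddCommGroup (∀ i, Level A V i))

noncomputable instance : Module 𝕜 (LevelSeq A V) :=
  inferInstanceAs (Module 𝕜 (∀ i, Level A V i))

noncomputable instance : Module A.carrier (LevelSeq A V) :=
  inferInstanceAs (Module A.carrier (∀ i, Level A V i))

instance : IsScalarTower 𝕜 A.carrier (LevelSeq A V) :=
  inferInstanceAs (IsScalarTower 𝕜 A.carrier (∀ i, Level A V i))

variable {A} in
/-- The transition map `A/K j ⊗ V → A/K i ⊗ V`, for `K j ≤ K i`. -/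
noncomputable def levelProj {i j : A.index} (h : A.K j ≤ A.K i) :
    Level A V j →ₗ[A.carrier] Level A V i :=
  TensorProduct.AlgebraTensorModule.map (Submodule.factor h) LinearMap.id

/-- The `A`-module `A ⊗ V`, which for formal `A` means the inverse limit of the `A/K i ⊗ V`. -/
noncomputable def tensorSub : Submodule A.carrier (LevelSeq A V) where
  carrier := {w | ∀ i j (h : A.K j ≤ A.K i), levelProj V h (w j) = w i}
  zero_mem' _ _ _ := map_zero _
  add_mem' {y z} hy hz i j h :=
    (map_add (levelProj V h) (y j) (z j)).trans (congrArg₂ (· + ·) (hy i j h) (hz i j h))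
  smul_mem' c y hy i j h :=
    (map_smul (levelProj V h) c (y j)).trans (congrArg (c • ·) (hy i j h))

/-- The underlying space of `A ⊗ V`, and also that of `A ⊗ ΠV`. -/
abbrev Tens : Type _ := tensorSub A V

/-- The inclusion `v ↦ 1 ⊗ v`. -/
noncomputable def incl (v : V.carrier) : Tens A V :=
  ⟨fun i => (Submodule.Quotient.mk 1 : A.carrier ⧸ A.K i) ⊗ₜ[𝕜] v, fun i j h => by
    simp [levelProj]⟩

/-- For a subspace `S` of `A` and a subspace `T` of `V`, the elements of `A/K i ⊗ V` which come
from `S ⊗ T`. -/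
noncomputable def levelTens (i : A.index) (S : Submodule 𝕜 A.carrier)
    (T : Submodule 𝕜 V.carrier) : Submodule 𝕜 (Level A V i) :=
  Submodule.map₂ (TensorProduct.mk 𝕜 (A.carrier ⧸ A.K i) V.carrier)
    (S.map ((A.K i).mkQ.restrictScalars 𝕜)) T

/-- The elements of `A ⊗ V` of parity `p`. -/
def Homog (p : ZMod 2) (w : Tens A V) : Prop :=
  ∀ i, w.1 i ∈ ⨆ q : ZMod 2, levelTens A V i (A.gr q) (V.gr (p - q))

/-- The elements of `A ⊗ ΠV` of parity `p`; the parity of `ΠV` is opposite to that of `V`. -/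
def PiHomog (p : ZMod 2) (w : Tens A V) : Prop := Homog A V (p + 1) w

/-- The subspace `A_+ ⊗ V` of `A ⊗ V`. -/
def InPlus (w : Tens A V) : Prop :=
  ∀ i, w.1 i ∈ levelTens A V i (A.aug.restrictScalars 𝕜) ⊤

/-- `w` is the limit of the sequence `u`, in the topology of the inverse limit. -/
def ConvTo (u : ℕ → Tens A V) (w : Tens A V) : Prop :=
  ∀ i, ∀ᶠ N in Filter.atTop, (u N).1 i = w.1 i

/-- `(A ⊗ V, d)` is a formal Block module. -/
structure IsBlock (d : Tens A V →ₗ[𝕜] Tens A V) : Prop where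
  odd : ∀ p w, Homog A V p w → Homog A V (p + 1) (d w)
  leibniz : ∀ q (a : A.carrier) w, a ∈ A.gr q → d (a • w) = A.d a • w + sgn q • (a • d w)
  square : ∀ w, d (d w) = 0
  continuous : ∀ i, ∃ j, ∀ w : Tens A V, w.1 j = 0 → (d w).1 i = 0
  formal : ∀ v, InPlus A V (d (incl A V v) - incl A V (V.d v))

/-- The operations of parity `p` and arity `n` of the operad `End_A(A ⊗ ΠV)`: the continuous
`A`-multilinear maps `(A ⊗ ΠV)^n → A_+ ⊗ ΠV`. -/
structure IsEndA (p : ZMod 2) {n : ℕ}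
    (f : MultilinearMap 𝕜 (fun _ : Fin n => Tens A V) (Tens A V)) : Prop where
  parity : ∀ (c : Fin n → ZMod 2) w, (∀ j, PiHomog A V (c j) (w j)) →
    PiHomog A V (p + ∑ j, c j) (f w)
  multilinear : ∀ (c : Fin n → ZMod 2) w, (∀ j, PiHomog A V (c j) (w j)) →
    ∀ (q : ZMod 2) (a : A.carrier), a ∈ A.gr q → ∀ j,
      f (Function.update w j (a • w j))
        = sgn (q * (p + ∑ l with l < j, c l)) • (a • f w)
  plus : ∀ w, InPlus A V (f w)
  continuous : ∀ w i, ∃ j, ∀ w' : Fin n → Tens A V, (∀ l, (w' l).1 j = (w l).1 j) →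
    (f w').1 i = (f w).1 i

/-- The Koszul sign of the reordering `(w₁, …, wₙ) ↦ (w_{σ 1}, …, w_{σ n})` of elements of
parities `c`. -/
def koszul {n : ℕ} (σ : Equiv.Perm (Fin n)) (c : Fin n → ZMod 2) : ℤ :=
  ∏ i, ∏ j, if i < j ∧ σ j < σ i then sgn (c (σ i) * c (σ j)) else 1

variable {A V}

/-- A Block `P`-algebra structure on `(A ⊗ V, d)`: a map of dg operads from `P` to
`End_A(A ⊗ ΠV, d)`. The operations of the endomorphism operad are given by the usual formulas, with
Koszul signs, on homogeneous arguments. -/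
structure BlockAlg (P : PreOperad.{u, v} 𝕜) (d : Tens A V →ₗ[𝕜] Tens A V) where
  op : ∀ {p n}, P.obj p n →ₗ[𝕜] MultilinearMap 𝕜 (fun _ : Fin n => Tens A V) (Tens A V)
  mem : ∀ {p n} (f : P.obj p n), IsEndA A V p (op f)
  map_act : ∀ {p n} (σ : Equiv.Perm (Fin n)) (f : P.obj p n) (c : Fin n → ZMod 2) w,
    (∀ j, PiHomog A V (c j) (w j)) → op (P.act σ f) w = koszul σ c • op f (fun j => w (σ j))
  map_comp : ∀ {p q s a b r} (i : Fin a) (h : r + 1 = a + b) (hs : s = p + q)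
    (f : P.obj p a) (g : P.obj q b) (c : Fin r → ZMod 2) w, (∀ j, PiHomog A V (c j) (w j)) →
      op (P.comp i h hs f g) w = sgn (q * ∑ l with l.1 < i.1, c l) •
        op f (fun j => if hj : j = i then op g (fun k => w (innerIdx i h k))
          else w (outerIdx i h j hj))
  map_d : ∀ {p n} (f : P.obj p n) (c : Fin n → ZMod 2) w, (∀ j, PiHomog A V (c j) (w j)) →
    op (P.d f) w = d (op f w)
      - sgn p • ∑ j, sgn (∑ l with l < j, c l) • op f (Function.update w j (d (w j)))

variable {O : DGOperad.{u, v} 𝕜} {ε : ℤˣ} (φ : PreOperad.Hom (lInf 𝕜 ε) O.toPreOperad)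

/-- A Block `Tw O`-algebra structure on `(A ⊗ V, d)`. As `Tw O` is a topological operad, the
map to `A_+ ⊗ End(ΠV)` is required to be continuous. -/
structure TwBlockAlg (d : Tens A V →ₗ[𝕜] Tens A V) extends BlockAlg (twOperad φ) d where
  continuous : ∀ (p : ZMod 2) (n : ℕ) (i : A.index), ∃ N, ∀ y : powObj O p n, y.1 N = 0 →
    ∀ w, (op (p := p) (n := n) y w).1 i = 0

/-- The action of `φ(m_n)` in a Block `O`-algebra. -/
noncomputable def mOp {d : Tens A V →ₗ[𝕜] Tens A V} (g : BlockAlg O.toPreOperad d) (n : ℕ)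
    (hn : 2 ≤ n) : MultilinearMap 𝕜 (fun _ : Fin n => Tens A V) (Tens A V) :=
  g.op (φ.toFun (lInfM 𝕜 ε n (p := 1) rfl hn))

/-- The set `MC_φ(V, A)` of a Block `O`-algebra: the even elements `ξ` of `A_+ ⊗ ΠV` with
`d ξ - ε ∑_{k ≥ 2} (1/k!) φ(m_k)(ξ, …, ξ) = 0`. -/
structure IsMC {d : Tens A V →ₗ[𝕜] Tens A V} (g : BlockAlg O.toPreOperad d) (ξ : Tens A V) :
    Prop where
  even : PiHomog A V 0 ξ
  plus : InPlus A V ξ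
  eqn : ConvTo A V (fun N => d ξ - (ε : ℤ) • ∑ j ∈ Finset.range N,
    ((j + 2).factorial : 𝕜)⁻¹ • mOp φ g (j + 2) (by omega) (fun _ => ξ)) 0

/-- `d` is the twist of the differential `d'` of a Block `O`-algebra by `ξ`:
`d w = d' w - ε ∑_{k ≥ 1} (1/k!) φ(m_{k+1})(ξ, …, ξ, w)`. -/
def IsTwisted {d' : Tens A V →ₗ[𝕜] Tens A V} (g : BlockAlg O.toPreOperad d') (ξ : Tens A V)
    (d : Tens A V →ₗ[𝕜] Tens A V) : Prop :=
  ∀ w, ConvTo A V (fun N => d' w - (ε : ℤ) • ∑ j ∈ Finset.range N,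
    ((j + 1).factorial : 𝕜)⁻¹ • mOp φ g (j + 1 + 1) (by omega)
      (Fin.snoc (α := fun _ => Tens A V) (fun _ => ξ) w)) (d w)

/-- A Block `O`-algebra structure on some formal Block module `(A ⊗ V, d')`, together with
`ξ ∈ MC_φ(V, A)` such that `d` is the twist of `d'` by `ξ`. -/
structure MCData (d : Tens A V →ₗ[𝕜] Tens A V) where
  d' : Tens A V →ₗ[𝕜] Tens A V
  isBlock : IsBlock A V d'
  alg : BlockAlg O.toPreOperad d'
  ξ : Tens A V
  isMC : IsMC φ alg ξ
  isTwisted : IsTwisted φ alg ξ d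

end Block

end BlockTw

open scoped TensorProduct

namespace BlockTw

universe u v w v'

set_option linter.unusedSectionVars false

/-! ### Signs -/

/-! Both sides of the bijection are read inside one operad with zero differential, `tensEnd A V`:
all graded multilinear maps over the field on the superspace A ⊗ ΠV. For an odd endomorphism D the
derivation [D, -] is the differential that D induces on multilinear maps. So a Block P-algebra
structure on (A ⊗ V, d) is a map H of operads from P, with values in continuous A-multilinear
operations into A_+ ⊗ ΠV, such that H(d_P f) = [d, H f].

Forget the differentials first. A map on O together with an even point ξ of A_+ ⊗ ΠV (a `TensRep`)
extends uniquely to a continuous map on O[[x]]. Indeed a composite in which x occurs N times has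
values in A_+^N ⊗ V (`evT_mem_fil`, resting on `IsEndA.map_fil`), and every K i contains a power of
A_+ (`exists_augPow_le`). Modulo K i the evaluation therefore factors through O[x]/(x^N) for large N
(`ev_mem_filIdeal`), which defines `powHom`; uniqueness is `powMap_eq`.

Now the differentials. As [D, -] is a derivation (`bracket_comp`), the extension takes the
differential of O_MC to [d', -] as soon as it does so on generators (`TensRep.powHom_powD`). On O
this says that O acts on (A ⊗ V, d'); on x it is the Maurer–Cartan equation, read modulo every A_+^N
(`mc_eqn_iff`). The extension takes [α, -] to the bracket with the action of α (`powHom_bracket`),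
and brackets are additive in their first argument. Hence Tw O acts on (A ⊗ V, d) exactly when O_MC
acts compatibly with d' = d - α, and d = d' + α is the twisting formula (`isTwisted_iff`). In
particular d' is determined by d, the action of O and ξ.

What is left is that d' squares to zero when it is obtained from d. Put l_n = (1/n!) m_{n+1}(ξ, …,
ξ, -), q_n(u) = (1/(n-1)!) m_{n+1}(u, ξ, …, ξ, w) and c_n = (1/(n+1)!) m_{n+1}(ξ, …, ξ). The
relation for d m_{n+1}, evaluated at (ξ, …, ξ, w), reads d' l_n(w) + l_n(d' w) + q_n(d' ξ) = ε
∑_{a+b=n} (l_b l_a(w) + q_b(c_a)) (`lInf_identity`). Summed over n, the q-terms cancel by the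
Maurer–Cartan equation d' ξ = ε ∑ c_a. With α = -ε ∑ l_n this leaves d'α + αd' + α² = 0
(`alphaLin_square`), so d² = d'². -/

@[simp] theorem sgn_zero : sgn 0 = 1 := rfl

@[simp] theorem sgn_one : sgn 1 = -1 := rfl

@[simp] theorem sgn_mul_self (p : ZMod 2) : sgn p * sgn p = 1 := by
  revert p; decide

@[simp] theorem sgn_smul_smul {M : Type*} [AddCommGroup M] (p : ZMod 2) (x : M) :
    sgn p • sgn p • x = x := by
  rw [smul_smul, sgn_mul_self, one_smul]

theorem sgn_sum {ι : Type*} (s : Finset ι) (f : ι → ZMod 2) :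
    sgn (∑ i ∈ s, f i) = ∏ i ∈ s, sgn (f i) := by
  classical
  induction s using Finset.induction_on with
  | empty => simp
  | insert a s ha ih => rw [Finset.sum_insert ha, Finset.prod_insert ha, sgn_add, ih]

theorem zmod_two_add_self (x : ZMod 2) : x + x = 0 := CharTwo.add_self_eq_zero x

/-- The exponent of the Koszul sign. -/
def koszulExp {n : ℕ} (σ : Equiv.Perm (Fin n)) (c : Fin n → ZMod 2) : ZMod 2 :=
  ∑ i, ∑ j, if i < j ∧ σ j < σ i then c (σ i) * c (σ j) else 0

theorem koszul_eq_sgn {n : ℕ} (σ : Equiv.Perm (Fin n)) (c : Fin n → ZMod 2) :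
    koszul σ c = sgn (koszulExp σ c) := by
  simp only [koszul, koszulExp, sgn_sum]
  refine Finset.prod_congr rfl fun i _ => Finset.prod_congr rfl fun j _ => ?_
  split_ifs <;> rfl

theorem koszul_one {n : ℕ} (c : Fin n → ZMod 2) : koszul 1 c = 1 := by
  refine Finset.prod_eq_one fun i _ => Finset.prod_eq_one fun j _ => if_neg ?_
  simp only [Equiv.Perm.coe_one, id, not_and, not_lt]
  exact fun h => h.le

/-- Terms above and below the diagonal cancel in pairs. This reduces an identity between Koszul
exponents to a check on each unordered pair of inputs. -/
theorem sum_sum_eq_zero_of_add_swap {n : ℕ} (F : Fin n → Fin n → ZMod 2) (h0 : ∀ i, F i i = 0)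
    (h : ∀ i j, F i j + F j i = 0) : ∑ i, ∑ j, F i j = 0 := by
  have key : ∀ i j, F i j = (if i < j then F i j else 0) + (if j < i then F i j else 0) := by
    intro i j
    rcases lt_trichotomy i j with hij | rfl | hij
    · simp [hij, hij.not_gt]
    · simp [h0]
    · simp [hij, hij.not_gt]
  have e : ∑ i, ∑ j, F i j = ∑ i, ∑ j, ((if i < j then F i j else 0)
      + (if j < i then F i j else 0)) :=
    Finset.sum_congr rfl fun i _ => Finset.sum_congr rfl fun j _ => key i j
  rw [e]
  simp only [Finset.sum_add_distrib]
  rw [Finset.sum_comm (f := fun i j => if j < i then F i j else 0), ← Finset.sum_add_distrib]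
  refine Finset.sum_eq_zero fun i _ => ?_
  rw [← Finset.sum_add_distrib]
  refine Finset.sum_eq_zero fun j _ => ?_
  split_ifs
  · exact h i j
  · simp

/-- A pair is inverted by `σ * τ` exactly when one, and not both, of `τ` and `σ` inverts it (`σ`
acting on the images under `τ`), and exponents are counted modulo 2. -/
theorem koszul_mul {n : ℕ} (σ τ : Equiv.Perm (Fin n)) (c : Fin n → ZMod 2) :
    koszul (σ * τ) c = koszul σ c * koszul τ (c ∘ σ) := by
  simp only [koszul_eq_sgn, ← sgn_add]
  congr 1
  rw [← sub_eq_zero, CharTwo.sub_eq_add]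
  -- Reindexing along `τ` makes all three exponents sums over the same pairs `(i, j)`.
  have e : koszulExp σ c = ∑ i, ∑ j,
      if τ i < τ j ∧ σ (τ j) < σ (τ i) then c (σ (τ i)) * c (σ (τ j)) else 0 := by
    rw [koszulExp, ← Equiv.sum_comp τ]
    exact Finset.sum_congr rfl fun i _ => (Equiv.sum_comp τ _).symm
  rw [e, koszulExp, koszulExp]
  simp only [← Finset.sum_add_distrib]
  refine sum_sum_eq_zero_of_add_swap _ (fun i => by simp) fun i j => ?_
  rcases eq_or_ne i j with rfl | hij
  · simp
  have h1 : τ i ≠ τ j := τ.injective.ne hij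
  have h2 : σ (τ i) ≠ σ (τ j) := σ.injective.ne h1
  simp only [Equiv.Perm.coe_mul, Function.comp_apply]
  rw [mul_comm (c (σ (τ j)))]
  generalize c (σ (τ i)) * c (σ (τ j)) = s
  have two := zmod_two_add_self s
  rcases hij.lt_or_gt with a | a <;> rcases h1.lt_or_gt with b | b <;>
    rcases h2.lt_or_gt with e | e <;> simp [a, b, e, a.not_gt, b.not_gt, e.not_gt, two]

/-! ### Slots of a partial composite -/

theorem innerIdx_ne_outerIdx {a b r : ℕ} (i : Fin a) (h : r + 1 = a + b) (k : Fin b) (j : Fin a)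
    (hj : j ≠ i) : innerIdx i h k ≠ outerIdx i h j hj := by
  intro e
  have e := congrArg Fin.val e
  have := k.2
  have h3 : j.1 ≠ i.1 := fun e => hj (Fin.ext e)
  simp only [innerIdx, outerIdx] at e
  split_ifs at e with hlt
  · have : j.1 < i.1 := hlt
    simp at e; omega
  · have : ¬ j.1 < i.1 := hlt
    simp at e; omega

theorem outerIdx_val {a b r : ℕ} (i : Fin a) (h : r + 1 = a + b) (j : Fin a) (hj : j ≠ i) :
    (outerIdx i h j hj).1 = if j < i then j.1 else j.1 - 1 + b := by
  rw [outerIdx]; split_ifs <;> rfl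

/-- The inputs of `f ∘_i g` are those of `g` and the inputs `j ≠ i` of `f`. -/
def slotMap {a b r : ℕ} (i : Fin a) (h : r + 1 = a + b) :
    Fin b ⊕ {j : Fin a // j ≠ i} → Fin r :=
  Sum.elim (innerIdx i h) fun j => outerIdx i h j.1 j.2

/-- Injectivity is arithmetic of positions; the count b + (a - 1) = r gives the rest. All sums over
the inputs of a composite are split along this bijection. -/
theorem slotMap_bijective {a b r : ℕ} (i : Fin a) (h : r + 1 = a + b) :
    Function.Bijective (slotMap i h) := by
  rw [Fintype.bijective_iff_injective_and_card]
  constructor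
  · rintro (k | ⟨j, hj⟩) (k' | ⟨j', hj'⟩) e
    · have e := congrArg Fin.val e
      simp only [slotMap, Sum.elim_inl, innerIdx] at e
      exact congrArg Sum.inl (Fin.ext (by omega))
    · exact absurd e (innerIdx_ne_outerIdx i h k j' hj')
    · exact absurd e.symm (innerIdx_ne_outerIdx i h k' j hj)
    · have e := congrArg Fin.val e
      have h3 : j.1 ≠ i.1 := fun e => hj (Fin.ext e)
      have h4 : j'.1 ≠ i.1 := fun e => hj' (Fin.ext e)
      simp only [slotMap, Sum.elim_inr, outerIdx_val, Fin.lt_def] at e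
      have : j = j' := Fin.ext (by split_ifs at e <;> omega)
      subst this; rfl
  · have := i.2
    simp only [Fintype.card_sum, Fintype.card_fin, Fintype.card_subtype_compl,
      Fintype.card_unique]
    omega

theorem sum_slots {M : Type*} [AddCommMonoid M] {a b r : ℕ} (i : Fin a) (h : r + 1 = a + b)
    (F : Fin r → M) :
    ∑ l, F l = ∑ k, F (innerIdx i h k) + ∑ j : {j : Fin a // j ≠ i}, F (outerIdx i h j.1 j.2) := by
  rw [← (Equiv.ofBijective _ (slotMap_bijective i h)).sum_comp, Fintype.sum_sum_type]
  rfl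

theorem slot_cases {a b r : ℕ} (i : Fin a) (h : r + 1 = a + b) {M : Fin r → Prop}
    (h1 : ∀ k, M (innerIdx i h k)) (h2 : ∀ j hj, M (outerIdx i h j hj)) (l : Fin r) : M l := by
  obtain ⟨k | j, rfl⟩ := (slotMap_bijective i h).2 l
  · exact h1 k
  · exact h2 j.1 j.2

theorem sum_eq_add_sum_ne {M : Type*} [AddCommMonoid M] {a : ℕ} (i : Fin a) (F : Fin a → M) :
    ∑ l, F l = F i + ∑ j : {j : Fin a // j ≠ i}, F j.1 := by
  rw [Fintype.sum_eq_add_sum_subtype_ne _ i]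

theorem inner_lt_outer {a b r : ℕ} (i : Fin a) (h : r + 1 = a + b) (k : Fin b) (j : Fin a)
    (hj : j ≠ i) : innerIdx i h k < outerIdx i h j hj ↔ i < j := by
  have h3 : j.1 ≠ i.1 := fun e => hj (Fin.ext e)
  have := k.2
  simp only [Fin.lt_def, outerIdx_val, innerIdx]
  split_ifs <;> omega

theorem outer_lt_inner {a b r : ℕ} (i : Fin a) (h : r + 1 = a + b) (k : Fin b) (j : Fin a)
    (hj : j ≠ i) : outerIdx i h j hj < innerIdx i h k ↔ j < i := by
  have h3 : j.1 ≠ i.1 := fun e => hj (Fin.ext e)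
  have := k.2
  simp only [Fin.lt_def, outerIdx_val, innerIdx]
  split_ifs <;> omega

theorem inner_lt_inner {a b r : ℕ} (i : Fin a) (h : r + 1 = a + b) (k k' : Fin b) :
    innerIdx i h k < innerIdx i h k' ↔ k < k' := by
  rw [Fin.lt_def, Fin.lt_def]
  simp [innerIdx]

theorem outer_lt_outer {a b r : ℕ} (i : Fin a) (h : r + 1 = a + b) (j j' : Fin a)
    (hj : j ≠ i) (hj' : j' ≠ i) : outerIdx i h j hj < outerIdx i h j' hj' ↔ j < j' := by
  have h3 : j.1 ≠ i.1 := fun e => hj (Fin.ext e)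
  have h4 : j'.1 ≠ i.1 := fun e => hj' (Fin.ext e)
  simp only [Fin.lt_def, outerIdx_val]
  split_ifs <;> omega

theorem inner_val_lt {a b r : ℕ} (i : Fin a) (h : r + 1 = a + b) (k : Fin b) :
    ¬ (innerIdx i h k).1 < i.1 := by
  simp [innerIdx]

theorem outer_val_lt {a b r : ℕ} (i : Fin a) (h : r + 1 = a + b) (j : Fin a) (hj : j ≠ i) :
    (outerIdx i h j hj).1 < i.1 ↔ j < i := by
  have h3 : j.1 ≠ i.1 := fun e => hj (Fin.ext e)
  simp only [Fin.lt_def, outerIdx_val]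
  split_ifs <;> omega

theorem sum_sum_slots {M : Type*} [AddCommMonoid M] {a b r : ℕ} (i : Fin a) (h : r + 1 = a + b)
    (F : Fin r → Fin r → M) :
    ∑ x, ∑ y, F x y = ∑ k, ∑ k', F (innerIdx i h k) (innerIdx i h k')
      + ∑ k, ∑ j : {j : Fin a // j ≠ i}, F (innerIdx i h k) (outerIdx i h j.1 j.2)
      + (∑ j : {j : Fin a // j ≠ i}, ∑ k, F (outerIdx i h j.1 j.2) (innerIdx i h k)
      + ∑ j : {j : Fin a // j ≠ i}, ∑ j' : {j : Fin a // j ≠ i},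
        F (outerIdx i h j.1 j.2) (outerIdx i h j'.1 j'.2)) := by
  rw [sum_slots i h, ← Finset.sum_add_distrib, ← Finset.sum_add_distrib]
  exact congrArg₂ _ (Finset.sum_congr rfl fun _ _ => sum_slots i h _)
    (Finset.sum_congr rfl fun _ _ => sum_slots i h _)

theorem sum_sum_eq_add_sum_ne {M : Type*} [AddCommMonoid M] {a : ℕ} (i : Fin a)
    (F : Fin a → Fin a → M) :
    ∑ x, ∑ y, F x y = F i i + ∑ j : {j : Fin a // j ≠ i}, F i j.1
      + (∑ j : {j : Fin a // j ≠ i}, F j.1 i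
      + ∑ j : {j : Fin a // j ≠ i}, ∑ j' : {j : Fin a // j ≠ i}, F j.1 j'.1) := by
  rw [sum_eq_add_sum_ne i, ← Finset.sum_add_distrib]
  exact congrArg₂ _ (sum_eq_add_sum_ne i _) (Finset.sum_congr rfl fun _ _ => sum_eq_add_sum_ne i _)

/-- The sign rule behind the equivariance of partial composition. -/
theorem koszul_comp {q : ZMod 2} {a b r : ℕ} (i : Fin a) (h : r + 1 = a + b)
    (σ : Equiv.Perm (Fin a)) (τ : Equiv.Perm (Fin b)) (ρ : Equiv.Perm (Fin r))
    (h₁ : ∀ j, ρ (innerIdx i h j) = innerIdx (σ i) h (τ j))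
    (h₂ : ∀ j hj hj', ρ (outerIdx i h j hj) = outerIdx (σ i) h (σ j) hj')
    (c : Fin r → ZMod 2) (c' : Fin a → ZMod 2)
    (hi : c' (σ i) = q + ∑ k, c (innerIdx (σ i) h k))
    (ho : ∀ j hj, c' j = c (outerIdx (σ i) h j hj)) :
    sgn (q * ∑ l with l.1 < (σ i).1, c l) * (koszul τ (fun k => c (innerIdx (σ i) h k))
      * koszul σ c') = koszul ρ c * sgn (q * ∑ l with l.1 < i.1, c (ρ l)) := by
  have hσ : ∀ j : {j : Fin a // j ≠ i}, σ j.1 ≠ σ i := fun j => σ.injective.ne j.2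
  have h₂' : ∀ j : {j : Fin a // j ≠ i}, ρ (outerIdx i h j.1 j.2)
    = outerIdx (σ i) h (σ j.1) (hσ j) := fun j => h₂ _ _ _
  have ho' : ∀ j : {j : Fin a // j ≠ i}, c (outerIdx (σ i) h (σ j.1) (hσ j)) = c' (σ j.1) :=
    fun j => (ho _ _).symm
  simp only [koszul_eq_sgn, ← sgn_add]
  congr 1
  -- Only inputs of the outer operation precede slot `σ i`; the inner ones start there.
  have s1 : ∑ l with l.1 < (σ i).1, c l
      = ∑ j : {j : Fin a // j ≠ i}, if σ j.1 < σ i then c' (σ j.1) else 0 := by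
    rw [Finset.sum_filter, sum_slots (σ i) h]
    simp only [inner_val_lt, outer_val_lt, if_false, Finset.sum_const_zero, zero_add]
    rw [← (σ.subtypeEquiv (p := fun j => j ≠ i) (q := fun j => j ≠ σ i)
      fun j => (σ.injective.ne_iff).symm).sum_comp]
    refine Finset.sum_congr rfl fun j _ => ?_
    rw [← ho' j]
    rfl
  have s2 : ∑ l with l.1 < i.1, c (ρ l)
      = ∑ j : {j : Fin a // j ≠ i}, if j.1 < i then c' (σ j.1) else 0 := by
    rw [Finset.sum_filter, sum_slots i h]
    simp only [inner_val_lt, outer_val_lt, if_false, Finset.sum_const_zero, zero_add, h₂', ho']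
  have s3 : koszulExp ρ c = koszulExp τ (fun k => c (innerIdx (σ i) h k))
      + (∑ k, c (innerIdx (σ i) h k)) * (∑ j : {j : Fin a // j ≠ i},
        ((if i < j.1 ∧ σ j.1 < σ i then c' (σ j.1) else 0)
          + (if j.1 < i ∧ σ i < σ j.1 then c' (σ j.1) else 0)))
      + ∑ j : {j : Fin a // j ≠ i}, ∑ j' : {j : Fin a // j ≠ i},
        if j.1 < j'.1 ∧ σ j'.1 < σ j.1 then c' (σ j.1) * c' (σ j'.1) else 0 := by
    rw [koszulExp, sum_sum_slots i h]
    simp only [h₁, h₂', ho', inner_lt_inner, outer_lt_outer,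
      inner_lt_outer, outer_lt_inner, Finset.sum_add_distrib, mul_add]
    rw [koszulExp]
    have x1 : (∑ k, c (innerIdx (σ i) h k)) * (∑ j : {j : Fin a // j ≠ i},
        (if i < j.1 ∧ σ j.1 < σ i then c' (σ j.1) else 0)) = ∑ k, ∑ j : {j : Fin a // j ≠ i},
          if i < j.1 ∧ σ j.1 < σ i then c (innerIdx (σ i) h (τ k)) * c' (σ j.1) else 0 := by
      rw [← Equiv.sum_comp τ, Finset.sum_mul_sum]
      simp only [mul_ite, mul_zero]
    have x2 : (∑ k, c (innerIdx (σ i) h k)) * (∑ j : {j : Fin a // j ≠ i},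
        (if j.1 < i ∧ σ i < σ j.1 then c' (σ j.1) else 0)) = ∑ j : {j : Fin a // j ≠ i}, ∑ k,
          if j.1 < i ∧ σ i < σ j.1 then c' (σ j.1) * c (innerIdx (σ i) h (τ k)) else 0 := by
      rw [← Equiv.sum_comp τ, mul_comm, Finset.sum_mul_sum]
      simp only [ite_mul, zero_mul]
    rw [x1, x2]
    ring
  have s4 : koszulExp σ c' = c' (σ i) * (∑ j : {j : Fin a // j ≠ i},
        ((if i < j.1 ∧ σ j.1 < σ i then c' (σ j.1) else 0)
          + (if j.1 < i ∧ σ i < σ j.1 then c' (σ j.1) else 0)))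
      + ∑ j : {j : Fin a // j ≠ i}, ∑ j' : {j : Fin a // j ≠ i},
        if j.1 < j'.1 ∧ σ j'.1 < σ j.1 then c' (σ j.1) * c' (σ j'.1) else 0 := by
    rw [koszulExp, sum_sum_eq_add_sum_ne i]
    simp only [lt_self_iff_false, false_and, if_false, zero_add, Finset.sum_add_distrib,
      Finset.sum_mul, add_mul, ite_mul, zero_mul, ← add_assoc, mul_comm (c' (σ i))]
  -- The pair `{i, j}` is inverted by `σ` exactly when one, and not both, of `j < i` and `σ j < σ i`
  -- holds.
  have s5 : ∑ j : {j : Fin a // j ≠ i}, ((if i < j.1 ∧ σ j.1 < σ i then c' (σ j.1) else 0)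
          + (if j.1 < i ∧ σ i < σ j.1 then c' (σ j.1) else 0))
      = ∑ j : {j : Fin a // j ≠ i}, (if σ j.1 < σ i then c' (σ j.1) else 0)
        + ∑ j : {j : Fin a // j ≠ i}, (if j.1 < i then c' (σ j.1) else 0) := by
    rw [← Finset.sum_add_distrib]
    refine Finset.sum_congr rfl fun j _ => ?_
    have two := zmod_two_add_self (c' (σ j.1))
    rcases j.2.lt_or_gt with x | x <;> rcases (hσ j).lt_or_gt with y | y <;>
      simp [x, y, x.not_gt, y.not_gt, two]
  rw [s1, s2, s3, s4, s5, hi]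
  generalize ∑ j : {j : Fin a // j ≠ i}, (if σ j.1 < σ i then c' (σ j.1) else 0) = X
  generalize ∑ j : {j : Fin a // j ≠ i}, (if j.1 < i then c' (σ j.1) else 0) = Y
  -- `q * X` occurs twice on the left: in the explicit sign, and in the exponent of `σ` through the
  -- summand `q` of the parity at the composed slot.
  linear_combination (q * X) * CharTwo.two_eq_zero (R := ZMod 2)

/-! ### Arguments of partial composites -/

/-- The arguments of `f` in `f ∘_i g`, where `u` is the value of `g`. -/
def insArg {α : Type*} {a b r : ℕ} (i : Fin a) (h : r + 1 = a + b) (u : α) (w : Fin r → α) :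
    Fin a → α :=
  fun j => if hj : j = i then u else w (outerIdx i h j hj)

/-- The variant of `insArg` for families indexed by `ℕ`. -/
def insNat {α : Type*} (i b : ℕ) (u : α) (W : ℕ → α) : ℕ → α :=
  fun x => if x < i then W x else if x = i then u else W (x - 1 + b)

section Args

variable {α : Type*} {a b r : ℕ} (i : Fin a) (h : r + 1 = a + b)

@[simp] theorem insArg_self (u : α) (w : Fin r → α) : insArg i h u w i = u := by
  simp [insArg]

theorem insArg_of_ne (u : α) (w : Fin r → α) (j : Fin a) (hj : j ≠ i) :
    insArg i h u w j = w (outerIdx i h j hj) := by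
  simp [insArg, hj]

theorem update_insArg (u u' : α) (w : Fin r → α) :
    Function.update (insArg i h u w) i u' = insArg i h u' w := by
  funext j
  by_cases hj : j = i
  · subst hj; simp
  · simp [hj, insArg]

theorem insArg_update_inner (u x : α) (w : Fin r → α) (k : Fin b) :
    insArg i h u (Function.update w (innerIdx i h k) x) = insArg i h u w := by
  funext j
  by_cases hj : j = i
  · subst hj; simp
  · rw [insArg_of_ne _ _ _ _ _ hj, insArg_of_ne _ _ _ _ _ hj,
      Function.update_of_ne (innerIdx_ne_outerIdx i h k j hj).symm]

theorem innerIdx_injective : Function.Injective (innerIdx i h) := fun k k' e =>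
  Fin.ext (by have e := congrArg Fin.val e; simpa [innerIdx] using e)

theorem update_inner_comp_inner (x : α) (w : Fin r → α) (k : Fin b) :
    (fun k' => Function.update w (innerIdx i h k) x (innerIdx i h k'))
      = Function.update (fun k' => w (innerIdx i h k')) k x := by
  funext k'
  by_cases hk : k' = k
  · subst hk; simp
  · rw [Function.update_of_ne hk, Function.update_of_ne ((innerIdx_injective i h).ne hk)]

theorem insArg_update_outer (u x : α) (w : Fin r → α) (j : Fin a) (hj : j ≠ i) :
    insArg i h u (Function.update w (outerIdx i h j hj) x)
      = Function.update (insArg i h u w) j x := by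
  funext j'
  by_cases e : j' = i
  · subst e; rw [insArg_self, Function.update_of_ne (Ne.symm hj), insArg_self]
  · by_cases e' : j' = j
    · subst e'; rw [insArg_of_ne _ _ _ _ _ e]; simp
    · rw [Function.update_of_ne e', insArg_of_ne _ _ _ _ _ e, insArg_of_ne _ _ _ _ _ e,
        Function.update_of_ne]
      intro x
      rcases lt_or_gt_of_ne e' with y | y
      · exact ((outer_lt_outer i h _ _ e hj).2 y).ne x
      · exact ((outer_lt_outer i h _ _ hj e).2 y).ne x.symm

theorem update_outer_comp_inner (x : α) (w : Fin r → α) (j : Fin a) (hj : j ≠ i) :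
    (fun k' => Function.update w (outerIdx i h j hj) x (innerIdx i h k'))
      = fun k' => w (innerIdx i h k') :=
  funext fun k' => Function.update_of_ne (innerIdx_ne_outerIdx i h k' j hj) _ _

/-- For arguments taken from one family indexed by ℕ, iterated insertions can be compared by
arithmetic of positions. The two associativity laws are proved in this form. -/
theorem insArg_nat (u : α) (W : ℕ → α) :
    (insArg i h u fun k => W k.1) = fun j => insNat i.1 b u W j.1 := by
  funext j
  by_cases hj : j = i
  · subst hj; simp [insNat]
  · have : j.1 ≠ i.1 := fun e => hj (Fin.ext e)
    rw [insArg_of_ne _ _ _ _ _ hj, outerIdx_val, insNat, if_neg this]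
    simp only [Fin.lt_def]
    split_ifs <;> rfl

end Args

/-- Insertion trades the `b` entries starting at `i` for the single entry `u`. Applied to parities,
this gives the sign of an operation placed to the right of an earlier one. -/
theorem sum_range_insNat {M : Type*} [AddCommMonoid M] (i b m : ℕ) (hm : i < m) (u : M)
    (C : ℕ → M) : ∑ x ∈ Finset.range m, insNat i b u C x + ∑ k ∈ Finset.range b, C (i + k)
      = u + ∑ x ∈ Finset.range (m - 1 + b), C x := by
  induction m, hm using Nat.le_induction with
  | base =>
    rw [Finset.sum_range_succ, Nat.succ_sub_one, Finset.sum_range_add]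
    have : ∑ x ∈ Finset.range i, insNat i b u C x = ∑ x ∈ Finset.range i, C x :=
      Finset.sum_congr rfl fun x hx => by simp [insNat, Finset.mem_range.1 hx]
    rw [this]
    simp only [insNat, lt_self_iff_false, if_false, if_true]
    abel
  | succ m hm ih =>
    have e : m + 1 - 1 + b = (m - 1 + b) + 1 := by omega
    rw [Finset.sum_range_succ, e, Finset.sum_range_succ, add_right_comm, ih, add_assoc]
    simp only [insNat, (show ¬ m < i by omega), (show ¬ m = i by omega), if_false]

theorem sum_range_insNat_of_le {M : Type*} [AddCommMonoid M] (i b m : ℕ) (hm : m ≤ i) (u : M)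
    (C : ℕ → M) : ∑ x ∈ Finset.range m, insNat i b u C x = ∑ x ∈ Finset.range m, C x :=
  Finset.sum_congr rfl fun x hx => by
    simp [insNat, (Finset.mem_range.1 hx).trans_le hm]

theorem sum_filter_lt {M : Type*} [AddCommMonoid M] {n m : ℕ} (hm : m ≤ n) (C : ℕ → M) :
    ∑ l : Fin n with l.1 < m, C l.1 = ∑ x ∈ Finset.range m, C x := by
  rw [Finset.sum_filter, Fin.sum_univ_eq_sum_range (fun x => if x < m then C x else 0),
    ← Finset.sum_filter]
  refine Finset.sum_congr (Finset.ext fun x => ?_) fun _ _ => rfl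
  simp only [Finset.mem_filter, Finset.mem_range]
  omega

/-! ### Multilinear maps on a superspace -/

/-- A `ℤ/2`-grading, given by the parity involution. -/
structure ParityInvolution (𝕜 : Type u) [Field 𝕜] (T : Type v) [AddCommGroup T]
    [Module 𝕜 T] where
  inv : T →ₗ[𝕜] T
  inv_inv : ∀ w, inv (inv w) = w

section Multi

variable {𝕜 : Type u} [Field 𝕜] {T : Type v} [AddCommGroup T] [Module 𝕜 T]
  (θ : ParityInvolution 𝕜 T)

/-- The elements of parity `p`. -/
def ParityInvolution.part (p : ZMod 2) : Submodule 𝕜 T where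
  carrier := {w | θ.inv w = sgn p • w}
  zero_mem' := by simp
  add_mem' {x y} hx hy := by
    change θ.inv x = _ at hx
    change θ.inv y = _ at hy
    change θ.inv _ = _
    rw [map_add, hx, hy, smul_add]
  smul_mem' c x hx := by
    change θ.inv x = _ at hx
    change θ.inv _ = _
    rw [map_smul, hx, smul_comm]

variable {θ} in
theorem ParityInvolution.mem_part {p : ZMod 2} {w : T} :
    w ∈ θ.part p ↔ θ.inv w = sgn p • w := Iff.rfl

/-- The projection to the elements of parity `p`. -/
noncomputable def ParityInvolution.pr (p : ZMod 2) : T →ₗ[𝕜] T :=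
  (2 : 𝕜)⁻¹ • (LinearMap.id + sgn p • θ.inv)

theorem ParityInvolution.pr_apply (p : ZMod 2) (w : T) :
    θ.pr p w = (2 : 𝕜)⁻¹ • (w + sgn p • θ.inv w) := rfl

theorem ParityInvolution.pr_mem (p : ZMod 2) (w : T) : θ.pr p w ∈ θ.part p := by
  rw [mem_part, pr_apply, map_smul, map_add, map_zsmul, θ.inv_inv, smul_comm (sgn p),
    smul_add (sgn p), sgn_smul_smul, add_comm]

variable [CharZero 𝕜]

theorem ParityInvolution.pr_of_mem {p : ZMod 2} {w : T} (hw : w ∈ θ.part p) : θ.pr p w = w := by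
  rw [pr_apply, mem_part.1 hw, sgn_smul_smul, ← two_smul 𝕜 w, smul_smul,
    inv_mul_cancel₀ two_ne_zero, one_smul]

omit [CharZero 𝕜] in
theorem ParityInvolution.pr_of_mem_ne {p q : ZMod 2} {w : T} (hw : w ∈ θ.part p) (hq : q ≠ p) :
    θ.pr q w = 0 := by
  rw [pr_apply, mem_part.1 hw, smul_smul, ← sgn_add]
  have : q + p = 1 := by revert hq; clear hw; revert p q; decide
  simp [this]

theorem ParityInvolution.sum_pr (w : T) : ∑ p, θ.pr p w = w := by
  change ∑ p : Fin 2, θ.pr p w = w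
  rw [Fin.sum_univ_two]
  change θ.pr 0 w + θ.pr 1 w = w
  rw [pr_apply, pr_apply, ← smul_add, sgn_zero, sgn_one]
  have : w + (1 : ℤ) • θ.inv w + (w + (-1 : ℤ) • θ.inv w) = (2 : 𝕜) • w := by
    rw [two_smul]; module
  rw [this, smul_smul, inv_mul_cancel₀ two_ne_zero, one_smul]

variable (𝕜 T) in
/-- Multilinear maps `T^n → T`. -/
abbrev Multi (n : ℕ) := MultilinearMap 𝕜 (fun _ : Fin n => T) T

omit [CharZero 𝕜] in
theorem Multi.map_zsmul_insArg {a b r : ℕ} (i : Fin a) (h : r + 1 = a + b) (f : Multi 𝕜 T a)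
    (m : ℤ) (u : T) (w : Fin r → T) :
    f (insArg i h (m • u) w) = m • f (insArg i h u w) := by
  rw [← update_insArg i h u (m • u), ← Int.cast_smul_eq_zsmul 𝕜 m u,
    f.map_update_smul, Int.cast_smul_eq_zsmul, update_insArg]

include θ in
/-- A multilinear map is determined by its values on homogeneous arguments. -/
theorem Multi.ext_part {n : ℕ} {f g : Multi 𝕜 T n}
    (h : ∀ (c : Fin n → ZMod 2) w, (∀ j, w j ∈ θ.part (c j)) → f w = g w) : f = g := by
  ext w
  have e : w = fun j => ∑ p, θ.pr p (w j) := funext fun j => (θ.sum_pr (w j)).symm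
  rw [e, f.map_sum, g.map_sum]
  exact Finset.sum_congr rfl fun c _ => h c _ fun j => θ.pr_mem _ _

-- Finite tuples are extended by 0, which is homogeneous of every parity, so nothing is lost by
-- testing on families indexed by ℕ.
include θ in
theorem Multi.ext_part_nat {n : ℕ} {f g : Multi 𝕜 T n}
    (h : ∀ (C : ℕ → ZMod 2) (W : ℕ → T), (∀ x, W x ∈ θ.part (C x)) →
      f (fun k => W k.1) = g (fun k => W k.1)) : f = g := by
  refine Multi.ext_part θ fun c w hw => ?_
  have := h (fun x => if hx : x < n then c ⟨x, hx⟩ else 0)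
    (fun x => if hx : x < n then w ⟨x, hx⟩ else 0) fun x => by
      by_cases hx : x < n
      · simpa [hx] using hw ⟨x, hx⟩
      · simp [hx]
  simpa using this

/-- Multiply a multilinear map by a sign that depends on the parities of the arguments. -/
noncomputable def signed {n : ℕ} (s : (Fin n → ZMod 2) → ℤ) : Multi 𝕜 T n →ₗ[𝕜] Multi 𝕜 T n where
  toFun f := ∑ c, s c • f.compLinearMap fun j => θ.pr (c j)
  map_add' f g := by
    rw [← Finset.sum_add_distrib]
    refine Finset.sum_congr rfl fun c _ => ?_
    rw [← smul_add]
    rfl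
  map_smul' k f := by
    rw [RingHom.id_apply, Finset.smul_sum]
    refine Finset.sum_congr rfl fun c _ => ?_
    rw [smul_comm k]
    rfl

omit [CharZero 𝕜] in
theorem signed_apply' {n : ℕ} (s : (Fin n → ZMod 2) → ℤ) (f : Multi 𝕜 T n) (w : Fin n → T) :
    signed θ s f w = ∑ c, s c • f fun j => θ.pr (c j) (w j) := by
  simp [signed]

/-- Homogeneous arguments are killed by the projections to the wrong parity, so one parity pattern
survives in the sum. -/
theorem signed_apply {n : ℕ} (s : (Fin n → ZMod 2) → ℤ) (f : Multi 𝕜 T n) {c : Fin n → ZMod 2}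
    {w : Fin n → T} (hw : ∀ j, w j ∈ θ.part (c j)) : signed θ s f w = s c • f w := by
  rw [signed_apply', Finset.sum_eq_single c]
  · simp only [θ.pr_of_mem (hw _)]
  · intro c' _ hc
    obtain ⟨j, hj⟩ := Function.ne_iff.1 hc
    rw [f.map_coord_zero j (θ.pr_of_mem_ne (hw j) hj), smul_zero]
  · simp

/-- The composite of `f` and `g` at the slot `i` of `f`, without sign. -/
def insRaw {a b r : ℕ} (i : Fin a) (h : r + 1 = a + b) (f : Multi 𝕜 T a) (g : Multi 𝕜 T b) :
    Multi 𝕜 T r :=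
  MultilinearMap.mk' (fun w => f (insArg i h (g fun k => w (innerIdx i h k)) w))
    (by
      intro w l x y
      induction l using slot_cases i h with
      | h1 k =>
        simp only [insArg_update_inner, update_inner_comp_inner, g.map_update_add]
        -- Slot `i` is exhibited as an update of a dummy value 0, to which linearity of `f` in that
        -- slot applies.
        rw [← update_insArg i h 0 (_ + _), f.map_update_add, update_insArg, update_insArg]
      | h2 j hj =>
        simp only [insArg_update_outer, update_outer_comp_inner, f.map_update_add])
    (by
      intro w l x y
      induction l using slot_cases i h with
      | h1 k =>
        simp only [insArg_update_inner, update_inner_comp_inner, g.map_update_smul]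
        rw [← update_insArg i h 0 (_ • _), f.map_update_smul, update_insArg]
      | h2 j hj =>
        simp only [insArg_update_outer, update_outer_comp_inner, f.map_update_smul])

omit [CharZero 𝕜] in
theorem insRaw_apply {a b r : ℕ} (i : Fin a) (h : r + 1 = a + b) (f : Multi 𝕜 T a)
    (g : Multi 𝕜 T b) (w : Fin r → T) :
    insRaw i h f g w = f (insArg i h (g fun k => w (innerIdx i h k)) w) := rfl

/-- The composite of `f` and `g`, `g` of parity `q`, at the slot `i` of `f`. -/
noncomputable def ins (q : ZMod 2) {a b r : ℕ} (i : Fin a) (h : r + 1 = a + b) :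
    Multi 𝕜 T a →ₗ[𝕜] Multi 𝕜 T b →ₗ[𝕜] Multi 𝕜 T r :=
  (LinearMap.mk₂ 𝕜 (insRaw i h)
    (fun _ _ _ => rfl) (fun _ _ _ => rfl)
    (fun f g g' => by
      ext w
      rw [insRaw_apply, _root_.add_apply, _root_.add_apply, insRaw_apply,
        insRaw_apply, ← update_insArg i h 0 (_ + _), f.map_update_add, update_insArg,
        update_insArg])
    (fun c f g => by
      ext w
      rw [insRaw_apply, _root_.smul_apply, _root_.smul_apply, insRaw_apply,
        ← update_insArg i h 0 (_ • _), f.map_update_smul, update_insArg])).compr₂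
    (signed θ fun c => sgn (q * ∑ l with l.1 < i.1, c l))

omit [CharZero 𝕜] in
theorem ins_eq (q : ZMod 2) {a b r : ℕ} (i : Fin a) (h : r + 1 = a + b) (f : Multi 𝕜 T a)
    (g : Multi 𝕜 T b) :
    ins θ q i h f g = signed θ (fun c => sgn (q * ∑ l with l.1 < i.1, c l)) (insRaw i h f g) :=
  rfl

theorem ins_apply (q : ZMod 2) {a b r : ℕ} (i : Fin a) (h : r + 1 = a + b) (f : Multi 𝕜 T a)
    (g : Multi 𝕜 T b) {c : Fin r → ZMod 2} {w : Fin r → T} (hw : ∀ j, w j ∈ θ.part (c j)) :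
    ins θ q i h f g w = sgn (q * ∑ l with l.1 < i.1, c l) •
      f (insArg i h (g fun k => w (innerIdx i h k)) w) := by
  rw [ins_eq, signed_apply θ _ _ hw, insRaw_apply]

theorem ins_apply_nat (q : ZMod 2) {a b r : ℕ} (i : Fin a) (h : r + 1 = a + b) (f : Multi 𝕜 T a)
    (g : Multi 𝕜 T b) {C : ℕ → ZMod 2} {W : ℕ → T} (hW : ∀ x, W x ∈ θ.part (C x)) :
    ins θ q i h f g (fun k => W k.1) = sgn (q * ∑ x ∈ Finset.range i.1, C x) •
      f (fun j => insNat i.1 b (g fun k => W (i.1 + k.1)) W j.1) := by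
  rw [ins_apply θ q i h f g (c := fun k => C k.1) fun j => hW _, insArg_nat]
  have e := i.2
  rcases Nat.eq_zero_or_pos b with rfl | hb
  · rw [sum_filter_lt (by omega)]; rfl
  · rw [sum_filter_lt (by omega)]; rfl

/-- The action of a permutation on a multilinear map, with the Koszul sign. -/
noncomputable def braid {n : ℕ} (σ : Equiv.Perm (Fin n)) : Multi 𝕜 T n →ₗ[𝕜] Multi 𝕜 T n where
  toFun f := signed θ (koszul σ) (f.domDomCongr σ)
  map_add' f g := by rw [← map_add]; rfl
  map_smul' c f := by rw [RingHom.id_apply, ← map_smul]; rfl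

theorem braid_apply {n : ℕ} (σ : Equiv.Perm (Fin n)) (f : Multi 𝕜 T n) {c : Fin n → ZMod 2}
    {w : Fin n → T} (hw : ∀ j, w j ∈ θ.part (c j)) :
    braid θ σ f w = koszul σ c • f fun j => w (σ j) :=
  signed_apply θ _ _ hw

/-- The multilinear maps of parity `p`. -/
def parityMaps (p : ZMod 2) (n : ℕ) : Submodule 𝕜 (Multi 𝕜 T n) where
  carrier := {f | ∀ (c : Fin n → ZMod 2) w, (∀ j, w j ∈ θ.part (c j)) →
    f w ∈ θ.part (p + ∑ j, c j)}
  zero_mem' _ _ _ := zero_mem _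
  add_mem' hf hg c w hw := add_mem (hf c w hw) (hg c w hw)
  smul_mem' k _ hf c w hw := Submodule.smul_mem _ k (hf c w hw)

variable {θ}

omit [CharZero 𝕜] in
theorem parityMaps.nat {p : ZMod 2} {n : ℕ} {f : Multi 𝕜 T n} (hf : f ∈ parityMaps θ p n)
    {C : ℕ → ZMod 2} {W : ℕ → T} (hW : ∀ x, W x ∈ θ.part (C x)) :
    f (fun k => W k.1) ∈ θ.part (p + ∑ x ∈ Finset.range n, C x) := by
  have := hf (fun k => C k.1) (fun k => W k.1) fun j => hW _
  rwa [Fin.sum_univ_eq_sum_range] at this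

omit [CharZero 𝕜] in
theorem zsmul_mem_part {p : ZMod 2} (m : ℤ) {x : T} (hx : x ∈ θ.part p) : m • x ∈ θ.part p :=
  zsmul_mem hx m

theorem braid_mem {p : ZMod 2} {n : ℕ} (σ : Equiv.Perm (Fin n)) {f : Multi 𝕜 T n}
    (hf : f ∈ parityMaps θ p n) : braid θ σ f ∈ parityMaps θ p n := by
  intro c w hw
  rw [braid_apply θ σ f hw]
  have := hf (fun j => c (σ j)) (fun j => w (σ j)) fun j => hw _
  rw [Equiv.sum_comp σ c] at this
  exact zsmul_mem_part _ this

omit [CharZero 𝕜] in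
theorem insArg_mem {a b r : ℕ} (i : Fin a) (h : r + 1 = a + b) {s : ZMod 2} {u : T}
    (hu : u ∈ θ.part s) {c : Fin r → ZMod 2} {w : Fin r → T} (hw : ∀ j, w j ∈ θ.part (c j))
    (j : Fin a) : insArg i h u w j ∈ θ.part (insArg i h s c j) := by
  by_cases hj : j = i
  · subst hj; simpa using hu
  · rw [insArg_of_ne _ _ _ _ _ hj, insArg_of_ne _ _ _ _ _ hj]; exact hw _

omit [CharZero 𝕜] in
theorem insNat_mem (i b : ℕ) {s : ZMod 2} {u : T}
    (hu : u ∈ θ.part s) {C : ℕ → ZMod 2} {W : ℕ → T} (hW : ∀ x, W x ∈ θ.part (C x)) (x : ℕ) :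
    insNat i b u W x ∈ θ.part (insNat i b s C x) := by
  simp only [insNat]
  split_ifs
  · exact hW _
  · exact hu
  · exact hW _

theorem sum_insArg {M : Type*} [AddCommMonoid M] {a b r : ℕ} (i : Fin a) (h : r + 1 = a + b)
    (u : M) (c : Fin r → M) :
    ∑ j, insArg i h u c j + ∑ k, c (innerIdx i h k) = u + ∑ l, c l := by
  rw [sum_slots i h, sum_eq_add_sum_ne i, insArg_self, add_assoc, add_comm (∑ k, _)]
  congr 2
  exact Finset.sum_congr rfl fun j _ => insArg_of_ne _ _ _ _ _ j.2

theorem ins_mem {p q s : ZMod 2} {a b r : ℕ} (i : Fin a) (h : r + 1 = a + b) (hs : s = p + q)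
    {f : Multi 𝕜 T a} {g : Multi 𝕜 T b} (hf : f ∈ parityMaps θ p a) (hg : g ∈ parityMaps θ q b) :
    ins θ q i h f g ∈ parityMaps θ s r := by
  intro c w hw
  rw [ins_apply θ q i h f g hw]
  refine zsmul_mem_part _ ?_
  have := hf _ _ (insArg_mem i h (hg _ _ fun k => hw (innerIdx i h k)) hw)
  convert this using 2
  have e := sum_insArg i h (q + ∑ k, c (innerIdx i h k)) c
  rw [hs]
  linear_combination -e

theorem braid_one {n : ℕ} (f : Multi 𝕜 T n) : braid θ 1 f = f :=
  Multi.ext_part θ fun c w hw => by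
    rw [braid_apply θ _ _ hw, koszul_one, one_smul]; rfl

theorem braid_mul {n : ℕ} (σ τ : Equiv.Perm (Fin n)) (f : Multi 𝕜 T n) :
    braid θ (σ * τ) f = braid θ σ (braid θ τ f) :=
  Multi.ext_part θ fun c w hw => by
    rw [braid_apply θ _ _ hw, braid_apply θ _ _ hw, braid_apply θ _ _ (c := c ∘ σ)
      fun j => hw (σ j), smul_smul, koszul_mul]; rfl

/-- The arguments agree by the description of `ρ` on inner and outer inputs, the signs by
`koszul_comp`. -/
theorem ins_braid {q : ZMod 2} {a b r : ℕ} (i : Fin a) (h : r + 1 = a + b)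
    (σ : Equiv.Perm (Fin a)) (τ : Equiv.Perm (Fin b)) (ρ : Equiv.Perm (Fin r))
    (h₁ : ∀ j, ρ (innerIdx i h j) = innerIdx (σ i) h (τ j))
    (h₂ : ∀ j hj hj', ρ (outerIdx i h j hj) = outerIdx (σ i) h (σ j) hj')
    (f : Multi 𝕜 T a) {g : Multi 𝕜 T b} (hg : g ∈ parityMaps θ q b) :
    ins θ q (σ i) h (braid θ σ f) (braid θ τ g) = braid θ ρ (ins θ q i h f g) := by
  refine Multi.ext_part θ fun c w hw => ?_
  have hu := braid_mem τ hg _ _ fun k => hw (innerIdx (σ i) h k)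
  rw [ins_apply θ q _ h _ _ hw, braid_apply θ _ _ (insArg_mem (σ i) h hu hw),
    braid_apply θ ρ _ hw, ins_apply θ q i h f g fun j => hw (ρ j),
    braid_apply θ τ _ fun k => hw (innerIdx (σ i) h k)]
  have e : ∀ u : T, (fun j => insArg (σ i) h u w (σ j)) = insArg i h u fun l => w (ρ l) := by
    intro u
    funext j
    by_cases hj : j = i
    · subst hj; simp
    · have hj' : σ j ≠ σ i := σ.injective.ne hj
      rw [insArg_of_ne _ _ _ _ _ hj, insArg_of_ne _ _ _ _ _ hj', h₂ j hj hj']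
  rw [e, Multi.map_zsmul_insArg]
  simp only [h₁, smul_smul]
  congr 1
  rw [← koszul_comp i h σ τ ρ h₁ h₂ c _ (insArg_self (σ i) h _ c) fun j hj =>
    insArg_of_ne _ _ _ _ _ hj]
  ring

/-- The sign of `e` splits into its passage past the first `i` inputs and past the next `j`. The
first part joins the sign of `g` to form that of the inner composite, of parity `q + t`; the second
is the sign inside it. -/
theorem ins_seq {q t : ZMod 2} {a b c r₁ r₂ r : ℕ} (i : Fin a) (j : Fin b) (l : Fin r₁)
    (h₁ : r₁ + 1 = a + b) (h₂ : r + 1 = r₁ + c) (h₃ : r₂ + 1 = b + c) (h₄ : r + 1 = a + r₂)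
    (hl : l.1 = i.1 + j.1) (f : Multi 𝕜 T a) (g : Multi 𝕜 T b) {e : Multi 𝕜 T c}
    (he : e ∈ parityMaps θ t c) :
    ins θ t l h₂ (ins θ q i h₁ f g) e = ins θ (q + t) i h₄ f (ins θ t j h₃ g e) := by
  refine Multi.ext_part_nat θ fun C W hW => ?_
  have hu := parityMaps.nat he (C := fun k => C (l.1 + k)) (W := fun k => W (l.1 + k))
    fun x => hW _
  rw [ins_apply_nat θ _ _ _ _ _ hW, ins_apply_nat θ _ _ _ _ _ (insNat_mem l.1 c hu hW),
    ins_apply_nat θ _ _ _ _ _ hW, ins_apply_nat θ t j h₃ g e (C := fun k => C (i.1 + k))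
      (W := fun k => W (i.1 + k)) fun x => hW _,
    ← insArg_nat i h₄, Multi.map_zsmul_insArg, insArg_nat, sum_range_insNat_of_le _ _ _ (by omega)]
  simp only [smul_smul]
  have hj := j.2
  have hi := i.2
  congr 1
  · rw [hl, Finset.sum_range_add]
    simp only [← sgn_add]
    congr 1
    ring
  · congr 1
    funext x
    simp only [insNat, hl]
    split_ifs with x1 x2 x3 x4 x5 x6 <;> first
      | rfl
      | (exfalso; omega)
      | skip
    · congr 1
      funext k
      split_ifs with y1 y2 y3 y4 y5 y6 <;> first
        | rfl
        | (exfalso; omega)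
        | (congr 1; omega)
        | (simp only [add_assoc])
    all_goals congr 1; omega

/-- On the right `e` passes the value of `g`, on the left only the inputs of `g`. These differ by
the parity `q`, which accounts for the sign of the exchange. -/
theorem ins_par {q t : ZMod 2} {a b c r₁ r₂ r : ℕ} (i j : Fin a) (l : Fin r₁) (l' : Fin r₂)
    (h₁ : r₁ + 1 = a + b) (h₂ : r + 1 = r₁ + c) (h₃ : r₂ + 1 = a + c) (h₄ : r + 1 = r₂ + b)
    (hij : i < j) (hl : l.1 + 1 = j.1 + b) (hl' : l'.1 = i.1) (f : Multi 𝕜 T a)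
    {g : Multi 𝕜 T b} {e : Multi 𝕜 T c} (hg : g ∈ parityMaps θ q b) (he : e ∈ parityMaps θ t c) :
    ins θ t l h₂ (ins θ q i h₁ f g) e = sgn (q * t) • ins θ q l' h₄ (ins θ t j h₃ f e) g := by
  refine Multi.ext_part_nat θ fun C W hW => ?_
  have hu := parityMaps.nat he (C := fun k => C (l.1 + k)) (W := fun k => W (l.1 + k))
    fun x => hW _
  have hu' := parityMaps.nat hg (C := fun k => C (l'.1 + k)) (W := fun k => W (l'.1 + k))
    fun x => hW _
  rw [ins_apply_nat θ _ _ _ _ _ hW, ins_apply_nat θ _ _ _ _ _ (insNat_mem l.1 c hu hW),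
    _root_.smul_apply, ins_apply_nat θ _ _ _ _ _ hW,
    ins_apply_nat θ _ _ _ _ _ (insNat_mem l'.1 b hu' hW),
    sum_range_insNat_of_le _ _ _ (by rw [Fin.lt_def] at hij; omega)]
  simp only [smul_smul]
  rw [Fin.lt_def] at hij
  congr 1
  · have e := sum_range_insNat l'.1 b j.1 (by omega) (q + ∑ x ∈ Finset.range b, C (l'.1 + x)) C
    have e2 : j.1 - 1 + b = l.1 := by omega
    rw [e2] at e
    have e3 : ∑ x ∈ Finset.range j.1, insNat l'.1 b (q + ∑ x ∈ Finset.range b, C (l'.1 + x)) C x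
        = q + ∑ x ∈ Finset.range l.1, C x := by linear_combination e
    rw [e3, hl']
    simp only [← sgn_add]
    congr 1
    linear_combination (-q * t) * CharTwo.two_eq_zero (R := ZMod 2)
  · congr 1
    funext x
    simp only [insNat, hl']
    split_ifs with x1 x2 x3 x4 x5 x6 <;> first
      | rfl
      | (exfalso; omega)
      | skip
    · congr 1
      funext k
      have := k.2
      rw [if_pos (by omega)]
    · congr 1
      funext k
      rw [if_neg (by omega), if_neg (by omega)]
      congr 1
      omega
    · congr 1
      omega

variable (θ)

/-- The operations of the endomorphism operad of the superspace `T`, with zero differential. -/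
noncomputable def endPreOperad : PreOperad.{u, v} 𝕜 where
  obj p n := parityMaps θ p n
  act σ := (braid θ σ).restrict fun _ hf => braid_mem σ hf
  comp {_ q _ _ _ _} i h hs := LinearMap.mk₂ 𝕜
    (fun f g => ⟨ins θ q i h f.1 g.1, ins_mem i h hs f.2 g.2⟩)
    (fun f f' g => Subtype.ext (LinearMap.map_add₂ (ins θ q i h) f.1 f'.1 g.1))
    (fun c f g => Subtype.ext (LinearMap.map_smul₂ (ins θ q i h) c f.1 g.1))
    (fun f g g' => Subtype.ext (map_add (ins θ q i h f.1) g.1 g'.1))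
    (fun c f g => Subtype.ext (map_smul (ins θ q i h f.1) c g.1))
  d := 0

variable {θ}

theorem endPreOperad_ext {p : ZMod 2} {n : ℕ} {f g : (endPreOperad θ).obj p n}
    (h : f.1 = g.1) : f = g := Subtype.ext h

theorem endPreOperad_zsmul_coe {p : ZMod 2} {n : ℕ} (m : ℤ) (f : (endPreOperad θ).obj p n) :
    (m • f).1 = m • f.1 := (AddSubgroupClass.coe_zsmul f m)

theorem endPreOperad_act_coe {p : ZMod 2} {n : ℕ} (σ : Equiv.Perm (Fin n))
    (f : (endPreOperad θ).obj p n) : ((endPreOperad θ).act σ f).1 = braid θ σ f.1 := rfl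

theorem endPreOperad_comp_coe {p q s : ZMod 2} {a b r : ℕ} (i : Fin a) (h : r + 1 = a + b)
    (hs : s = p + q) (f : (endPreOperad θ).obj p a) (g : (endPreOperad θ).obj q b) :
    ((endPreOperad θ).comp i h hs f g).1 = ins θ q i h f.1 g.1 := rfl

theorem endPreOperad_d {p : ZMod 2} {n : ℕ} (f : (endPreOperad θ).obj p n) :
    (endPreOperad θ).d f = 0 := rfl

variable (θ)

/-- The endomorphism operad of the superspace `T`, with zero differential. -/
noncomputable def endOperad : DGOperad.{u, v} 𝕜 where
  toPreOperad := endPreOperad θ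
  act_one f := endPreOperad_ext (by rw [endPreOperad_act_coe, braid_one])
  act_mul σ τ f := endPreOperad_ext (by simp only [endPreOperad_act_coe, braid_mul])
  comp_act i h hs σ τ ρ h₁ h₂ f g := endPreOperad_ext (by
    simp only [endPreOperad_act_coe, endPreOperad_comp_coe]
    exact ins_braid i h σ τ ρ h₁ h₂ f.1 g.2)
  comp_seq i j l h₁ h₂ h₃ h₄ e₁ e₂ e₃ e₄ hl f g e := endPreOperad_ext (by
    simp only [endPreOperad_comp_coe]
    rw [e₃]
    exact ins_seq i j l h₁ h₂ h₃ h₄ hl f.1 g.1 e.2)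
  comp_par i j l l' h₁ h₂ h₃ h₄ e₁ e₂ e₃ e₄ hij hl hl' f g e := endPreOperad_ext (by
    simp only [endPreOperad_comp_coe, endPreOperad_zsmul_coe]
    exact ins_par i j l l' h₁ h₂ h₃ h₄ hij hl hl' f.1 g.2 e.2)
  d_act σ f := by simp only [endPreOperad_d, map_zero]
  d_comp i h hs e₁ e₂ f g := by
    simp only [endPreOperad_d, map_zero, LinearMap.zero_apply, smul_zero, add_zero]
  d_d f := rfl

end Multi

/-! ### Evaluation of formal composites in an operad -/

section Eval

variable {𝕜 : Type u} [Field 𝕜] {G : ZMod 2 → ℕ → Type v'} (P : PreOperad.{u, v} 𝕜)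
  (γ : ∀ {p n}, G p n → P.obj p n)

/-- The value of a formal composite, where the generators take the values `γ`. -/
noncomputable def evalTree : ∀ {p n}, OpTree G p n → P.obj p n
  | _, _, .gen g => γ g
  | _, _, .act σ t => P.act σ (evalTree t)
  | _, _, .comp i h hs t t' => P.comp i h hs (evalTree t) (evalTree t')

/-- The linear extension of `evalTree`. -/
noncomputable def evalFree {p : ZMod 2} {n : ℕ} : Free 𝕜 G p n →ₗ[𝕜] P.obj p n :=
  Finsupp.linearCombination 𝕜 fun t => evalTree P γ t

@[simp] theorem evalFree_tr {p : ZMod 2} {n : ℕ} (t : OpTree G p n) :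
    evalFree P γ (tr 𝕜 t) = evalTree P γ t := by
  simp [evalFree, tr]

theorem evalFree_act {p : ZMod 2} {n : ℕ} (σ : Equiv.Perm (Fin n)) (x : Free 𝕜 G p n) :
    evalFree P γ (freeAct 𝕜 G σ x) = P.act σ (evalFree P γ x) := by
  induction x using Free.induct with
  | h0 => simp
  | ha x y hx hy => simp only [map_add, hx, hy]
  | hs c x hx => simp only [map_smul, hx]
  | ht t => rw [freeAct_tr, evalFree_tr, evalFree_tr, evalTree]

theorem evalFree_comp {p q s : ZMod 2} {a b r : ℕ} (i : Fin a) (h : r + 1 = a + b)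
    (hs : s = p + q) (x : Free 𝕜 G p a) (y : Free 𝕜 G q b) :
    evalFree P γ (freeComp 𝕜 G i h hs x y)
      = P.comp i h hs (evalFree P γ x) (evalFree P γ y) := by
  induction x using Free.induct with
  | h0 => simp
  | ha x y hx hy => simp only [map_add, LinearMap.add_apply, hx, hy]
  | hs c x hx => simp only [map_smul, LinearMap.smul_apply, hx]
  | ht t =>
    induction y using Free.induct with
    | h0 => simp
    | ha x y hx hy => simp only [map_add, hx, hy]
    | hs c x hx => simp only [map_smul, hx]
    | ht t' => rw [freeComp_tr, evalFree_tr, evalFree_tr, evalFree_tr, evalTree]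

end Eval

section EvalRel

variable {𝕜 : Type u} [Field 𝕜] {G : ZMod 2 → ℕ → Type v'} (P : DGOperad.{u, v} 𝕜)
  (γ : ∀ {p n}, G p n → P.obj p n) {R : ∀ p n, Free 𝕜 G p n → Prop}
  (I : ∀ p n, Submodule 𝕜 (P.obj p n))

/-- The consequences of relations that hold modulo an ideal hold modulo this ideal. -/
theorem evalFree_mem_of_rel
    (base : ∀ p n x, R p n x → evalFree P.toPreOperad γ x ∈ I p n)
    (act : ∀ {p n} (σ : Equiv.Perm (Fin n)) (f : P.obj p n), f ∈ I p n → P.act σ f ∈ I p n)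
    (left : ∀ {p q s a b r} (i : Fin a) (h : r + 1 = a + b) (hs : s = p + q) (f : P.obj p a)
      (t : OpTree G q b), f ∈ I p a → P.comp i h hs f (evalTree P.toPreOperad γ t) ∈ I s r)
    (right : ∀ {p q s a b r} (i : Fin a) (h : r + 1 = a + b) (hs : s = p + q)
      (t : OpTree G p a) (f : P.obj q b), f ∈ I q b →
        P.comp i h hs (evalTree P.toPreOperad γ t) f ∈ I s r)
    {p : ZMod 2} {n : ℕ} {x : Free 𝕜 G p n} (hx : Rel R x) :
    evalFree P.toPreOperad γ x ∈ I p n := by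
  induction hx with
  | base hx => exact base _ _ _ hx
  | act_one t => simp [evalTree, P.act_one]
  | act_mul σ τ t => simp [evalTree, P.act_mul]
  | comp_act i h hs σ τ ρ h₁ h₂ t t' =>
    simp [evalTree, P.comp_act i h hs σ τ ρ h₁ h₂]
  | comp_seq i j l h₁ h₂ h₃ h₄ e₁ e₂ e₃ e₄ hl x y z =>
    simp [evalTree, P.comp_seq i j l h₁ h₂ h₃ h₄ e₁ e₂ e₃ e₄ hl]
  | comp_par i j l l' h₁ h₂ h₃ h₄ e₁ e₂ e₃ e₄ hij hl hl' x y z =>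
    rw [map_sub, map_zsmul, evalFree_tr, evalFree_tr]
    simp only [evalTree]
    rw [P.comp_par i j l l' h₁ h₂ h₃ h₄ e₁ e₂ e₃ e₄ hij hl hl', sub_self]
    exact zero_mem _
  | act σ hx ih => rw [evalFree_act]; exact act σ _ ih
  | comp_left i h hs hx t ih =>
    rw [evalFree_comp, evalFree_tr]; exact left i h hs _ t ih
  | comp_right i h hs t hx ih =>
    rw [evalFree_comp, evalFree_tr]; exact right i h hs t _ ih

end EvalRel

/-! ### Composition with a unary operation -/

section Unary

variable {𝕜 : Type u} [Field 𝕜] (P : DGOperad.{u, v} 𝕜) {t : ZMod 2} (l : P.obj t 1)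

theorem outerIdx_one {n r : ℕ} (i : Fin n) (h : r + 1 = n + 1) (j : Fin n) (hj : j ≠ i) :
    (outerIdx i h j hj).1 = j.1 := by
  have : j.1 ≠ i.1 := fun e => hj (Fin.ext e)
  rw [outerIdx_val]; simp only [Fin.lt_def]; split_ifs <;> omega

/-- Inserting a unary operation does not renumber inputs, so the induced permutation is `σ` itself.
-/
theorem comp_act_unary {p s : ZMod 2} {n : ℕ} (hs : s = p + t) (σ : Equiv.Perm (Fin n))
    (f : P.obj p n) (j : Fin n) :
    P.comp (σ j) rfl hs (P.act σ f) l = P.act σ (P.comp j rfl hs f l) := by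
  have := P.comp_act j rfl hs σ 1 σ
    (fun k => Fin.ext (by have := k.2; simp [innerIdx]))
    (fun k hk hk' => Fin.ext (by
      rw [outerIdx_one]
      congr 2
      exact Fin.ext (outerIdx_one _ _ _ _))) f l
  rwa [P.act_one] at this

theorem unary_comp_act {p s : ZMod 2} {n : ℕ} (hs : s = t + p) (σ : Equiv.Perm (Fin n))
    (f : P.obj p n) :
    P.comp (0 : Fin 1) (Nat.add_comm n 1) hs l (P.act σ f)
      = P.act σ (P.comp (0 : Fin 1) (Nat.add_comm n 1) hs l f) := by
  have := P.comp_act (0 : Fin 1) (Nat.add_comm n 1) hs 1 σ σ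
    (fun k => Fin.ext (by simp [innerIdx]))
    (fun k hk hk' => absurd (Subsingleton.elim k 0) hk) l f
  rwa [P.act_one] at this

variable {p q s s₁ s₂ : ZMod 2} {a b r : ℕ} (i : Fin a) (h : r + 1 = a + b)
  (f : P.obj p a) (g : P.obj q b)

theorem unary_comp_comp (hs : s₁ = p + q) (e : s = t + s₁) (e₁ : s₂ = t + p) (e₂ : s = s₂ + q) :
    P.comp (0 : Fin 1) (Nat.add_comm r 1) e l (P.comp i h hs f g)
      = P.comp i h e₂ (P.comp (0 : Fin 1) (Nat.add_comm a 1) e₁ l f) g :=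
  (P.comp_seq (0 : Fin 1) i i (Nat.add_comm a 1) h h (Nat.add_comm r 1) e₁ e₂ hs e
    (by simp) l f g).symm

theorem comp_comp_unary_inner (k : Fin b) (hs : s₁ = p + q) (e : s = s₁ + t) (e₁ : s₂ = q + t)
    (e₂ : s = p + s₂) :
    P.comp (innerIdx i h k) rfl e (P.comp i h hs f g) l
      = P.comp i h e₂ f (P.comp k rfl e₁ g l) :=
  P.comp_seq i k _ h rfl rfl h hs e e₁ e₂ rfl f g l

/-- Parallel associativity is stated for slots in increasing order. When `j < i` it is applied with
`g` and `l` exchanged, and the sign, being its own inverse, crosses to the other side. -/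
theorem comp_comp_unary_outer (j : Fin a) (hj : j ≠ i) (hs : s₁ = p + q) (e : s = s₁ + t)
    (e₁ : s₂ = p + t) (e₂ : s = s₂ + q) :
    P.comp (outerIdx i h j hj) rfl e (P.comp i h hs f g) l
      = sgn (q * t) • P.comp i h e₂ (P.comp j rfl e₁ f l) g := by
  have hv := outerIdx_val i h j hj
  rcases lt_or_gt_of_ne hj with hlt | hlt
  · have := P.comp_par j i i (outerIdx i h j hj) rfl h h rfl e₁ e₂ hs e hlt rfl
      (by rw [hv, if_pos hlt]) f l g
    rw [this, smul_smul, mul_comm q t, sgn_mul_self, one_smul]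
  · have h2 : i.1 < j.1 := hlt
    exact P.comp_par i j (outerIdx i h j hj) i h rfl rfl h hs e e₁ e₂ hlt
      (by rw [hv, if_neg hlt.not_gt]; omega) rfl f g l

theorem comp_unary_comp (e₁ : s₁ = p + t) (e : s = s₁ + q) (e₂ : s₂ = t + q) (e₃ : s = p + s₂) :
    P.comp i h e (P.comp i rfl e₁ f l) g
      = P.comp i h e₃ f (P.comp (0 : Fin 1) (Nat.add_comm b 1) e₂ l g) :=
  P.comp_seq i (0 : Fin 1) i rfl h (Nat.add_comm b 1) h e₁ e e₂ e₃ (by simp) f l g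

end Unary

/-! ### The derivation `[α, -]` -/

section Bracket

variable {𝕜 : Type u} [Field 𝕜]

/-- The derivation `z ↦ α ∘ z - (-1)^{|z|} ∑ i, z ∘_i α`. -/
def PreOperad.bracket (P : PreOperad.{u, v} 𝕜) {p : ZMod 2} {n : ℕ} (α : P.obj 1 1) :
    P.obj p n →ₗ[𝕜] P.obj (p + 1) n :=
  P.comp (0 : Fin 1) (Nat.add_comm n 1) (add_comm p 1) α
    - sgn p • ∑ i : Fin n, (P.comp i rfl rfl).flip α

theorem PreOperad.bracket_apply (P : PreOperad.{u, v} 𝕜) {p : ZMod 2} {n : ℕ} (α : P.obj 1 1)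
    (z : P.obj p n) : P.bracket α z = P.comp (0 : Fin 1) (Nat.add_comm n 1) (add_comm p 1) α z
      - sgn p • ∑ i : Fin n, P.comp i rfl rfl z α := by
  simp [bracket, LinearMap.sum_apply]

theorem PreOperad.bracket_add (P : PreOperad.{u, v} 𝕜) {p : ZMod 2} {n : ℕ} (α β : P.obj 1 1)
    (z : P.obj p n) : P.bracket (α + β) z = P.bracket α z + P.bracket β z := by
  simp only [bracket_apply, map_add, LinearMap.add_apply, Finset.sum_add_distrib, smul_add]
  abel

theorem PreOperad.twist_d (P : PreOperad.{u, v} 𝕜) {p : ZMod 2} {n : ℕ} (α : P.obj 1 1)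
    (z : P.obj p n) : (P.twist α).d z = P.d z + P.bracket α z := by
  simp only [twist, bracket]
  rw [add_sub_assoc]
  rfl

variable (P : DGOperad.{u, v} 𝕜) (α : P.obj 1 1)

theorem bracket_act {p : ZMod 2} {n : ℕ} (σ : Equiv.Perm (Fin n)) (f : P.obj p n) :
    P.bracket α (P.act σ f) = P.act σ (P.bracket α f) := by
  rw [PreOperad.bracket_apply, PreOperad.bracket_apply, unary_comp_act, map_sub, map_zsmul,
    map_sum, ← Equiv.sum_comp σ]
  simp only [comp_act_unary]

/-- Insertions of `α` into the composite go either into `g` or into a slot of `f` other than `i`.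
The insertion of `α` between `f` and `g` is absent from the left; on the right it occurs in both
brackets with opposite signs and cancels. -/
theorem bracket_comp {p q s : ZMod 2} {a b r : ℕ} (i : Fin a) (h : r + 1 = a + b)
    (hs : s = p + q) (e₁ : s + 1 = (p + 1) + q) (e₂ : s + 1 = p + (q + 1)) (f : P.obj p a)
    (g : P.obj q b) : P.bracket α (P.comp i h hs f g)
      = P.comp i h e₁ (P.bracket α f) g + sgn p • P.comp i h e₂ f (P.bracket α g) := by
  simp only [PreOperad.bracket_apply]
  rw [sum_slots i h, sum_eq_add_sum_ne i, unary_comp_comp P α i h f g hs _ (add_comm p 1) e₁]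
  simp only [fun k => comp_comp_unary_inner P α i h f g k hs rfl rfl e₂,
    fun j : {j : Fin a // j ≠ i} => comp_comp_unary_outer P α i h f g j.1 j.2 hs rfl rfl e₁,
    map_sub, map_add, map_sum, map_zsmul, LinearMap.sub_apply, LinearMap.add_apply,
    LinearMap.sum_apply, LinearMap.smul_apply,
    comp_unary_comp P α i h f g rfl e₁ (add_comm q 1) e₂, ← Finset.smul_sum, mul_one]
  have hsg : sgn s = sgn p * sgn q := by rw [hs, sgn_add]
  simp only [hsg, smul_add, smul_sub, smul_smul]
  rw [mul_assoc, sgn_mul_self, mul_one]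
  abel

end Bracket

/-! ### Operations that commute with a unary operation -/

section Commutes

variable {𝕜 : Type u} [Field 𝕜] (P : DGOperad.{u, v} 𝕜) {t : ZMod 2} (l : P.obj t 1)

/-- `f ∘_j l = (-1)^{|l||f|} l ∘ f` for all `j`. -/
def CommutesWith {p : ZMod 2} {n : ℕ} (f : P.obj p n) : Prop :=
  ∀ j : Fin n, P.comp j rfl (add_comm t p) f l
    = sgn (t * p) • P.comp (0 : Fin 1) (Nat.add_comm n 1) rfl l f

variable {P l}

theorem CommutesWith.act {p : ZMod 2} {n : ℕ} {f : P.obj p n} (hf : CommutesWith P l f)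
    (σ : Equiv.Perm (Fin n)) : CommutesWith P l (P.act σ f) := by
  intro j
  obtain ⟨j, rfl⟩ := σ.surjective j
  rw [comp_act_unary, hf j, map_zsmul, unary_comp_act]

/-- From an inner slot `l` is pulled through `g` and then through `f`; from an outer slot it passes
`g` by parallel associativity and then goes through `f`. The signs multiply to that of the total
parity in both cases. -/
theorem CommutesWith.comp {p q s : ZMod 2} {a b r : ℕ} (i : Fin a) (h : r + 1 = a + b)
    (hs : s = p + q) {f : P.obj p a} {g : P.obj q b} (hf : CommutesWith P l f)
    (hg : CommutesWith P l g) : CommutesWith P l (P.comp i h hs f g) := by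
  have e₁ : t + s = (t + p) + q := by rw [hs, add_assoc]
  have e₂ : t + s = p + (t + q) := by rw [hs, add_left_comm]
  intro m
  rw [unary_comp_comp P l i h f g hs rfl rfl e₁]
  induction m using slot_cases i h with
  | h1 k =>
    rw [comp_comp_unary_inner P l i h f g k hs _ (add_comm t q) e₂, hg k, map_zsmul,
      ← comp_unary_comp P l i h f g (add_comm t p) e₁ rfl e₂, hf i, map_zsmul,
      LinearMap.smul_apply, smul_smul, ← sgn_add, add_comm (t * q), ← mul_add, ← congrArg (t * ·) hs]
  | h2 j hj =>
    rw [comp_comp_unary_outer P l i h f g j hj hs _ (add_comm t p) e₁, hf j, map_zsmul,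
      LinearMap.smul_apply, smul_smul, ← sgn_add, mul_comm q, add_comm (t * q), ← mul_add, ← congrArg (t * ·) hs]

end Commutes

/-! ### Parity involutions of graded spaces -/

section Grade

variable {𝕜 : Type u} [Field 𝕜] {M : Type v} [AddCommGroup M] [Module 𝕜 M]
  (gr : ZMod 2 → Submodule 𝕜 M) [DirectSum.Decomposition gr]

/-- The parity involution of a `ℤ/2`-graded space. -/
noncomputable def gradeInv : M →ₗ[𝕜] M :=
  ∑ p, sgn p • ((gr p).subtype ∘ₗ DirectSum.component 𝕜 _ (fun p => gr p) p ∘ₗ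
    (DirectSum.decomposeLinearEquiv gr).toLinearMap)

theorem gradeInv_apply (m : M) :
    gradeInv gr m = ∑ p, sgn p • (DirectSum.decompose gr m p : M) := by
  simp [gradeInv, LinearMap.sum_apply]
  rfl

variable {gr}

theorem gradeInv_of_mem {p : ZMod 2} {m : M} (hm : m ∈ gr p) : gradeInv gr m = sgn p • m := by
  rw [gradeInv_apply, Finset.sum_eq_single p]
  · rw [DirectSum.decompose_of_mem_same _ hm]
  · intro q _ hq
    rw [DirectSum.decompose_of_mem_ne _ hm hq.symm, smul_zero]
  · simp

variable (gr)

/-- The parity involution of a `ℤ/2`-graded space. -/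
noncomputable def gradeParity : ParityInvolution 𝕜 M where
  inv := gradeInv gr
  inv_inv w := by
    induction w using DirectSum.Decomposition.inductionOn gr with
    | zero => simp
    | homogeneous m => rw [gradeInv_of_mem m.2, map_zsmul, gradeInv_of_mem m.2, sgn_smul_smul]
    | add m m' h h' => rw [map_add, map_add, h, h']

variable {gr}

theorem mem_gradeParity_of_mem {p : ZMod 2} {m : M} (hm : m ∈ gr p) :
    m ∈ (gradeParity gr).part p := gradeInv_of_mem hm

/-- As 2 is invertible, the eigenspace projections of the involution are the projections of the
given grading. -/
theorem gradeParity_pr_mem [CharZero 𝕜] (p : ZMod 2) (m : M) :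
    (gradeParity gr).pr p m ∈ gr p := by
  induction m using DirectSum.Decomposition.inductionOn gr with
  | zero => simp
  | @homogeneous q m =>
    rcases eq_or_ne p q with rfl | hpq
    · rw [ParityInvolution.pr_of_mem _ (mem_gradeParity_of_mem m.2)]
      exact m.2
    · rw [ParityInvolution.pr_of_mem_ne _ (mem_gradeParity_of_mem m.2) hpq]
      exact zero_mem _
  | add m m' h h' => rw [map_add]; exact add_mem h h'

end Grade

/-- The projections are linear polynomials in the involution. -/
theorem ParityInvolution.pr_mem_of_stable {𝕜 : Type u} [Field 𝕜] {T : Type v} [AddCommGroup T]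
    [Module 𝕜 T] (θ : ParityInvolution 𝕜 T) {S : Submodule 𝕜 T} (hS : ∀ x ∈ S, θ.inv x ∈ S)
    (p : ZMod 2) {x : T} (hx : x ∈ S) : θ.pr p x ∈ S := by
  rw [pr_apply]
  exact S.smul_mem _ (add_mem hx (zsmul_mem (hS x hx) _))

/-! ### Powers of the augmentation ideal -/

section Formal

variable {𝕜 : Type u} [Field 𝕜] (A : FormalCDGA 𝕜) (V : DGSpace 𝕜)

theorem gradeInv_mul (a b : A.carrier) :
    gradeInv A.gr (a * b) = gradeInv A.gr a * gradeInv A.gr b := by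
  induction a using DirectSum.Decomposition.inductionOn A.gr with
  | zero => simp
  | add m m' h h' => rw [add_mul, map_add, map_add, add_mul, h, h']
  | homogeneous m =>
    induction b using DirectSum.Decomposition.inductionOn A.gr with
    | zero => simp
    | add m m' h h' => rw [mul_add, map_add, map_add, mul_add, h, h']
    | homogeneous m' =>
      rw [gradeInv_of_mem m.2, gradeInv_of_mem m'.2,
        gradeInv_of_mem (SetLike.mul_mem_graded m.2 m'.2), sgn_add, smul_mul_smul_comm]

variable {A} in
theorem gradeInv_mem_of_homogeneous {I : Ideal A.carrier} (hI : I.IsHomogeneous A.gr)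
    {a : A.carrier} (ha : a ∈ I) : gradeInv A.gr a ∈ I := by
  rw [gradeInv_apply]
  exact sum_mem fun p _ => zsmul_mem (hI p ha) _

variable {A} in
/-- Homogeneous left ideals are two-sided. -/
theorem mul_mem_of_homogeneous {I : Ideal A.carrier} (hI : I.IsHomogeneous A.gr)
    {a : A.carrier} (ha : a ∈ I) (b : A.carrier) : a * b ∈ I := by
  induction b using DirectSum.Decomposition.inductionOn A.gr with
  | zero => simp
  | add m m' h h' => rw [mul_add]; exact add_mem h h'
  | homogeneous b =>
    classical
    rw [← DirectSum.sum_support_decompose A.gr a, Finset.sum_mul]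
    refine sum_mem fun p _ => ?_
    rw [A.comm (SetLike.coe_mem _) b.2]
    exact zsmul_mem (I.mul_mem_left _ (hI p ha)) _

/-- The powers of the augmentation ideal. -/
noncomputable def augPow : ℕ → Submodule 𝕜 A.carrier
  | 0 => ⊤
  | m + 1 => A.aug.restrictScalars 𝕜 * augPow m

theorem mul_mem_augPow_left (m : ℕ) (b : A.carrier) {a : A.carrier} (ha : a ∈ augPow A m) :
    b * a ∈ augPow A m := by
  cases m with
  | zero => trivial
  | succ m =>
    refine Submodule.mul_induction_on ha (fun x hx y hy => ?_) fun x y hx hy => ?_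
    · rw [← mul_assoc]
      exact Submodule.mul_mem_mul (A.aug.mul_mem_left b hx) hy
    · rw [mul_add]; exact add_mem hx hy

theorem augPow_mul (m n : ℕ) {a b : A.carrier} (ha : a ∈ augPow A m) (hb : b ∈ augPow A n) :
    a * b ∈ augPow A (m + n) := by
  induction m generalizing a with
  | zero => rw [zero_add]; exact mul_mem_augPow_left A n a hb
  | succ m ih =>
    rw [Nat.succ_add]
    refine Submodule.mul_induction_on ha (fun x hx y hy => ?_) fun x y hx hy => ?_
    · rw [mul_assoc]
      exact Submodule.mul_mem_mul hx (ih hy)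
    · rw [add_mul]; exact add_mem hx hy

theorem augPow_antitone : Antitone (augPow A) :=
  antitone_nat_of_succ_le fun m => Submodule.mul_le.2 fun x _ _ hy =>
    mul_mem_augPow_left A m x hy

/-- `augPow` starts from the whole algebra, so its first step is A_+ · A. This is A_+ because
homogeneous ideals are two-sided. -/
theorem augPow_one : augPow A 1 = A.aug.restrictScalars 𝕜 := by
  refine le_antisymm (Submodule.mul_le.2 fun x hx y _ =>
    mul_mem_of_homogeneous A.aug_homogeneous hx y) fun x hx => ?_
  rw [← mul_one x]
  exact Submodule.mul_mem_mul hx Submodule.mem_top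

theorem gradeInv_mem_augPow (m : ℕ) {a : A.carrier} (ha : a ∈ augPow A m) :
    gradeInv A.gr a ∈ augPow A m := by
  induction m generalizing a with
  | zero => trivial
  | succ m ih =>
    refine Submodule.mul_induction_on ha (fun x hx y hy => ?_) fun x y hx hy => ?_
    · rw [gradeInv_mul]
      exact Submodule.mul_mem_mul (gradeInv_mem_of_homogeneous A.aug_homogeneous hx) (ih hy)
    · rw [map_add]; exact add_mem hx hy

/-- Compares the adic filtration with the topology: each term of the inverse system sees only
finitely many powers of A_+. -/
theorem exists_augPow_le (i : A.index) : ∃ m, augPow A m ≤ (A.K i).restrictScalars 𝕜 := by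
  obtain ⟨m, hm⟩ := A.K_nilpotent i
  refine ⟨m, fun x hx => ?_⟩
  -- The induction trades a factor of `augPow` for an entry of the list, keeping their number equal
  -- to `m`. At `k = 0` the list product lies in K i, and the arbitrary remaining factor is absorbed
  -- by the two-sided ideal.
  suffices ∀ k (x) (_ : x ∈ augPow A k) (l : List A.carrier), l.length + k = m →
      (∀ a ∈ l, a ∈ A.aug) → l.prod * x ∈ A.K i by
    simpa using this m x hx [] (by simp) (by simp)
  intro k
  induction k with
  | zero =>
    intro x _ l hl ha
    exact mul_mem_of_homogeneous (A.K_homogeneous i) (hm l hl ha) x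
  | succ k ih =>
    intro x hx l hl ha
    refine Submodule.mul_induction_on hx (fun a ha' y hy => ?_) fun x y hx hy => ?_
    · have := ih y hy (l ++ [a]) (by simp; omega) fun b hb => by
        rcases List.mem_append.1 hb with hb | hb
        · exact ha b hb
        · rw [List.mem_singleton.1 hb]; exact ha'
      simpa [mul_assoc] using this
    · rw [mul_add]; exact add_mem hx hy

/-! ### The parity involution of `A ⊗ ΠV` -/

/-- The parity involution of `A/K i`. -/
noncomputable def quotInv (i : A.index) : (A.carrier ⧸ A.K i) →ₗ[𝕜] (A.carrier ⧸ A.K i) :=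
  (Submodule.Quotient.restrictScalarsEquiv 𝕜 (A.K i)).toLinearMap ∘ₗ
    ((A.K i).restrictScalars 𝕜).mapQ ((A.K i).restrictScalars 𝕜) (gradeInv A.gr)
      (fun _ hx => gradeInv_mem_of_homogeneous (A.K_homogeneous i) hx) ∘ₗ
    (Submodule.Quotient.restrictScalarsEquiv 𝕜 (A.K i)).symm.toLinearMap

theorem quotInv_mk (i : A.index) (a : A.carrier) :
    quotInv A i (Submodule.Quotient.mk a) = Submodule.Quotient.mk (gradeInv A.gr a) := rfl

/-- The parity involution of `A/K i ⊗ V`. -/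
noncomputable def levelInv (i : A.index) : Level A V i →ₗ[𝕜] Level A V i :=
  TensorProduct.map (quotInv A i) (gradeInv V.gr)

variable {A V} in
theorem Level.induct {i : A.index} {M : Level A V i → Prop} (u : Level A V i)
    (h0 : M 0) (ha : ∀ x y, M x → M y → M (x + y))
    (ht : ∀ q p a v, a ∈ A.gr q → v ∈ V.gr p → M ((Submodule.Quotient.mk a) ⊗ₜ v)) : M u := by
  induction u using TensorProduct.induction_on with
  | zero => exact h0
  | add x y hx hy => exact ha x y hx hy
  | tmul x v =>
    obtain ⟨a, rfl⟩ := Submodule.Quotient.mk_surjective _ x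
    induction a using DirectSum.Decomposition.inductionOn A.gr with
    | zero => rw [Submodule.Quotient.mk_zero, TensorProduct.zero_tmul]; exact h0
    | add m m' h h' => rw [Submodule.Quotient.mk_add, TensorProduct.add_tmul]; exact ha _ _ h h'
    | homogeneous a =>
      induction v using DirectSum.Decomposition.inductionOn V.gr with
      | zero => rw [TensorProduct.tmul_zero]; exact h0
      | add m m' h h' => rw [TensorProduct.tmul_add]; exact ha _ _ h h'
      | homogeneous v => exact ht _ _ _ _ a.2 v.2

theorem levelInv_tmul (i : A.index) {q p : ZMod 2} {a : A.carrier} {v : V.carrier}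
    (ha : a ∈ A.gr q) (hv : v ∈ V.gr p) :
    levelInv A V i ((Submodule.Quotient.mk a) ⊗ₜ v)
      = sgn (q + p) • ((Submodule.Quotient.mk a) ⊗ₜ v) := by
  rw [levelInv, TensorProduct.map_tmul, quotInv_mk, gradeInv_of_mem ha, gradeInv_of_mem hv,
    sgn_add, mul_smul]
  rw [← Int.cast_smul_eq_zsmul 𝕜 (sgn q), ← Int.cast_smul_eq_zsmul 𝕜 (sgn p),
    ← Int.cast_smul_eq_zsmul 𝕜 (sgn p), ← Int.cast_smul_eq_zsmul 𝕜 (sgn q),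
    TensorProduct.tmul_smul, Submodule.Quotient.mk_smul, ← TensorProduct.smul_tmul', smul_comm]

theorem levelInv_levelInv (i : A.index) (u : Level A V i) :
    levelInv A V i (levelInv A V i u) = u := by
  induction u using Level.induct with
  | h0 => simp
  | ha x y hx hy => rw [map_add, map_add, hx, hy]
  | ht q p a v ha hv =>
    rw [levelInv_tmul A V i ha hv, map_zsmul, levelInv_tmul A V i ha hv, sgn_smul_smul]

theorem levelProj_tmul {i j : A.index} (h : A.K j ≤ A.K i) (a : A.carrier) (v : V.carrier) :
    levelProj V h ((Submodule.Quotient.mk a) ⊗ₜ v) = (Submodule.Quotient.mk a) ⊗ₜ v := rfl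

theorem smul_mk_tmul (i : A.index) (a b : A.carrier) (v : V.carrier) :
    a • ((Submodule.Quotient.mk b : A.carrier ⧸ A.K i) ⊗ₜ[𝕜] v)
      = (Submodule.Quotient.mk (a * b) : A.carrier ⧸ A.K i) ⊗ₜ[𝕜] v := by
  rw [TensorProduct.smul_tmul', ← Submodule.Quotient.mk_smul, smul_eq_mul]

theorem levelProj_levelInv {i j : A.index} (h : A.K j ≤ A.K i) (u : Level A V j) :
    levelProj V h (levelInv A V j u) = levelInv A V i (levelProj V h u) := by
  induction u using Level.induct with
  | h0 => simp
  | ha x y hx hy => simp only [map_add, hx, hy]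
  | ht q p a v ha hv =>
    rw [levelInv_tmul A V j ha hv, map_zsmul, levelProj_tmul, levelInv_tmul A V i ha hv]

variable {A V} in
theorem Tens.ext' {w w' : Tens A V} (h : ∀ i, w.1 i = w'.1 i) : w = w' :=
  Subtype.ext (funext h)

/-- The component of an element of `A ⊗ V` in `A/K i ⊗ V`. -/
noncomputable def toLevel (i : A.index) : Tens A V →ₗ[𝕜] Level A V i where
  toFun w := w.1 i
  map_add' _ _ := rfl
  map_smul' _ _ := rfl

variable {A V} in
@[simp] theorem toLevel_apply (i : A.index) (w : Tens A V) : toLevel A V i w = w.1 i := rfl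

theorem toLevel_smul (i : A.index) (a : A.carrier) (w : Tens A V) :
    toLevel A V i (a • w) = a • toLevel A V i w := rfl

variable {A V} in
theorem toLevel_eq_of_le {i j : A.index} (h : A.K j ≤ A.K i) {w w' : Tens A V}
    (hw : toLevel A V j w = toLevel A V j w') : toLevel A V i w = toLevel A V i w' := by
  have h1 := w.2 i j h
  have h2 := w'.2 i j h
  simp only [toLevel_apply] at hw ⊢
  rw [← h1, ← h2, hw]

/-- The parity involution of `A ⊗ ΠV`. -/
noncomputable def tensParity : ParityInvolution 𝕜 (Tens A V) where
  inv :=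
    -- The minus sign is the parity shift from V to ΠV.
    { toFun := fun w => ⟨fun i => -levelInv A V i (w.1 i), fun i j h => by
        rw [map_neg, levelProj_levelInv, w.2 i j h]⟩
      map_add' := fun w w' => Tens.ext' fun i => by
        change -levelInv A V i (w.1 i + w'.1 i) = -levelInv A V i (w.1 i) + -levelInv A V i (w'.1 i)
        rw [map_add, neg_add]
      map_smul' := fun c w => Tens.ext' fun i => by
        change -levelInv A V i (c • w.1 i) = c • -levelInv A V i (w.1 i)
        rw [map_smul, smul_neg] }
  inv_inv w := Tens.ext' fun i => by
    change -levelInv A V i (-levelInv A V i (w.1 i)) = w.1 i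
    rw [map_neg, neg_neg, levelInv_levelInv]

theorem toLevel_inv (i : A.index) (w : Tens A V) :
    toLevel A V i ((tensParity A V).inv w) = -levelInv A V i (toLevel A V i w) := rfl

variable {A V}

theorem levelInv_of_mem {i : A.index} {p : ZMod 2} {u : Level A V i}
    (hu : u ∈ ⨆ q : ZMod 2, levelTens A V i (A.gr q) (V.gr (p - q))) :
    levelInv A V i u = sgn p • u := by
  suffices ⨆ q : ZMod 2, levelTens A V i (A.gr q) (V.gr (p - q))
      ≤ LinearMap.ker (levelInv A V i - sgn p • LinearMap.id) by
    simpa [sub_eq_zero] using this hu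
  refine iSup_le fun q => Submodule.map₂_le.2 ?_
  rintro _ ⟨a, ha, rfl⟩ v hv
  have := levelInv_tmul A V i ha hv
  rw [add_sub_cancel] at this
  simpa [sub_eq_zero] using this

/-- For every `u`, the sum of `u` and (-1)^p times its image lies in the part of parity `p`; for an
eigenvector this sum is 2u. -/
theorem mem_of_levelInv [CharZero 𝕜] {i : A.index} {p : ZMod 2} {u : Level A V i}
    (hu : levelInv A V i u = sgn p • u) :
    u ∈ ⨆ q : ZMod 2, levelTens A V i (A.gr q) (V.gr (p - q)) := by
  set S := ⨆ q : ZMod 2, levelTens A V i (A.gr q) (V.gr (p - q)) with hS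
  have key : ∀ u, u + sgn p • levelInv A V i u ∈ S := by
    intro u
    induction u using Level.induct with
    | h0 => simp
    | ha x y hx hy =>
      have := add_mem hx hy
      rw [map_add, smul_add]
      convert this using 1
      abel
    | ht q r a v ha hv =>
      rw [levelInv_tmul A V i ha hv]
      rcases eq_or_ne p (q + r) with rfl | hne
      · rw [sgn_smul_smul]
        have : (Submodule.Quotient.mk a : A.carrier ⧸ A.K i) ⊗ₜ[𝕜] v ∈ S := by
          refine Submodule.mem_iSup_of_mem q (Submodule.apply_mem_map₂ _ ⟨a, ha, rfl⟩ ?_)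
          rwa [add_sub_cancel_left]
        exact add_mem this this
      · have : p + (q + r) = 1 := by
          generalize q + r = s at hne
          revert hne; clear hu hS; clear S; revert p s; decide
        rw [smul_smul, ← sgn_add, this, sgn_one, neg_smul, one_smul, add_neg_cancel]
        exact zero_mem _
  have h2 := key u
  rw [hu, sgn_smul_smul, ← two_smul 𝕜] at h2
  have := S.smul_mem (2 : 𝕜)⁻¹ h2
  rwa [smul_smul, inv_mul_cancel₀ two_ne_zero, one_smul] at this

/-- Parity, imposed separately on every term of the inverse system, becomes an eigenspace condition
on the limit itself, where projections to homogeneous parts are available. -/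
theorem piHomog_iff [CharZero 𝕜] {p : ZMod 2} {w : Tens A V} :
    PiHomog A V p w ↔ w ∈ (tensParity A V).part p := by
  have e : ∀ u u' : Tens A V, u = u' ↔ ∀ i, toLevel A V i u = toLevel A V i u' :=
    fun u u' => ⟨fun h i => by rw [h], fun h => Tens.ext' h⟩
  rw [ParityInvolution.mem_part, e]
  refine forall_congr' fun i => ?_
  rw [toLevel_inv, map_zsmul, neg_eq_iff_eq_neg, ← neg_smul]
  have : -sgn p = sgn (p + 1) := by rw [sgn_add, sgn_one, mul_neg, mul_one]
  rw [this]
  exact ⟨levelInv_of_mem, mem_of_levelInv⟩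

theorem homog_iff [CharZero 𝕜] {p : ZMod 2} {w : Tens A V} :
    Homog A V p w ↔ w ∈ (tensParity A V).part (p + 1) := by
  rw [← piHomog_iff, PiHomog, add_assoc, zmod_two_add_self, add_zero]

theorem tensParity_inv_smul {q : ZMod 2} {a : A.carrier} (ha : a ∈ A.gr q) (w : Tens A V) :
    (tensParity A V).inv (a • w) = sgn q • a • (tensParity A V).inv w := by
  refine Tens.ext' fun i => ?_
  rw [← toLevel_apply, ← toLevel_apply, toLevel_inv, toLevel_smul, map_zsmul, toLevel_smul, toLevel_inv, smul_neg, smul_neg]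
  congr 1
  generalize toLevel A V i w = u
  induction u using Level.induct with
  | h0 => simp
  | ha x y hx hy => simp only [map_add, smul_add, hx, hy]
  | ht r p b v hb hv =>
    rw [smul_mk_tmul, levelInv_tmul A V i (SetLike.mul_mem_graded ha hb) hv,
      levelInv_tmul A V i hb hv, smul_comm a, smul_smul, ← sgn_add, add_assoc, smul_mk_tmul]

theorem smul_mem_part {q p : ZMod 2} {a : A.carrier} (ha : a ∈ A.gr q) {w : Tens A V}
    (hw : w ∈ (tensParity A V).part p) : a • w ∈ (tensParity A V).part (q + p) := by
  rw [ParityInvolution.mem_part] at hw ⊢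
  rw [tensParity_inv_smul ha, hw, sgn_add, mul_smul, smul_comm a]

/-! ### The filtration by powers of the augmentation ideal -/

variable (A V)

/-- The elements of `A_+^m ⊗ V`. -/
noncomputable def fil (m : ℕ) : Submodule 𝕜 (Tens A V) where
  carrier := {w | ∀ i, toLevel A V i w ∈ levelTens A V i (augPow A m) ⊤}
  zero_mem' i := by rw [map_zero]; exact zero_mem _
  add_mem' hx hy i := by rw [map_add]; exact add_mem (hx i) (hy i)
  smul_mem' c _ hx i := by rw [map_smul]; exact Submodule.smul_mem _ c (hx i)

variable {A V}

theorem mem_fil {m : ℕ} {w : Tens A V} :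
    w ∈ fil A V m ↔ ∀ i, toLevel A V i w ∈ levelTens A V i (augPow A m) ⊤ := Iff.rfl

theorem inPlus_iff {w : Tens A V} : InPlus A V w ↔ w ∈ fil A V 1 := by
  rw [mem_fil, augPow_one]; rfl

theorem levelTens_mono {i : A.index} {S S' : Submodule 𝕜 A.carrier} (h : S ≤ S')
    (T : Submodule 𝕜 V.carrier) : levelTens A V i S T ≤ levelTens A V i S' T :=
  Submodule.map₂_le_map₂_left (Submodule.map_mono h)

theorem fil_antitone : Antitone (fil A V) := fun _ _ h _ hw i =>
  levelTens_mono (augPow_antitone A h) _ (hw i)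

theorem mem_fil_zero (w : Tens A V) : w ∈ fil A V 0 := fun i => by
  generalize toLevel A V i w = u
  induction u using Level.induct with
  | h0 => exact zero_mem _
  | ha x y hx hy => exact add_mem hx hy
  | ht q p a v ha hv => exact Submodule.apply_mem_map₂ _ ⟨a, trivial, rfl⟩ trivial

theorem smul_mem_fil {m n : ℕ} {a : A.carrier} (ha : a ∈ augPow A m) {w : Tens A V}
    (hw : w ∈ fil A V n) : a • w ∈ fil A V (m + n) := fun i => by
  have : levelTens A V i (augPow A n) ⊤ ≤ (levelTens A V i (augPow A (m + n)) ⊤).comap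
      (Algebra.lsmul 𝕜 𝕜 (Level A V i) a) := by
    refine Submodule.map₂_le.2 ?_
    rintro _ ⟨b, hb, rfl⟩ v hv
    change a • ((Submodule.Quotient.mk b : A.carrier ⧸ A.K i) ⊗ₜ[𝕜] v)
      ∈ levelTens A V i (augPow A (m + n)) ⊤
    rw [smul_mk_tmul]
    exact Submodule.apply_mem_map₂ _ ⟨_, augPow_mul A m n ha hb, rfl⟩ trivial
  exact this (hw i)

theorem inv_mem_fil {m : ℕ} {w : Tens A V} (hw : w ∈ fil A V m) :
    (tensParity A V).inv w ∈ fil A V m := fun i => by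
  rw [toLevel_inv]
  refine neg_mem ?_
  have : levelTens A V i (augPow A m) ⊤ ≤ (levelTens A V i (augPow A m) ⊤).comap
      (levelInv A V i) := by
    refine Submodule.map₂_le.2 ?_
    rintro _ ⟨a, ha, rfl⟩ v hv
    exact Submodule.apply_mem_map₂ _ ⟨_, gradeInv_mem_augPow A m ha, rfl⟩ trivial
  exact this (hw i)

/-- Elements a ⊗ v with a in A_+^m vanish in A/K i ⊗ V. Congruences modulo A_+^m ⊗ V thus become
equalities at level `i`. -/
theorem toLevel_eq_zero_of_mem_fil {m : ℕ} {i : A.index}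
    (h : augPow A m ≤ (A.K i).restrictScalars 𝕜) {w : Tens A V} (hw : w ∈ fil A V m) :
    toLevel A V i w = 0 := by
  have : levelTens A V i (augPow A m) ⊤ ≤ ⊥ := by
    refine Submodule.map₂_le.2 ?_
    rintro _ ⟨a, ha, rfl⟩ v hv
    have : (Submodule.Quotient.mk a : A.carrier ⧸ A.K i) = 0 :=
      (Submodule.Quotient.mk_eq_zero _).2 (h ha)
    change (Submodule.Quotient.mk a : A.carrier ⧸ A.K i) ⊗ₜ[𝕜] v = 0
    rw [this, TensorProduct.zero_tmul]
  exact this (hw i)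

theorem eq_zero_of_mem_fil {w : Tens A V} (hw : ∀ m, w ∈ fil A V m) : w = 0 :=
  Tens.ext' fun i => by
    obtain ⟨m, hm⟩ := exists_augPow_le A i
    exact toLevel_eq_zero_of_mem_fil hm (hw m)

variable (A V) in
/-- The span of the `a • u`, with `a` a homogeneous element of `A_+^m`. -/
noncomputable def filSpan (m : ℕ) : Submodule 𝕜 (Tens A V) :=
  Submodule.span 𝕜 {x | ∃ (q : ZMod 2) (a : A.carrier) (u : Tens A V),
    a ∈ augPow A m ∧ a ∈ A.gr q ∧ x = a • u}

theorem inv_mem_filSpan {m : ℕ} {w : Tens A V} (hw : w ∈ filSpan A V m) :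
    (tensParity A V).inv w ∈ filSpan A V m := by
  suffices filSpan A V m ≤ (filSpan A V m).comap (tensParity A V).inv from this hw
  refine Submodule.span_le.2 ?_
  rintro _ ⟨q, a, u, ha, hq, rfl⟩
  change (tensParity A V).inv (a • u) ∈ filSpan A V m
  rw [tensParity_inv_smul hq]
  refine zsmul_mem (S := Submodule 𝕜 (Tens A V)) (Submodule.subset_span ?_) _
  exact ⟨q, a, _, ha, hq, rfl⟩

/-- Elements of `fil` are given level by level and need not be finite sums a • u. At any one level
they agree with such sums, to which A-multilinearity applies. -/
theorem exists_filSpan [CharZero 𝕜] {m : ℕ} {w : Tens A V} (hw : w ∈ fil A V m) (j : A.index) :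
    ∃ w' ∈ filSpan A V m, toLevel A V j w' = toLevel A V j w := by
  suffices levelTens A V j (augPow A m) ⊤ ≤ (filSpan A V m).map (toLevel A V j) from this (hw j)
  refine Submodule.map₂_le.2 ?_
  rintro _ ⟨a, ha, rfl⟩ v -
  refine ⟨a • incl A V v, ?_, ?_⟩
  -- The coefficient is split into homogeneous parts, which remain in A_+^m since this space is
  -- stable under the involution.
  · rw [← (gradeParity A.gr).sum_pr a, Finset.sum_smul]
    refine sum_mem fun q _ => Submodule.subset_span (Set.mem_ofPred.2
      ⟨q, _, _, ?_, gradeParity_pr_mem q a, rfl⟩)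
    exact ParityInvolution.pr_mem_of_stable _ (fun x hx => gradeInv_mem_augPow A m hx) q ha
  · change a • ((Submodule.Quotient.mk 1 : A.carrier ⧸ A.K j) ⊗ₜ[𝕜] v)
      = (Submodule.Quotient.mk a : A.carrier ⧸ A.K j) ⊗ₜ[𝕜] v
    rw [smul_mk_tmul, mul_one]

end Formal

/-! ### Unary operations in the endomorphism operad -/

section EndOperad

variable {𝕜 : Type u} [Field 𝕜] [CharZero 𝕜] {T : Type v} [AddCommGroup T] [Module 𝕜 T]
  {θ : ParityInvolution 𝕜 T}

/-- The underlying multilinear map of an operation of the endomorphism operad. -/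
noncomputable def toMulti {p : ZMod 2} {n : ℕ} : (endOperad θ).obj p n →ₗ[𝕜] Multi 𝕜 T n :=
  (parityMaps θ p n).subtype

/-- A multilinear map of parity `p` as an operation of the endomorphism operad. -/
noncomputable def ofMulti {p : ZMod 2} {n : ℕ} (f : Multi 𝕜 T n) (hf : f ∈ parityMaps θ p n) :
    (endOperad θ).obj p n := ⟨f, hf⟩

@[simp] theorem toMulti_ofMulti {p : ZMod 2} {n : ℕ} (f : Multi 𝕜 T n)
    (hf : f ∈ parityMaps θ p n) : toMulti (ofMulti f hf) = f := rfl

theorem toMulti_mem {p : ZMod 2} {n : ℕ} (f : (endOperad θ).obj p n) :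
    toMulti f ∈ parityMaps θ p n := f.2

theorem toMulti_injective {p : ZMod 2} {n : ℕ} :
    Function.Injective (toMulti (θ := θ) (p := p) (n := n)) := Subtype.val_injective

theorem toMulti_act {p : ZMod 2} {n : ℕ} (σ : Equiv.Perm (Fin n)) (f : (endOperad θ).obj p n) :
    toMulti ((endOperad θ).act σ f) = braid θ σ (toMulti f) := rfl

theorem toMulti_comp {p q s : ZMod 2} {a b r : ℕ} (i : Fin a) (h : r + 1 = a + b)
    (hs : s = p + q) (f : (endOperad θ).obj p a) (g : (endOperad θ).obj q b) :
    toMulti ((endOperad θ).comp i h hs f g) = ins θ q i h (toMulti f) (toMulti g) := rfl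

/-- A linear map as a multilinear map in one variable. -/
def unaryMulti (D : T →ₗ[𝕜] T) : Multi 𝕜 T 1 :=
  MultilinearMap.mk' (fun w => D (w 0))
    (fun w l x y => by obtain rfl := Subsingleton.elim l 0; simp)
    (fun w l x y => by obtain rfl := Subsingleton.elim l 0; simp)

@[simp] theorem unaryMulti_apply (D : T →ₗ[𝕜] T) (w : Fin 1 → T) :
    unaryMulti D w = D (w 0) := rfl

theorem insArg_unary {α : Type*} {n : ℕ} (j : Fin n) (u : α) (w : Fin n → α) :
    insArg j rfl u w = Function.update w j u := by
  funext k
  by_cases hk : k = j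
  · subst hk; simp
  · rw [insArg_of_ne _ _ _ _ _ hk, Function.update_of_ne hk]
    exact congrArg w (Fin.ext (outerIdx_one j rfl k hk))

theorem ins_unary_apply {t : ZMod 2} {n : ℕ} (j : Fin n) (f : Multi 𝕜 T n) (D : Multi 𝕜 T 1)
    {c : Fin n → ZMod 2} {w : Fin n → T} (hw : ∀ j, w j ∈ θ.part (c j)) :
    ins θ t j rfl f D w
      = sgn (t * ∑ l with l < j, c l) • f (Function.update w j (D fun _ => w j)) := by
  rw [ins_apply θ t j rfl f D hw, insArg_unary]
  congr 3
  congr 1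
  funext k
  exact congrArg w (Fin.ext (by have := k.2; simp [innerIdx]))

/-- A multilinear map in one variable as a linear map. -/
def unaryLin (D : Multi 𝕜 T 1) : T →ₗ[𝕜] T where
  toFun x := D fun _ => x
  map_add' x y := by
    have := D.map_update_add (fun _ => 0) 0 x y
    simp only [Function.update_eq_const_of_subsingleton] at this
    exact this
  map_smul' c x := by
    have := D.map_update_smul (fun _ => 0) 0 c x
    simp only [Function.update_eq_const_of_subsingleton] at this
    exact this

@[simp] theorem unaryLin_apply (D : Multi 𝕜 T 1) (x : T) : unaryLin D x = D fun _ => x := rfl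

/-- The only slot of a unary operation has no inputs before it, so no sign appears and the formula
holds for arbitrary, not just homogeneous, arguments. -/
theorem unary_ins_apply {p : ZMod 2} {n : ℕ} (f : Multi 𝕜 T n) (D : Multi 𝕜 T 1)
    (w : Fin n → T) : ins θ p (0 : Fin 1) (Nat.add_comm n 1) D f w = D fun _ => f w := by
  have : ins θ p (0 : Fin 1) (Nat.add_comm n 1) D f = (unaryLin D).compMultilinearMap f := by
    refine Multi.ext_part θ fun c w hw => ?_
    rw [ins_apply θ p _ _ _ _ hw]
    simp only [Fin.val_zero, not_lt_zero, Finset.filter_false, Finset.sum_empty, mul_zero,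
      sgn_zero, one_smul]
    change D _ = D fun _ => f w
    congr 1
    funext k
    obtain rfl := Subsingleton.elim k 0
    rw [insArg_self]
    congr 1
    funext k
    exact congrArg w (Fin.ext (by simp [innerIdx]))
  rw [this]
  rfl

end EndOperad

/-! ### Continuous A-multilinear operations with values in A_+ ⊗ ΠV -/

section EndA

variable {𝕜 : Type u} [Field 𝕜] [CharZero 𝕜] {A : FormalCDGA 𝕜} {V : DGSpace 𝕜}

variable (A V) in
/-- The operad of graded multilinear maps on `A ⊗ ΠV`. -/
noncomputable abbrev tensEnd : DGOperad 𝕜 := endOperad (tensParity A V)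

/-- Multiplication by an element of `A`, as a unary operation. -/
noncomputable def smulOp {q : ZMod 2} (a : A.carrier) (ha : a ∈ A.gr q) :
    (tensEnd A V).obj q 1 :=
  ofMulti (unaryMulti (Algebra.lsmul 𝕜 𝕜 (Tens A V) a)) fun c w hw => by
    simpa using smul_mem_part ha (hw 0)

theorem toMulti_smulOp {q : ZMod 2} (a : A.carrier) (ha : a ∈ A.gr q) (w : Fin 1 → Tens A V) :
    toMulti (smulOp (V := V) a ha) w = a • w 0 := rfl

theorem exists_K_le {ι : Type*} (s : Finset ι) (j : ι → A.index) :
    ∃ k, ∀ x ∈ s, A.K k ≤ A.K (j x) := by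
  classical
  obtain ⟨k, hk⟩ := A.K_directed.finset_le (s.image j)
  exact ⟨k, fun x hx => hk _ (Finset.mem_image_of_mem j hx)⟩

theorem exists_K_le₂ (i j : A.index) : ∃ k, A.K k ≤ A.K i ∧ A.K k ≤ A.K j :=
  A.K_directed i j

/-- Continuity of a multilinear map on `A ⊗ V`. -/
def IsCont {n : ℕ} (f : Multi 𝕜 (Tens A V) n) : Prop :=
  ∀ w i, ∃ j, ∀ w' : Fin n → Tens A V, (∀ l, toLevel A V j (w' l) = toLevel A V j (w l)) →
    toLevel A V i (f w') = toLevel A V i (f w)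

theorem IsCont.zero {n : ℕ} : IsCont (0 : Multi 𝕜 (Tens A V) n) := fun _ i => ⟨i, fun _ _ => rfl⟩

theorem IsCont.add {n : ℕ} {f g : Multi 𝕜 (Tens A V) n} (hf : IsCont f) (hg : IsCont g) :
    IsCont (f + g) := by
  intro w i
  obtain ⟨j, hj⟩ := hf w i
  obtain ⟨j', hj'⟩ := hg w i
  obtain ⟨k, hk, hk'⟩ := exists_K_le₂ j j'
  refine ⟨k, fun w' h => ?_⟩
  rw [_root_.add_apply, _root_.add_apply, map_add, map_add,
    hj w' fun l => toLevel_eq_of_le hk (h l), hj' w' fun l => toLevel_eq_of_le hk' (h l)]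

theorem IsCont.smul {n : ℕ} {f : Multi 𝕜 (Tens A V) n} (hf : IsCont f) (c : 𝕜) :
    IsCont (c • f) := by
  intro w i
  obtain ⟨j, hj⟩ := hf w i
  refine ⟨j, fun w' h => ?_⟩
  rw [_root_.smul_apply, _root_.smul_apply, map_smul, map_smul, hj w' h]

theorem toLevel_pr_congr (p : ZMod 2) {j : A.index} {w w' : Tens A V}
    (h : toLevel A V j w = toLevel A V j w') :
    toLevel A V j ((tensParity A V).pr p w) = toLevel A V j ((tensParity A V).pr p w') := by
  simp only [ParityInvolution.pr_apply, map_smul, map_add, map_zsmul, toLevel_inv, h]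

theorem IsCont.signed {n : ℕ} {f : Multi 𝕜 (Tens A V) n} (hf : IsCont f)
    (s : (Fin n → ZMod 2) → ℤ) : IsCont (signed (tensParity A V) s f) := by
  intro w i
  choose j hj using fun c : Fin n → ZMod 2 => hf (fun l => (tensParity A V).pr (c l) (w l)) i
  obtain ⟨k, hk⟩ := exists_K_le Finset.univ j
  refine ⟨k, fun w' h => ?_⟩
  rw [signed_apply', signed_apply', map_sum, map_sum]
  refine Finset.sum_congr rfl fun c hc => ?_
  rw [map_zsmul, map_zsmul, hj c _ fun l => toLevel_pr_congr _ (toLevel_eq_of_le (hk c hc) (h l))]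

theorem IsCont.domDomCongr {n : ℕ} {f : Multi 𝕜 (Tens A V) n} (hf : IsCont f)
    (σ : Equiv.Perm (Fin n)) : IsCont (f.domDomCongr σ) := by
  intro w i
  obtain ⟨j, hj⟩ := hf (fun l => w (σ l)) i
  exact ⟨j, fun w' h => hj _ fun l => h (σ l)⟩

theorem IsCont.insRaw {a b r : ℕ} (i : Fin a) (h : r + 1 = a + b) {f : Multi 𝕜 (Tens A V) a}
    {g : Multi 𝕜 (Tens A V) b} (hf : IsCont f) (hg : IsCont g) : IsCont (insRaw i h f g) := by
  intro w m
  obtain ⟨j, hj⟩ := hf (insArg i h (g fun k => w (innerIdx i h k)) w) m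
  obtain ⟨j', hj'⟩ := hg (fun k => w (innerIdx i h k)) j
  obtain ⟨k, hk, hk'⟩ := exists_K_le₂ j j'
  refine ⟨k, fun w' hw' => hj _ fun l => ?_⟩
  by_cases hl : l = i
  · subst hl
    rw [insArg_self, insArg_self]
    exact hj' _ fun l => toLevel_eq_of_le hk' (hw' _)
  · rw [insArg_of_ne _ _ _ _ _ hl, insArg_of_ne _ _ _ _ _ hl]
    exact toLevel_eq_of_le hk (hw' _)

/-- Operadic form of A-multilinearity: commutation with multiplication by homogeneous elements of A.
In this form its stability under composition follows from the operad axioms, without further sign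
computations. -/
theorem isEndA_iff {p : ZMod 2} {n : ℕ} (f : (tensEnd A V).obj p n) :
    IsEndA A V p (toMulti f) ↔
      (∀ (q : ZMod 2) (a : A.carrier) (ha : a ∈ A.gr q), CommutesWith (tensEnd A V) (smulOp a ha) f)
        ∧ (∀ w, toMulti f w ∈ fil A V 1) ∧ IsCont (toMulti f) := by
  have key : (∀ (c : Fin n → ZMod 2) w, (∀ j, PiHomog A V (c j) (w j)) →
      ∀ (q : ZMod 2) (a : A.carrier), a ∈ A.gr q → ∀ j, toMulti f (Function.update w j (a • w j))
        = sgn (q * (p + ∑ l with l < j, c l)) • (a • toMulti f w)) ↔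
      ∀ (q : ZMod 2) (a : A.carrier) (ha : a ∈ A.gr q),
        CommutesWith (tensEnd A V) (smulOp a ha) f := by
    constructor
    · intro H q a ha j
      refine toMulti_injective ?_
      rw [map_zsmul, toMulti_comp, toMulti_comp]
      refine Multi.ext_part (tensParity A V) fun c w hw => ?_
      rw [ins_unary_apply j _ _ hw, _root_.smul_apply, unary_ins_apply, toMulti_smulOp,
        toMulti_smulOp, H c w (fun j => piHomog_iff.2 (hw j)) q a ha j, smul_smul, mul_add,
        sgn_add, mul_left_comm, sgn_mul_self, mul_one]
    · intro H c w hw q a ha j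
      have hw' := fun j => piHomog_iff.1 (hw j)
      have := congrArg (fun g => toMulti g w) (H q a ha j)
      simp only [map_zsmul, toMulti_comp] at this
      rw [ins_unary_apply j _ _ hw', _root_.smul_apply, unary_ins_apply, toMulti_smulOp,
        toMulti_smulOp] at this
      rw [mul_add, add_comm, sgn_add, mul_smul, ← this, sgn_smul_smul]
  constructor
  · intro H
    exact ⟨key.1 H.multilinear, fun w => inPlus_iff.1 (H.plus w), H.continuous⟩
  · rintro ⟨h1, h2, h3⟩
    exact ⟨fun c w hw => piHomog_iff.2 (toMulti_mem f c w fun j => piHomog_iff.1 (hw j)),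
      key.2 h1, fun w => inPlus_iff.2 (h2 w), h3⟩

theorem IsEndA.mem_parityMaps {p : ZMod 2} {n : ℕ} {f : Multi 𝕜 (Tens A V) n}
    (hf : IsEndA A V p f) : f ∈ parityMaps (tensParity A V) p n :=
  fun c w hw => piHomog_iff.1 (hf.parity c w fun j => piHomog_iff.2 (hw j))

theorem signed_mem {n : ℕ} {f : Multi 𝕜 (Tens A V) n} {S : Submodule 𝕜 (Tens A V)}
    (hf : ∀ w, f w ∈ S) (s : (Fin n → ZMod 2) → ℤ) (w : Fin n → Tens A V) :
    signed (tensParity A V) s f w ∈ S := by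
  rw [signed_apply']
  exact sum_mem fun c _ => zsmul_mem (hf _) _

theorem braid_eq {n : ℕ} (σ : Equiv.Perm (Fin n)) (f : Multi 𝕜 (Tens A V) n) :
    braid (tensParity A V) σ f = signed (tensParity A V) (koszul σ) (f.domDomCongr σ) := rfl

theorem isEndA_act {p : ZMod 2} {n : ℕ} (σ : Equiv.Perm (Fin n)) {f : (tensEnd A V).obj p n}
    (hf : IsEndA A V p (toMulti f)) : IsEndA A V p (toMulti ((tensEnd A V).act σ f)) := by
  rw [isEndA_iff] at hf ⊢
  refine ⟨fun q a ha => (hf.1 q a ha).act σ, ?_⟩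
  rw [toMulti_act, braid_eq]
  refine ⟨signed_mem (fun w => ?_) _, (hf.2.2.domDomCongr σ).signed _⟩
  rw [MultilinearMap.domDomCongr_apply]
  exact hf.2.1 _

theorem isEndA_comp {p q s : ZMod 2} {a b r : ℕ} (i : Fin a) (h : r + 1 = a + b)
    (hs : s = p + q) {f : (tensEnd A V).obj p a} {g : (tensEnd A V).obj q b}
    (hf : IsEndA A V p (toMulti f)) (hg : IsEndA A V q (toMulti g)) :
    IsEndA A V s (toMulti ((tensEnd A V).comp i h hs f g)) := by
  rw [isEndA_iff] at hf hg ⊢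
  refine ⟨fun q a ha => (hf.1 q a ha).comp i h hs (hg.1 q a ha), ?_⟩
  rw [toMulti_comp, ins_eq]
  refine ⟨signed_mem (fun w => ?_) _, (hf.2.2.insRaw i h hg.2.2).signed _⟩
  rw [insRaw_apply]
  exact hf.2.1 _

theorem IsEndA.zero {p : ZMod 2} {n : ℕ} :
    IsEndA A V p (0 : Multi 𝕜 (Tens A V) n) where
  parity c w _ := piHomog_iff.2 (zero_mem _)
  multilinear := by simp
  plus w := inPlus_iff.2 (zero_mem _)
  continuous := IsCont.zero

theorem IsEndA.add {p : ZMod 2} {n : ℕ} {f g : Multi 𝕜 (Tens A V) n} (hf : IsEndA A V p f)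
    (hg : IsEndA A V p g) : IsEndA A V p (f + g) where
  parity c w hw := piHomog_iff.2 (add_mem (piHomog_iff.1 (hf.parity c w hw))
    (piHomog_iff.1 (hg.parity c w hw)))
  multilinear c w hw q a ha j := by
    rw [_root_.add_apply, hf.multilinear c w hw q a ha j, hg.multilinear c w hw q a ha j,
      _root_.add_apply, smul_add, smul_add]
  plus w := inPlus_iff.2 (add_mem (inPlus_iff.1 (hf.plus w)) (inPlus_iff.1 (hg.plus w)))
  continuous := IsCont.add hf.continuous hg.continuous

theorem IsEndA.smul {p : ZMod 2} {n : ℕ} {f : Multi 𝕜 (Tens A V) n} (hf : IsEndA A V p f)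
    (k : 𝕜) : IsEndA A V p (k • f) where
  parity c w hw := piHomog_iff.2 (Submodule.smul_mem _ k (piHomog_iff.1 (hf.parity c w hw)))
  multilinear c w hw q a ha j := by
    rw [_root_.smul_apply, hf.multilinear c w hw q a ha j, _root_.smul_apply, smul_comm k,
      smul_comm k]
  plus w := inPlus_iff.2 (Submodule.smul_mem _ k (inPlus_iff.1 (hf.plus w)))
  continuous := IsCont.smul hf.continuous k

/-- `A`-multilinearity on arguments that need not be homogeneous. -/
theorem IsEndA.map_update_algebra_smul {p : ZMod 2} {n : ℕ} {f : Multi 𝕜 (Tens A V) n}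
    (hf : IsEndA A V p f) {q : ZMod 2} {a : A.carrier} (ha : a ∈ A.gr q) (j : Fin n)
    (w : Fin n → Tens A V) : f (Function.update w j (a • w j))
      = a • signed (tensParity A V) (fun c => sgn (q * (p + ∑ l with l < j, c l))) f w := by
  have key : f.compLinearMap (fun k => if k = j then Algebra.lsmul 𝕜 𝕜 (Tens A V) a
      else LinearMap.id) = (Algebra.lsmul 𝕜 𝕜 (Tens A V) a).compMultilinearMap
        (signed (tensParity A V) (fun c => sgn (q * (p + ∑ l with l < j, c l))) f) := by
    refine Multi.ext_part (tensParity A V) fun c w hw => ?_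
    rw [LinearMap.compMultilinearMap_apply, signed_apply _ _ _ hw, Algebra.lsmul_coe]
    beta_reduce
    rw [smul_comm a, ← hf.multilinear c w (fun j => piHomog_iff.2 (hw j)) q a ha j,
      MultilinearMap.compLinearMap_apply]
    congr 1
    funext k
    by_cases hk : k = j
    · subst hk; simp
    · simp [hk]
  have := congrArg (fun g => g w) key
  simp only [LinearMap.compMultilinearMap_apply, MultilinearMap.compLinearMap_apply,
    Algebra.lsmul_coe] at this
  rw [← this]
  congr 1
  funext k
  by_cases hk : k = j
  · subst hk; simp
  · simp [hk]

/-- The operations of parity `p` and arity `n` of `End_A(A ⊗ ΠV)` are compatible with the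
filtration. -/
theorem IsEndA.map_fil {p : ZMod 2} {n : ℕ} {f : Multi 𝕜 (Tens A V) n} (hf : IsEndA A V p f)
    (m : Fin n → ℕ) (w : Fin n → Tens A V) (hw : ∀ l, w l ∈ fil A V (m l)) :
    f w ∈ fil A V (∑ l, m l) := by
  -- Slots are treated one at a time: those in `s` hold finite sums a • u and contribute their
  -- exponents, the others hold anything and contribute none.
  suffices H : ∀ (s : Finset (Fin n)) (w : Fin n → Tens A V), (∀ l ∈ s, w l ∈ filSpan A V (m l)) →
      f w ∈ fil A V (∑ l ∈ s, m l) by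
    intro i
    -- Continuity allows each argument to be replaced by a finite sum that agrees with it at the
    -- level `j` governing level `i` of the value.
    obtain ⟨j, hj⟩ := hf.continuous w i
    choose w' hw' e using fun l => exists_filSpan (hw l) j
    have := H Finset.univ w' (fun l _ => hw' l) i
    rwa [toLevel_apply, hj w' e] at this
  intro s
  induction s using Finset.induction_on with
  | empty => exact fun w _ => mem_fil_zero _
  | insert l s hl ih =>
    intro w hw
    rw [← Function.update_eq_self l w, Finset.sum_insert hl]
    have hs : ∀ k ∈ s, w k ∈ filSpan A V (m k) := fun k hk => hw k (Finset.mem_insert_of_mem hk)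
    have hl' := hw l (Finset.mem_insert_self _ _)
    generalize w l = x at hl'
    induction hl' using Submodule.span_induction with
    | zero => rw [f.map_update_zero]; exact zero_mem _
    | add x y _ _ hx hy => rw [f.map_update_add]; exact add_mem hx hy
    | smul c x _ hx => rw [f.map_update_smul]; exact Submodule.smul_mem _ c hx
    | mem x hx =>
      obtain ⟨q, a, u, ha, hq, rfl⟩ := hx
      -- Once `a` is pulled out of slot `l`, the arguments are merely replaced by their parity
      -- components, which stay in `filSpan`, so the induction hypothesis covers the slots of `s`.
      have e := hf.map_update_algebra_smul hq l (Function.update w l u)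
      rw [Function.update_idem, Function.update_self] at e
      rw [e, signed_apply']
      refine smul_mem_fil ha (sum_mem fun c _ => zsmul_mem (ih _ fun k hk => ?_) _)
      rw [Function.update_of_ne (ne_of_mem_of_not_mem hk hl)]
      exact ParityInvolution.pr_mem_of_stable _ (fun x hx => inv_mem_filSpan hx) _ (hs k hk)

end EndA

/-! ### Block algebras as maps of operads -/

section BlockAlgHom

variable {𝕜 : Type u} [Field 𝕜] [CharZero 𝕜] {A : FormalCDGA 𝕜} {V : DGSpace 𝕜}

/-- An odd linear endomorphism of `A ⊗ V` as a unary operation. -/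
noncomputable def diffOp (d : Tens A V →ₗ[𝕜] Tens A V)
    (hd : ∀ p w, Homog A V p w → Homog A V (p + 1) (d w)) : (tensEnd A V).obj 1 1 :=
  ofMulti (unaryMulti d) fun c w hw => by
    have := hd (c 0 + 1) (w 0) (piHomog_iff.2 (hw 0))
    rw [homog_iff, add_assoc (c 0), zmod_two_add_self, add_zero] at this
    simpa [add_comm] using this

@[simp] theorem toMulti_diffOp (d : Tens A V →ₗ[𝕜] Tens A V)
    (hd : ∀ p w, Homog A V p w → Homog A V (p + 1) (d w)) (w : Fin 1 → Tens A V) :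
    toMulti (diffOp d hd) w = d (w 0) := rfl

/-- Identifies [D, -] with the differential that D induces on multilinear maps, so that
compatibility of a Block algebra with differentials becomes an equation in the operad. -/
theorem toMulti_bracket_apply (D : (tensEnd A V).obj 1 1) {p : ZMod 2} {n : ℕ}
    (f : (tensEnd A V).obj p n) {c : Fin n → ZMod 2} {w : Fin n → Tens A V}
    (hw : ∀ j, w j ∈ (tensParity A V).part (c j)) :
    toMulti ((tensEnd A V).bracket D f) w = toMulti D (fun _ => toMulti f w)
      - sgn p • ∑ j, sgn (∑ l with l < j, c l) •
        toMulti f (Function.update w j (toMulti D fun _ => w j)) := by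
  rw [PreOperad.bracket_apply, map_sub, map_zsmul, map_sum, toMulti_comp, _root_.sub_apply,
    unary_ins_apply, _root_.smul_apply, _root_.sum_apply]
  congr 2
  refine Finset.sum_congr rfl fun j _ => ?_
  rw [toMulti_comp, ins_unary_apply j _ _ hw, one_mul]

/-- A Block algebra as a map to the operad of graded multilinear maps. -/
noncomputable def BlockAlg.hom {P : PreOperad.{u, v} 𝕜} {d : Tens A V →ₗ[𝕜] Tens A V}
    (F : BlockAlg P d) {p : ZMod 2} {n : ℕ} : P.obj p n →ₗ[𝕜] (tensEnd A V).obj p n :=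
  LinearMap.codRestrict (parityMaps (tensParity A V) p n) F.op fun f => (F.mem f).mem_parityMaps

section Hom

variable {P : PreOperad.{u, v} 𝕜} {d : Tens A V →ₗ[𝕜] Tens A V} (F : BlockAlg P d)

@[simp] theorem BlockAlg.toMulti_hom {p : ZMod 2} {n : ℕ} (f : P.obj p n) :
    toMulti (F.hom f) = F.op f := rfl

theorem BlockAlg.hom_act {p : ZMod 2} {n : ℕ} (σ : Equiv.Perm (Fin n)) (f : P.obj p n) :
    F.hom (P.act σ f) = (tensEnd A V).act σ (F.hom f) := by
  refine toMulti_injective (Multi.ext_part (tensParity A V) fun c w hw => ?_)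
  rw [toMulti_act, braid_apply _ _ _ hw, F.toMulti_hom, F.toMulti_hom,
    F.map_act σ f c w fun j => piHomog_iff.2 (hw j)]

theorem BlockAlg.hom_comp {p q s : ZMod 2} {a b r : ℕ} (i : Fin a) (h : r + 1 = a + b)
    (hs : s = p + q) (f : P.obj p a) (g : P.obj q b) :
    F.hom (P.comp i h hs f g) = (tensEnd A V).comp i h hs (F.hom f) (F.hom g) := by
  refine toMulti_injective (Multi.ext_part (tensParity A V) fun c w hw => ?_)
  rw [toMulti_comp, ins_apply _ _ _ _ _ _ hw, F.toMulti_hom, F.toMulti_hom, F.toMulti_hom,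
    F.map_comp i h hs f g c w fun j => piHomog_iff.2 (hw j)]
  rfl

theorem BlockAlg.hom_d (hd : ∀ p w, Homog A V p w → Homog A V (p + 1) (d w)) {p : ZMod 2} {n : ℕ}
    (f : P.obj p n) : F.hom (P.d f) = (tensEnd A V).bracket (diffOp d hd) (F.hom f) := by
  refine toMulti_injective (Multi.ext_part (tensParity A V) fun c w hw => ?_)
  rw [toMulti_bracket_apply _ _ hw, F.toMulti_hom, F.map_d f c w fun j => piHomog_iff.2 (hw j)]
  rfl

end Hom

/-- A Block algebra, from a map to the operad of graded multilinear maps. -/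
noncomputable def BlockAlg.ofHom {P : PreOperad.{u, v} 𝕜} {d : Tens A V →ₗ[𝕜] Tens A V}
    (hd : ∀ p w, Homog A V p w → Homog A V (p + 1) (d w))
    (H : ∀ {p n}, P.obj p n →ₗ[𝕜] (tensEnd A V).obj p n)
    (mem : ∀ {p n} (f : P.obj p n), IsEndA A V p (toMulti (H f)))
    (act : ∀ {p n} (σ : Equiv.Perm (Fin n)) (f : P.obj p n),
      H (P.act σ f) = (tensEnd A V).act σ (H f))
    (comp : ∀ {p q s a b r} (i : Fin a) (h : r + 1 = a + b) (hs : s = p + q)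
      (f : P.obj p a) (g : P.obj q b),
      H (P.comp i h hs f g) = (tensEnd A V).comp i h hs (H f) (H g))
    (map_d : ∀ {p n} (f : P.obj p n), H (P.d f) = (tensEnd A V).bracket (diffOp d hd) (H f)) :
    BlockAlg P d where
  op := toMulti ∘ₗ H
  mem := mem
  map_act σ f c w hw := by
    rw [LinearMap.comp_apply, act, toMulti_act,
      braid_apply _ _ _ fun j => piHomog_iff.1 (hw j)]
    rfl
  map_comp i h hs f g c w hw := by
    rw [LinearMap.comp_apply, comp, toMulti_comp,
      ins_apply _ _ _ _ _ _ fun j => piHomog_iff.1 (hw j)]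
    rfl
  map_d f c w hw := by
    rw [LinearMap.comp_apply, map_d, toMulti_bracket_apply _ _ fun j => piHomog_iff.1 (hw j)]
    rfl

end BlockAlgHom

/-! ### Evaluation of power series -/

section Pow

variable {𝕜 : Type u} [Field 𝕜] {O : DGOperad.{u, v} 𝕜}

/-- A linear combination of formal composites as an element of `O[[x]]`. -/
noncomputable def powFree {p : ZMod 2} {n : ℕ} : Free 𝕜 (AdjGen O.obj) p n →ₗ[𝕜] powObj O p n where
  toFun z := ⟨fun N => (presIdeal (AdjRel O N) p n).mkQ z, fun _ _ _ => rfl⟩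
  map_add' _ _ := rfl
  map_smul' _ _ := rfl

theorem powFree_act {p : ZMod 2} {n : ℕ} (σ : Equiv.Perm (Fin n))
    (z : Free 𝕜 (AdjGen O.obj) p n) :
    powFree (freeAct 𝕜 _ σ z) = powAct σ (powFree z) := rfl

theorem powFree_comp {p q s : ZMod 2} {a b r : ℕ} (i : Fin a) (h : r + 1 = a + b)
    (hs : s = p + q) (z : Free 𝕜 (AdjGen O.obj) p a) (z' : Free 𝕜 (AdjGen O.obj) q b) :
    powFree (freeComp 𝕜 _ i h hs z z') = powComp i h hs (powFree z) (powFree z') := rfl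

variable [CharZero 𝕜] (O) (A : FormalCDGA 𝕜) (V : DGSpace 𝕜)

/-- A map from the operad `O`, without its differential, to `End_A(A ⊗ ΠV)`, and an operation of
arity `0`. -/
structure TensRep where
  hom : ∀ {p n}, O.obj p n →ₗ[𝕜] (tensEnd A V).obj p n
  isEndA : ∀ {p n} (f : O.obj p n), IsEndA A V p (toMulti (hom f))
  hom_act : ∀ {p n} (σ : Equiv.Perm (Fin n)) (f : O.obj p n),
    hom (O.act σ f) = (tensEnd A V).act σ (hom f)
  hom_comp : ∀ {p q s a b r} (i : Fin a) (h : r + 1 = a + b) (hs : s = p + q)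
      (f : O.obj p a) (g : O.obj q b),
      hom (O.comp i h hs f g) = (tensEnd A V).comp i h hs (hom f) (hom g)
  pt : (tensEnd A V).obj 0 0
  pt_isEndA : IsEndA A V 0 (toMulti pt)

namespace TensRep

variable {O A V} (E : TensRep O A V)

/-- The values of the generators of `O[[x]]`. -/
noncomputable def gen : ∀ {p n}, AdjGen O.obj p n → (tensEnd A V).obj p n
  | _, _, .old f => E.hom f
  | _, _, .x => E.pt

/-- The value of a formal composite. -/
noncomputable abbrev evT {p : ZMod 2} {n : ℕ} (t : OpTree (AdjGen O.obj) p n) :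
    (tensEnd A V).obj p n := evalTree (tensEnd A V).toPreOperad E.gen t

/-- The value of a linear combination of formal composites. -/
noncomputable abbrev ev {p : ZMod 2} {n : ℕ} : Free 𝕜 (AdjGen O.obj) p n →ₗ[𝕜]
    (tensEnd A V).obj p n := evalFree (tensEnd A V).toPreOperad E.gen

theorem isEndA_evT {p : ZMod 2} {n : ℕ} (t : OpTree (AdjGen O.obj) p n) :
    IsEndA A V p (toMulti (E.evT t)) := by
  induction t with
  | gen g =>
    cases g with
    | old f => exact E.isEndA f
    | x => exact E.pt_isEndA
  | act σ t ih => exact isEndA_act σ ih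
  | comp i h hs t t' ih ih' => exact isEndA_comp i h hs ih ih'

theorem isEndA_ev {p : ZMod 2} {n : ℕ} (z : Free 𝕜 (AdjGen O.obj) p n) :
    IsEndA A V p (toMulti (E.ev z)) := by
  induction z using Free.induct with
  | h0 => rw [map_zero, map_zero]; exact IsEndA.zero
  | ha x y hx hy => rw [map_add, map_add]; exact hx.add hy
  | hs c x hx => rw [map_smul, map_smul]; exact hx.smul c
  | ht t => rw [evalFree_tr]; exact E.isEndA_evT t

/-- Every occurrence of x contributes a value in A_+ ⊗ V, and continuous A-multilinear operations
add up the filtration degrees of their arguments. -/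
theorem evT_mem_fil {p : ZMod 2} {n : ℕ} (t : OpTree (AdjGen O.obj) p n) (m : Fin n → ℕ)
    (w : Fin n → Tens A V) (hw : ∀ l, w l ∈ fil A V (m l)) :
    toMulti (E.evT t) w ∈ fil A V (t.weight + ∑ l, m l) := by
  induction t with
  | gen g =>
    cases g with
    | old f =>
      change _ ∈ fil A V (0 + _)
      rw [zero_add]
      exact (E.isEndA f).map_fil m w hw
    | x =>
      change _ ∈ fil A V (1 + _)
      rw [Fin.sum_univ_zero]
      exact inPlus_iff.1 (E.pt_isEndA.plus w)
  | act σ t ih =>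
    rw [evT, evalTree, toMulti_act, braid_eq, signed_apply']
    refine sum_mem fun c _ => zsmul_mem ?_ _
    rw [OpTree.weight, ← Equiv.sum_comp σ m, MultilinearMap.domDomCongr_apply]
    exact ih (m ∘ σ) _ fun l =>
      ParityInvolution.pr_mem_of_stable _ (fun x hx => inv_mem_fil hx) _ (hw _)
  | @comp _ _ _ a b r i h hs t t' ih ih' =>
    rw [evT, evalTree, toMulti_comp, ins_eq, signed_apply']
    refine sum_mem fun c _ => zsmul_mem ?_ _
    have hw' : ∀ l, (tensParity A V).pr (c l) (w l) ∈ fil A V (m l) := fun l =>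
      ParityInvolution.pr_mem_of_stable _ (fun x hx => inv_mem_fil hx) _ (hw l)
    have h1 := ih' (fun k => m (innerIdx i h k)) _ fun k => hw' (innerIdx i h k)
    rw [insRaw_apply]
    -- The slot filled by `t'` carries the weight of `t'` plus the degrees of the inputs of `t'`.
    have h2 := ih (insArg i h (t'.weight + ∑ k, m (innerIdx i h k)) m) (insArg i h
      (toMulti (E.evT t') fun k => (tensParity A V).pr (c (innerIdx i h k)) (w (innerIdx i h k)))
      fun j => (tensParity A V).pr (c j) (w j)) fun l => by
        by_cases hl : l = i
        · subst hl; rw [insArg_self, insArg_self]; exact h1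
        · rw [insArg_of_ne _ _ _ _ _ hl, insArg_of_ne _ _ _ _ _ hl]; exact hw' _
    have e := sum_insArg i h (t'.weight + ∑ k, m (innerIdx i h k)) m
    convert h2 using 2
    rw [OpTree.weight]
    omega

variable (A V) in
/-- The operations with values in `A_+^N ⊗ V`. -/
noncomputable def filIdeal (N : ℕ) (p : ZMod 2) (n : ℕ) :
    Submodule 𝕜 ((tensEnd A V).obj p n) where
  carrier := {f | ∀ w, toMulti f w ∈ fil A V N}
  zero_mem' w := by rw [map_zero]; exact zero_mem _
  add_mem' hf hg w := by rw [map_add]; exact add_mem (hf w) (hg w)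
  smul_mem' c _ hf w := by rw [map_smul]; exact Submodule.smul_mem _ c (hf w)

theorem filIdeal_act {N : ℕ} {p : ZMod 2} {n : ℕ} (σ : Equiv.Perm (Fin n))
    {f : (tensEnd A V).obj p n} (hf : f ∈ filIdeal A V N p n) :
    (tensEnd A V).act σ f ∈ filIdeal A V N p n := fun w => by
  rw [toMulti_act, braid_eq]
  refine signed_mem (fun w => ?_) _ _
  rw [MultilinearMap.domDomCongr_apply]
  exact hf _

theorem filIdeal_comp_left {N : ℕ} {p q s : ZMod 2} {a b r : ℕ} (i : Fin a)
    (h : r + 1 = a + b) (hs : s = p + q) {f : (tensEnd A V).obj p a} (g : (tensEnd A V).obj q b)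
    (hf : f ∈ filIdeal A V N p a) : (tensEnd A V).comp i h hs f g ∈ filIdeal A V N s r :=
  fun w => by
    rw [toMulti_comp, ins_eq]
    refine signed_mem (fun w => ?_) _ _
    rw [insRaw_apply]
    exact hf _

/-- The inner values must be carried through `f`, so here `f` has to be A-multilinear and
continuous: degree `N` is placed in slot `i` and 0 elsewhere. -/
theorem filIdeal_comp_right {N : ℕ} {p q s : ZMod 2} {a b r : ℕ} (i : Fin a)
    (h : r + 1 = a + b) (hs : s = p + q) {f : (tensEnd A V).obj p a} {g : (tensEnd A V).obj q b}
    (hf : IsEndA A V p (toMulti f)) (hg : g ∈ filIdeal A V N q b) :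
    (tensEnd A V).comp i h hs f g ∈ filIdeal A V N s r := fun w => by
  rw [toMulti_comp, ins_eq]
  refine signed_mem (fun w => ?_) _ _
  rw [insRaw_apply]
  have := hf.map_fil (insArg i h N 0) (insArg i h (toMulti g fun k => w (innerIdx i h k)) w)
    fun l => by
      by_cases hl : l = i
      · subst hl; rw [insArg_self, insArg_self]; exact hg _
      · rw [insArg_of_ne _ _ _ _ _ hl]; exact mem_fil_zero _
  have e := sum_insArg i h N (0 : Fin r → ℕ)
  simp only [Pi.zero_apply, Finset.sum_const_zero, add_zero] at e
  rwa [e] at this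

/-- The relations of O and the operad axioms hold exactly in the endomorphism operad, and composites
with N occurrences of x take values in A_+^N ⊗ V. Evaluation is thus well defined on O[x]/(x^N) up
to A_+^N ⊗ V. -/
theorem ev_mem_filIdeal (N : ℕ) {p : ZMod 2} {n : ℕ} {z : Free 𝕜 (AdjGen O.obj) p n}
    (hz : (presIdeal (AdjRel O N) p n).mkQ z = 0) : E.ev z ∈ filIdeal A V N p n := by
  suffices presIdeal (AdjRel O N) p n ≤ (filIdeal A V N p n).comap E.ev from
    this ((Submodule.Quotient.mk_eq_zero _).1 hz)
  refine Submodule.span_le.2 fun x hx => ?_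
  refine evalFree_mem_of_rel (tensEnd A V) E.gen (filIdeal A V N) ?_
    (fun σ f hf => filIdeal_act σ hf) (fun i h hs f t hf => filIdeal_comp_left i h hs _ hf)
    (fun i h hs t f hf => filIdeal_comp_right i h hs (E.isEndA_evT t) hf) hx
  intro p n x hx
  induction hx with
  | add f g => simp [evalTree, gen]
  | smul c f => simp [evalTree, gen]
  | act σ f => simp [evalTree, gen, E.hom_act]
  | comp i h hs f g => simp [evalTree, gen, E.hom_comp i h hs]
  | pow t ht =>
    rw [evalFree_tr]
    intro w
    refine fil_antitone (ht.trans (Nat.le_add_right _ _))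
      (E.evT_mem_fil t (fun _ => 0) w fun l => mem_fil_zero _)

/-- Of two truncations of one series, the longer also represents it at the shorter order, so they
differ by an element of the ideal at that order. Its values vanish at level `i`, which makes
evaluation of series well defined. -/
theorem toLevel_ev_congr {i : A.index} {N M : ℕ} (hN : augPow A N ≤ (A.K i).restrictScalars 𝕜)
    (hM : augPow A M ≤ (A.K i).restrictScalars 𝕜) {p : ZMod 2} {n : ℕ} (y : powObj O p n)
    {z z' : Free 𝕜 (AdjGen O.obj) p n} (hz : (presIdeal (AdjRel O N) p n).mkQ z = y.1 N)
    (hz' : (presIdeal (AdjRel O M) p n).mkQ z' = y.1 M) (w : Fin n → Tens A V) :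
    toLevel A V i (toMulti (E.ev z) w) = toLevel A V i (toMulti (E.ev z') w) := by
  wlog h : N ≤ M generalizing N M z z'
  · exact (this hM hN hz' hz (le_of_not_ge h)).symm
  have e : (presIdeal (AdjRel O N) p n).mkQ z' = y.1 N := by
    rw [← y.2 N M h, ← hz']; rfl
  have := E.ev_mem_filIdeal N (z := z - z') (by rw [map_sub, hz, e, sub_self]) w
  have := toLevel_eq_zero_of_mem_fil hN this
  rwa [map_sub, map_sub, _root_.sub_apply, map_sub, sub_eq_zero] at this

variable (A) in
/-- A power of the augmentation ideal that vanishes in `A/K i`. -/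
noncomputable def order (i : A.index) : ℕ := (exists_augPow_le A i).choose

theorem order_spec (i : A.index) : augPow A (order A i) ≤ (A.K i).restrictScalars 𝕜 :=
  (exists_augPow_le A i).choose_spec

/-- A linear combination of formal composites that agrees with `y` modulo `x^N`. -/
noncomputable def rep {p : ZMod 2} {n : ℕ} (y : powObj O p n) (N : ℕ) :
    Free 𝕜 (AdjGen O.obj) p n :=
  ((presIdeal (AdjRel O N) p n).mkQ_surjective (y.1 N)).choose

theorem rep_spec {p : ZMod 2} {n : ℕ} (y : powObj O p n) (N : ℕ) :
    (presIdeal (AdjRel O N) p n).mkQ (rep y N) = y.1 N :=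
  ((presIdeal (AdjRel O N) p n).mkQ_surjective (y.1 N)).choose_spec

theorem mkQ_of_le {N M : ℕ} (h : N ≤ M) {p : ZMod 2} {n : ℕ} {y : powObj O p n}
    {z : Free 𝕜 (AdjGen O.obj) p n} (hz : (presIdeal (AdjRel O M) p n).mkQ z = y.1 M) :
    (presIdeal (AdjRel O N) p n).mkQ z = y.1 N := by
  rw [← y.2 N M h, ← hz]; rfl

/-- The value of an element of `O[[x]]`, as a multilinear map. -/
noncomputable def powMulti {p : ZMod 2} {n : ℕ} (y : powObj O p n) : Multi 𝕜 (Tens A V) n :=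
  MultilinearMap.mk' (fun w => ⟨fun i => toLevel A V i (toMulti (E.ev (rep y (order A i))) w),
      fun i j h => by
        have e := (toMulti (E.ev (rep y (order A j))) w).2 i j h
        refine Eq.trans e ?_
        exact E.toLevel_ev_congr (fun a ha => h (order_spec j ha)) (order_spec i) y
          (rep_spec y _) (rep_spec y _) w⟩)
    (fun w l x x' => Tens.ext' fun i => by
      change toLevel A V i _ = toLevel A V i _ + toLevel A V i _
      rw [MultilinearMap.map_update_add, map_add])
    (fun w l c x => Tens.ext' fun i => by
      change toLevel A V i _ = c • toLevel A V i _
      rw [MultilinearMap.map_update_smul, map_smul])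

/-- Frees the evaluation from the chosen representative: any sufficiently precise one computes level
`i`. -/
theorem toLevel_powMulti {i : A.index} {N : ℕ} (hN : augPow A N ≤ (A.K i).restrictScalars 𝕜)
    {p : ZMod 2} {n : ℕ} (y : powObj O p n) {z : Free 𝕜 (AdjGen O.obj) p n}
    (hz : (presIdeal (AdjRel O N) p n).mkQ z = y.1 N) (w : Fin n → Tens A V) :
    toLevel A V i (E.powMulti y w) = toLevel A V i (toMulti (E.ev z) w) :=
  E.toLevel_ev_congr (order_spec i) hN y (rep_spec y _) hz w

theorem isEndA_powMulti {p : ZMod 2} {n : ℕ} (y : powObj O p n) :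
    IsEndA A V p (E.powMulti y) where
  parity c w hw i := (E.isEndA_ev (rep y (order A i))).parity c w hw i
  multilinear c w hw q a ha j := Tens.ext' fun i => by
    have := congrArg (toLevel A V i)
      ((E.isEndA_ev (rep y (order A i))).multilinear c w hw q a ha j)
    rw [map_zsmul, toLevel_smul] at this
    rw [← toLevel_apply, ← toLevel_apply, map_zsmul, toLevel_smul]
    exact this
  plus w i := (E.isEndA_ev (rep y (order A i))).plus w i
  continuous w i := (E.isEndA_ev (rep y (order A i))).continuous w i

/-- The value of an element of `O[[x]]`. -/
noncomputable def powHom {p : ZMod 2} {n : ℕ} : powObj O p n →ₗ[𝕜] (tensEnd A V).obj p n where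
  toFun y := ofMulti (E.powMulti y) (E.isEndA_powMulti y).mem_parityMaps
  map_add' y y' := toMulti_injective (by
    rw [map_add, toMulti_ofMulti, toMulti_ofMulti, toMulti_ofMulti]
    ext1 w
    refine Tens.ext' fun i => ?_
    have := E.toLevel_powMulti (order_spec i) (y + y') (z := rep y _ + rep y' _)
      (by rw [map_add, rep_spec, rep_spec]; rfl) w
    rw [map_add, map_add, _root_.add_apply, map_add] at this
    exact this)
  map_smul' c y := toMulti_injective (by
    rw [map_smul, toMulti_ofMulti, toMulti_ofMulti]
    ext1 w
    refine Tens.ext' fun i => ?_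
    have := E.toLevel_powMulti (order_spec i) (c • y) (z := c • rep y _)
      (by rw [map_smul, rep_spec]; rfl) w
    rw [map_smul, map_smul, _root_.smul_apply, map_smul] at this
    exact this)

theorem isEndA_powHom {p : ZMod 2} {n : ℕ} (y : powObj O p n) :
    IsEndA A V p (toMulti (E.powHom y)) := E.isEndA_powMulti y

theorem toLevel_powHom {i : A.index} {N : ℕ} (hN : augPow A N ≤ (A.K i).restrictScalars 𝕜)
    {p : ZMod 2} {n : ℕ} (y : powObj O p n) {z : Free 𝕜 (AdjGen O.obj) p n}
    (hz : (presIdeal (AdjRel O N) p n).mkQ z = y.1 N) (w : Fin n → Tens A V) :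
    toLevel A V i (toMulti (E.powHom y) w) = toLevel A V i (toMulti (E.ev z) w) :=
  E.toLevel_powMulti hN y hz w

theorem powHom_powFree {p : ZMod 2} {n : ℕ} (z : Free 𝕜 (AdjGen O.obj) p n) :
    E.powHom (powFree z) = E.ev z :=
  toMulti_injective (MultilinearMap.ext fun w => Tens.ext' fun i =>
    E.toLevel_powHom (order_spec i) (powFree z) rfl w)

theorem powHom_act {p : ZMod 2} {n : ℕ} (σ : Equiv.Perm (Fin n)) (y : powObj O p n) :
    E.powHom (powAct σ y) = (tensEnd A V).act σ (E.powHom y) := by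
  refine toMulti_injective (Multi.ext_part (tensParity A V) fun c w hw => Tens.ext' fun i => ?_)
  have h1 := E.toLevel_powHom (order_spec i) (powAct σ y) (z := freeAct 𝕜 _ σ (rep y _))
    (by rw [← presAct_mkQ, rep_spec]; rfl) w
  refine h1.trans ?_
  rw [evalFree_act, toMulti_act, toMulti_act, braid_apply _ _ _ hw, braid_apply _ _ _ hw,
    map_zsmul, ← E.toLevel_powHom (order_spec i) y (rep_spec y _), ← map_zsmul]
  rfl

theorem powHom_comp {p q s : ZMod 2} {a b r : ℕ} (i : Fin a) (h : r + 1 = a + b)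
    (hs : s = p + q) (y : powObj O p a) (y' : powObj O q b) :
    E.powHom (powComp i h hs y y') = (tensEnd A V).comp i h hs (E.powHom y) (E.powHom y') := by
  refine toMulti_injective (Multi.ext_part (tensParity A V) fun c w hw => Tens.ext' fun m => ?_)
  rw [toMulti_comp, ins_apply _ _ _ _ _ _ hw, ← toLevel_apply, ← toLevel_apply, map_zsmul,
    E.toLevel_powHom (order_spec m) y (rep_spec y _)]
  -- The outer value at level `m` depends on its arguments at a possibly finer level `j`, so the
  -- inner series is truncated at an order `M` that is good for both.
  obtain ⟨j, hj⟩ := (E.isEndA_ev (rep y (order A m))).continuous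
    (insArg i h (toMulti (E.powHom y') fun k => w (innerIdx i h k)) w) m
  set M := max (order A m) (order A j)
  have hM : augPow A M ≤ (A.K j).restrictScalars 𝕜 :=
    (augPow_antitone A (le_max_right _ _)).trans (order_spec j)
  have h1 := E.toLevel_powHom (order_spec m) (powComp i h hs y y')
    (z := freeComp 𝕜 _ i h hs (rep y (order A m)) (rep y' M))
    (by rw [← presComp_mkQ, rep_spec, mkQ_of_le (le_max_left _ _) (rep_spec y' M)]; rfl) w
  rw [h1, evalFree_comp, toMulti_comp, ins_apply _ _ _ _ _ _ hw, map_zsmul]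
  congr 1
  refine hj _ fun l => ?_
  by_cases hl : l = i
  · subst hl
    rw [insArg_self, insArg_self]
    exact (E.toLevel_powHom hM y' (rep_spec y' M) _).symm
  · rw [insArg_of_ne _ _ _ _ _ hl, insArg_of_ne _ _ _ _ _ hl]

end TensRep

end Pow

/-! ### The differential of power series -/

section

variable {𝕜 : Type u} [Field 𝕜] [CharZero 𝕜]

theorem ins_zero {T : Type v} [AddCommGroup T] [Module 𝕜 T] {θ : ParityInvolution 𝕜 T} {a b r : ℕ}
    (i : Fin a) (h : r + 1 = a + b) (f : Multi 𝕜 T a) (g : Multi 𝕜 T b) :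
    ins θ 0 i h f g = insRaw i h f g :=
  Multi.ext_part θ fun c w hw => by
    rw [ins_apply _ _ _ _ _ _ hw, zero_mul, sgn_zero, one_smul]; rfl

variable {O : DGOperad.{u, v} 𝕜} {A : FormalCDGA 𝕜} {V : DGSpace 𝕜}
variable {ε : ℤˣ} (φ : PreOperad.Hom (lInf 𝕜 ε) O.toPreOperad)

/-- `d x` in `O[x]/(x^N)`. -/
noncomputable def dxFree (N : ℕ) : Free 𝕜 (AdjGen O.obj) (0 + 1) 0 :=
  (ε : ℤ) • ∑ j ∈ Finset.range N, ((j + 2).factorial : 𝕜)⁻¹ •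
      tr 𝕜 (plug (j + 2) (.gen (.old (φ.toFun (lInfM 𝕜 ε (0 + (j + 2)) (zero_add 1)
        (by omega))))))

theorem mkQ_dxFree (N : ℕ) : (presIdeal (AdjRel O N) (0 + 1) 0).mkQ (dxFree φ N)
    = adjD φ N .x := by
  simp only [dxFree, map_zsmul, map_sum, map_smul]
  rfl

/-- The twisting element in `O[x]/(x^N)`. -/
noncomputable def alphaFree (N : ℕ) : Free 𝕜 (AdjGen O.obj) 1 1 :=
  -((ε : ℤ) • ∑ j ∈ Finset.range N, ((j + 1).factorial : 𝕜)⁻¹ •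
      tr 𝕜 (plug (j + 1) (.gen (.old (φ.toFun (lInfM 𝕜 ε (1 + (j + 1)) rfl (by omega)))))))

theorem mkQ_alphaFree (N : ℕ) : (presIdeal (AdjRel O N) 1 1).mkQ (alphaFree φ N)
    = (show powObj O 1 1 from twistElt φ).1 N := by
  simp only [alphaFree, map_zsmul, map_sum, map_smul, map_neg]
  rfl

/-- The derivation of `O_MC` on `x`. -/
theorem powD_x (N : ℕ) : (presIdeal (AdjRel O N) (0 + 1) 0).mkQ (dxFree φ N)
    = (powD φ (powFree (tr 𝕜 (.gen .x)))).1 N := by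
  rw [mkQ_dxFree]
  change _ = presD (adjD φ N) (adjD_rel φ N) (cls (.gen .x))
  rw [presD_cls]
  rfl

theorem twOperad_d {p : ZMod 2} {n : ℕ} (y : (mcOperad φ).obj p n) :
    (twOperad φ).d y = (mcOperad φ).d y + (mcOperad φ).bracket (twistElt φ) y :=
  (mcOperad φ).twist_d (twistElt φ) y

namespace TensRep

variable (E : TensRep O A V)

/-- The value of `x`. -/
noncomputable def point : Tens A V := toMulti E.pt Fin.elim0

theorem toMulti_pt (w : Fin 0 → Tens A V) : toMulti E.pt w = E.point :=
  congrArg _ (Subsingleton.elim _ _)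

theorem point_mem_part : E.point ∈ (tensParity A V).part 0 := by
  have := toMulti_mem E.pt Fin.elim0 Fin.elim0 fun j => j.elim0
  rwa [Finset.univ_eq_empty, Finset.sum_empty, add_zero] at this

theorem point_mem_fil : E.point ∈ fil A V 1 := inPlus_iff.1 (E.pt_isEndA.plus _)

/-- As x is even, plugging it in costs no sign. The first `j` slots are filled from the last of them
downwards, which shifts the remaining arguments by `j`. -/
theorem evT_plug {p : ZMod 2} (j : ℕ) {r : ℕ} (t : OpTree (AdjGen O.obj) p (r + j))
    (W : ℕ → Tens A V) : toMulti (E.evT (plug j t)) (fun k => W k.1)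
      = toMulti (E.evT t) fun k => if k.1 < j then E.point else W (k.1 - j) := by
  induction j with
  | zero => rfl
  | succ j ih =>
    rw [plug, ih, evT, evalTree, toMulti_comp, ins_zero, insRaw_apply]
    have e : ∀ w : Fin 0 → Tens A V, toMulti (evalTree (tensEnd A V).toPreOperad E.gen
        (OpTree.gen AdjGen.x)) w = E.point := E.toMulti_pt
    rw [e, insArg_nat _ _ _ fun k => if k < j then E.point else W (k - j)]
    congr 1
    funext k
    simp only [insNat]
    split_ifs <;> first | rfl | omega | (congr 1; omega)

/-- The value of `m_n`. -/
noncomputable def mVal (n : ℕ) (W : ℕ → Tens A V) : Tens A V :=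
  if h : 2 ≤ n then toMulti (E.hom (φ.toFun (lInfM 𝕜 ε n (p := 1) rfl h))) fun k => W k.1 else 0

/-- Arities and parities in `dxFree` and `alphaFree` appear as sums such as 0 + (j + 2) and 0 + 1.
As `mVal` depends only on the number `n`, such expressions can be rewritten. -/
theorem mVal_eq {p : ZMod 2} (n : ℕ) (hp : p = 1) (h : 2 ≤ n) (W : ℕ → Tens A V) :
    toMulti (E.hom (φ.toFun (lInfM 𝕜 ε n hp h))) (fun k => W k.1) = E.mVal φ n W := by
  subst hp
  rw [mVal, dif_pos h]

theorem mVal_congr {n : ℕ} {W W' : ℕ → Tens A V} (h : ∀ k < n, W k = W' k) :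
    E.mVal φ n W = E.mVal φ n W' := by
  have : (fun k : Fin n => W k.1) = fun k : Fin n => W' k.1 := funext fun k => h k.1 k.2
  rw [mVal, mVal, this]

theorem ev_dxFree (N : ℕ) (w : Fin 0 → Tens A V) : toMulti (E.ev (dxFree φ N)) w
    = (ε : ℤ) • ∑ j ∈ Finset.range N, ((j + 2).factorial : 𝕜)⁻¹ •
      E.mVal φ (j + 2) fun _ => E.point := by
  simp only [dxFree, map_zsmul, map_sum, map_smul, _root_.smul_apply, _root_.sum_apply,
    evalFree_tr]
  congr 1
  refine Finset.sum_congr rfl fun j _ => ?_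
  congr 1
  have := E.evT_plug (j + 2) (.gen (.old (φ.toFun (lInfM 𝕜 ε (0 + (j + 2)) (zero_add 1)
    (by omega))))) (fun _ => 0)
  rw [Subsingleton.elim w fun _ => 0]
  refine this.trans ?_
  refine (E.mVal_eq φ _ _ _ fun k => if k < j + 2 then E.point else 0).trans ?_
  rw [zero_add]
  exact E.mVal_congr φ fun k hk => if_pos hk

theorem ev_alphaFree (N : ℕ) (w : Tens A V) : toMulti (E.ev (alphaFree φ N)) (fun _ => w)
    = -((ε : ℤ) • ∑ j ∈ Finset.range N, ((j + 1).factorial : 𝕜)⁻¹ •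
      E.mVal φ (j + 2) fun k => if k < j + 1 then E.point else w) := by
  simp only [alphaFree, map_zsmul, map_sum, map_smul, map_neg, _root_.neg_apply,
    _root_.smul_apply, _root_.sum_apply, evalFree_tr]
  congr 2
  refine Finset.sum_congr rfl fun j _ => ?_
  congr 1
  have := E.evT_plug (j + 1) (.gen (.old (φ.toFun (lInfM 𝕜 ε (1 + (j + 1)) rfl
    (by omega))))) (fun _ => w)
  refine this.trans ?_
  refine (E.mVal_eq φ _ _ _ fun k => if k < j + 1 then E.point else w).trans ?_
  rw [show 1 + (j + 1) = j + 2 by omega]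

/-- The discarded tail involves x at least `N` times, so the error of truncation is bounded
uniformly in the arguments. -/
theorem powHom_sub_ev_mem {p : ZMod 2} {n : ℕ} (y : powObj O p n) {N : ℕ}
    {z : Free 𝕜 (AdjGen O.obj) p n} (hz : (presIdeal (AdjRel O N) p n).mkQ z = y.1 N) :
    E.powHom y - E.ev z ∈ filIdeal A V N p n := fun w i => by
  have hM := (augPow_antitone A (le_max_right N (order A i))).trans (order_spec i)
  have e := rep_spec y (max N (order A i))
  have := E.ev_mem_filIdeal N (z := rep y (max N (order A i)) - z)
    (by rw [map_sub, hz, mkQ_of_le (le_max_left _ _) e, sub_self]) w i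
  rw [map_sub, _root_.sub_apply, map_sub, E.toLevel_powHom hM y e]
  rwa [map_sub, map_sub, _root_.sub_apply, map_sub] at this

variable {φ} (D : (tensEnd A V).obj 1 1)

/-- The Leibniz rule for [D, -] with errors allowed in A_+^N ⊗ V; this is the inductive step at a
composite. -/
theorem filIdeal_bracket_comp {N : ℕ} {p q s : ZMod 2} {a b r : ℕ} (i : Fin a)
    (h : r + 1 = a + b) (hs : s = p + q) (e₁ : s + 1 = (p + 1) + q) (e₂ : s + 1 = p + (q + 1))
    {f : (tensEnd A V).obj p a} {g : (tensEnd A V).obj q b} {f' : (tensEnd A V).obj (p + 1) a}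
    {g' : (tensEnd A V).obj (q + 1) b} (hf : IsEndA A V p (toMulti f))
    (hf' : f' - (tensEnd A V).bracket D f ∈ filIdeal A V N (p + 1) a)
    (hg' : g' - (tensEnd A V).bracket D g ∈ filIdeal A V N (q + 1) b) :
    (tensEnd A V).comp i h e₁ f' g + sgn p • (tensEnd A V).comp i h e₂ f g'
      - (tensEnd A V).bracket D ((tensEnd A V).comp i h hs f g) ∈ filIdeal A V N (s + 1) r := by
  rw [bracket_comp (tensEnd A V) D i h hs e₁ e₂]
  have h1 := filIdeal_comp_left i h e₁ g hf'
  have h2 := zsmul_mem (filIdeal_comp_right i h e₂ hf hg') (sgn p)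
  have := add_mem h1 h2
  rw [map_sub, map_sub, LinearMap.sub_apply, smul_sub] at this
  convert this using 1
  abel

/-- A derivation of `End_A(A ⊗ ΠV)` that is compatible with that of `O_MC` on the generators is
compatible with it on all formal composites. -/
theorem exists_ev_treeD (hO : ∀ {p n} (f : O.obj p n),
      E.hom (O.d f) = (tensEnd A V).bracket D (E.hom f)) {N : ℕ}
    (hx : E.ev (dxFree φ N) - (tensEnd A V).bracket D E.pt ∈ filIdeal A V N (0 + 1) 0)
    {p : ZMod 2} {n : ℕ} (t : OpTree (AdjGen O.obj) p n) :
    ∃ z, (presIdeal (AdjRel O N) (p + 1) n).mkQ z = treeD (adjD φ N) t ∧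
      E.ev z - (tensEnd A V).bracket D (E.evT t) ∈ filIdeal A V N (p + 1) n := by
  induction t with
  | gen g =>
    cases g with
    | old f =>
      refine ⟨tr 𝕜 (.gen (.old (O.d f))), rfl, ?_⟩
      rw [evalFree_tr]
      change E.hom (O.d f) - (tensEnd A V).bracket D (E.hom f) ∈ _
      rw [hO, sub_self]
      exact zero_mem _
    | x => exact ⟨dxFree φ N, mkQ_dxFree φ N, hx⟩
  | act σ t ih =>
    obtain ⟨z, hz, hz'⟩ := ih
    refine ⟨freeAct 𝕜 _ σ z, ?_, ?_⟩
    · rw [← presAct_mkQ, hz, treeD]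
    · rw [evalFree_act, evT, evalTree, bracket_act, ← map_sub]
      exact filIdeal_act σ hz'
  | @comp p q s a b r i h hs t t' ih ih' =>
    obtain ⟨z, hz, hz'⟩ := ih
    obtain ⟨y, hy, hy'⟩ := ih'
    have e₁ : s + 1 = (p + 1) + q := by rw [hs, add_right_comm]
    have e₂ : s + 1 = p + (q + 1) := by rw [hs, add_assoc]
    refine ⟨freeComp 𝕜 _ i h e₁ z (tr 𝕜 t') + sgn p • freeComp 𝕜 _ i h e₂ (tr 𝕜 t) y, ?_, ?_⟩
    · rw [map_add, map_zsmul, ← presComp_mkQ, ← presComp_mkQ, hz, hy, treeD]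
      rfl
    · rw [map_add, map_zsmul, evalFree_comp, evalFree_comp, evalFree_tr, evalFree_tr]
      exact filIdeal_bracket_comp D i h hs e₁ e₂ (E.isEndA_evT t) hz' hy'

theorem exists_ev_freeD (hO : ∀ {p n} (f : O.obj p n),
      E.hom (O.d f) = (tensEnd A V).bracket D (E.hom f)) {N : ℕ}
    (hx : E.ev (dxFree φ N) - (tensEnd A V).bracket D E.pt ∈ filIdeal A V N (0 + 1) 0)
    {p : ZMod 2} {n : ℕ} (z : Free 𝕜 (AdjGen O.obj) p n) :
    ∃ z', (presIdeal (AdjRel O N) (p + 1) n).mkQ z' = freeD (adjD φ N) z ∧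
      E.ev z' - (tensEnd A V).bracket D (E.ev z) ∈ filIdeal A V N (p + 1) n := by
  induction z using Free.induct with
  | h0 => exact ⟨0, by simp, by simp⟩
  | ha x y hx hy =>
    obtain ⟨z, hz, hz'⟩ := hx
    obtain ⟨y, hy, hy'⟩ := hy
    refine ⟨z + y, by rw [map_add, map_add, hz, hy], ?_⟩
    have := add_mem hz' hy'
    rw [map_add, map_add, map_add]
    convert this using 1
    abel
  | hs c x hx =>
    obtain ⟨z, hz, hz'⟩ := hx
    refine ⟨c • z, by rw [map_smul, map_smul, hz], ?_⟩
    rw [map_smul, map_smul, map_smul, ← smul_sub]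
    exact Submodule.smul_mem _ c hz'
  | ht t =>
    rw [freeD_tr, evalFree_tr]
    exact E.exists_ev_treeD D hO hx t

/-- Both sides are derivations along the evaluation, so agreement on O and, modulo each A_+^N, on x
suffices. -/
theorem powHom_powD (hD : IsCont (toMulti D)) (hO : ∀ {p n} (f : O.obj p n),
      E.hom (O.d f) = (tensEnd A V).bracket D (E.hom f))
    (hx : ∀ N, E.ev (dxFree φ N) - (tensEnd A V).bracket D E.pt ∈ filIdeal A V N (0 + 1) 0)
    {p : ZMod 2} {n : ℕ} (y : powObj O p n) :
    E.powHom (powD φ y) = (tensEnd A V).bracket D (E.powHom y) := by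
  refine toMulti_injective (Multi.ext_part (tensParity A V) fun c w hw => Tens.ext' fun i => ?_)
  -- `D` is merely continuous: its output at level `i` requires its input at level `j`, and `M` is
  -- precise enough at both.
  obtain ⟨j, hj⟩ := hD (fun _ => toMulti (E.powHom y) w) i
  set M := max (order A i) (order A j)
  have hMi : augPow A M ≤ (A.K i).restrictScalars 𝕜 :=
    (augPow_antitone A (le_max_left _ _)).trans (order_spec i)
  have hMj : augPow A M ≤ (A.K j).restrictScalars 𝕜 :=
    (augPow_antitone A (le_max_right _ _)).trans (order_spec j)
  obtain ⟨z, hz, hz'⟩ := E.exists_ev_freeD D hO (hx M) (rep y M)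
  have h1 := E.toLevel_powHom hMi (powD φ y) (z := z) (by
    rw [hz]
    change _ = presD (adjD φ M) (adjD_rel φ M) (y.1 M)
    rw [← rep_spec y M]
    rfl) w
  have h2 := toLevel_eq_zero_of_mem_fil hMi (hz' w)
  rw [map_sub, _root_.sub_apply, map_sub, sub_eq_zero] at h2
  refine (h1.trans h2).trans ?_
  rw [toMulti_bracket_apply D _ hw, ← toLevel_apply, toMulti_bracket_apply D _ hw]
  simp only [map_sub, map_zsmul, map_sum, E.toLevel_powHom hMi y (rep_spec y M)]
  congr 1
  exact hj _ fun _ => (E.toLevel_powHom hMj y (rep_spec y M) w).symm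

theorem powHom_bracket {p : ZMod 2} {n : ℕ} (α : (mcOperad φ).obj 1 1)
    (y : (mcOperad φ).obj p n) :
    E.powHom ((mcOperad φ).bracket α y) = (tensEnd A V).bracket (E.powHom α) (E.powHom y) := by
  have e := fun i : Fin n => E.powHom_comp i rfl rfl y α
  rw [PreOperad.bracket_apply (tensEnd A V).toPreOperad]
  refine (congrArg E.powHom ((mcOperad φ).bracket_apply α y)).trans ?_
  refine (map_sub E.powHom _ _).trans ?_
  refine congrArg₂ _ (E.powHom_comp _ _ _ α y) ?_
  refine (map_zsmul E.powHom _ _).trans (congrArg _ ?_)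
  exact (map_sum E.powHom _ _).trans (Finset.sum_congr rfl fun i _ => e i)

end TensRep

end

/-! ### Convergence, and Maurer–Cartan elements -/

section

variable {𝕜 : Type u} [Field 𝕜] [CharZero 𝕜]
variable {O : DGOperad.{u, v} 𝕜} {A : FormalCDGA 𝕜} {V : DGSpace 𝕜}

theorem zero_add_sum_fin_zero {M : Type*} [AddCommMonoid M] (c : Fin 0 → M) :
    0 + ∑ j, c j = 0 := by simp

theorem sub_mem_fil_of_le {u : ℕ → Tens A V} (hu : ∀ N, u (N + 1) - u N ∈ fil A V N) {N M : ℕ}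
    (h : N ≤ M) : u M - u N ∈ fil A V N := by
  induction M, h using Nat.le_induction with
  | base => rw [sub_self]; exact zero_mem _
  | succ M h ih =>
    rw [← sub_add_sub_cancel (u (M + 1)) (u M)]
    exact add_mem (fil_antitone h (hu M)) ih

/-- When the N-th increment lies in A_+^N ⊗ V, a limit is approached at that rate. Limits of such
series can therefore be handled as congruences modulo each step of the filtration. -/
theorem convTo_iff {u : ℕ → Tens A V} {y : Tens A V} (hu : ∀ N, u (N + 1) - u N ∈ fil A V N) :
    ConvTo A V u y ↔ ∀ N, u N - y ∈ fil A V N := by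
  constructor
  · intro h N i
    obtain ⟨M, hM⟩ := Filter.eventually_atTop.1 (h i)
    have h1 := sub_mem_fil_of_le hu (le_max_left N M) i
    rw [map_sub, toLevel_apply, hM _ (le_max_right N M)] at h1
    rw [← neg_sub, map_neg, map_sub]
    exact neg_mem h1
  · intro h i
    obtain ⟨m, hm⟩ := exists_augPow_le A i
    refine Filter.eventually_atTop.2 ⟨m, fun M hM => ?_⟩
    have := toLevel_eq_zero_of_mem_fil hm (fil_antitone hM (h M))
    rwa [map_sub, sub_eq_zero] at this

/-- For a linear map, continuity at 0 is continuity everywhere. -/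
theorem isCont_unaryMulti {d : Tens A V →ₗ[𝕜] Tens A V}
    (hd : ∀ i, ∃ j, ∀ w : Tens A V, w.1 j = 0 → (d w).1 i = 0) : IsCont (unaryMulti d) := by
  intro w i
  obtain ⟨j, hj⟩ := hd i
  refine ⟨j, fun w' h => ?_⟩
  have := hj (w' 0 - w 0) (by
    rw [← toLevel_apply, map_sub, h 0, sub_self])
  rwa [map_sub, ← toLevel_apply, map_sub, sub_eq_zero] at this

variable {ε : ℤˣ} (φ : PreOperad.Hom (lInf 𝕜 ε) O.toPreOperad)

namespace TensRep

variable (E : TensRep O A V)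

theorem mVal_mem_fil (n : ℕ) {W : ℕ → Tens A V} {m : ℕ → ℕ} (hW : ∀ k, W k ∈ fil A V (m k)) :
    E.mVal φ n W ∈ fil A V (∑ k ∈ Finset.range n, m k) := by
  rw [mVal]
  split_ifs with h
  · rw [Finset.sum_range]
    exact (E.isEndA _).map_fil (fun k => m k.1) _ fun l => hW l.1
  · exact zero_mem _

theorem mVal_const_mem_fil (n : ℕ) : E.mVal φ n (fun _ => E.point) ∈ fil A V n := by
  have := E.mVal_mem_fil φ n (W := fun _ => E.point) (m := fun _ => 1) fun _ => E.point_mem_fil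
  simpa using this

theorem mVal_snoc_mem_fil (n : ℕ) (w : Tens A V) :
    E.mVal φ (n + 1) (fun k => if k < n then E.point else w) ∈ fil A V n := by
  have := E.mVal_mem_fil φ (n + 1) (W := fun k => if k < n then E.point else w)
    (m := fun k => if k < n then 1 else 0) fun k => by
      split_ifs
      · exact E.point_mem_fil
      · exact mem_fil_zero _
  rw [Finset.sum_range_succ, if_neg (lt_irrefl n), add_zero,
    Finset.sum_congr rfl fun k hk => if_pos (Finset.mem_range.1 hk)] at this
  simpa using this

theorem mOp_eq {d' : Tens A V →ₗ[𝕜] Tens A V} (g : BlockAlg O.toPreOperad d')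
    (hE : ∀ {p n} (f : O.obj p n), E.hom f = g.hom f) (n : ℕ) (hn : 2 ≤ n) (W : ℕ → Tens A V) :
    mOp φ g n hn (fun k => W k.1) = E.mVal φ n W := by
  rw [mVal, dif_pos hn, hE]
  rfl

/-- The partial sums in the twisting formula are the values of the truncations of α, so their limit
is the value of α itself. -/
theorem isTwisted_iff {d d' : Tens A V →ₗ[𝕜] Tens A V} (g : BlockAlg O.toPreOperad d')
    (hE : ∀ {p n} (f : O.obj p n), E.hom f = g.hom f) :
    IsTwisted φ g E.point d
      ↔ ∀ w, d w = d' w + toMulti (E.powHom (twistElt φ)) (fun _ => w) := by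
  refine forall_congr' fun w => ?_
  have e : (fun N => d' w - (ε : ℤ) • ∑ j ∈ Finset.range N,
      ((j + 1).factorial : 𝕜)⁻¹ • mOp φ g (j + 1 + 1) (by omega)
        (Fin.snoc (α := fun _ => Tens A V) (fun _ => E.point) w))
      = fun N => d' w + toMulti (E.ev (alphaFree φ N)) (fun _ => w) := by
    funext N
    rw [ev_alphaFree, sub_eq_add_neg]
    congr 3
    refine Finset.sum_congr rfl fun j _ => ?_
    congr 1
    rw [← E.mOp_eq φ g hE _ (by omega)]
    congr 1
  rw [e, convTo_iff]
  · have h := fun N => E.powHom_sub_ev_mem (twistElt φ) (mkQ_alphaFree φ N) (fun _ => w)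
    constructor
    · intro h'
      refine (sub_eq_zero.1 (eq_zero_of_mem_fil fun N => ?_)).symm
      have := add_mem (h' N) (h N)
      rw [map_sub, _root_.sub_apply] at this
      convert this using 1
      abel
    · intro h' N
      rw [h', add_sub_add_left_eq_sub, ← neg_sub]
      have := neg_mem (h N)
      rwa [map_sub, _root_.sub_apply] at this
  · intro N
    rw [ev_alphaFree, ev_alphaFree, Finset.sum_range_succ, smul_add, neg_add]
    rw [← add_assoc, add_sub_cancel_left]
    exact neg_mem (zsmul_mem (Submodule.smul_mem _ _
      (fil_antitone (Nat.le_succ N) (E.mVal_snoc_mem_fil φ (N + 1) w))) _)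

/-- On an operation of arity 0 the bracket is plain application of `d'`. The N-th congruence
therefore compares `d' ξ` with the truncated value of d x, as the partial sums of the Maurer–Cartan
series do. -/
theorem mc_eqn_iff {d' : Tens A V →ₗ[𝕜] Tens A V}
    (hd : ∀ p w, Homog A V p w → Homog A V (p + 1) (d' w)) (g : BlockAlg O.toPreOperad d')
    (hE : ∀ {p n} (f : O.obj p n), E.hom f = g.hom f) :
    ConvTo A V (fun N => d' E.point - (ε : ℤ) • ∑ j ∈ Finset.range N,
      ((j + 2).factorial : 𝕜)⁻¹ • mOp φ g (j + 2) (by omega) (fun _ => E.point)) 0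
      ↔ ∀ N, E.ev (dxFree φ N) - (tensEnd A V).bracket (diffOp d' hd) E.pt
          ∈ filIdeal A V N (0 + 1) 0 := by
  have e : (fun N => d' E.point - (ε : ℤ) • ∑ j ∈ Finset.range N,
      ((j + 2).factorial : 𝕜)⁻¹ • mOp φ g (j + 2) (by omega) (fun _ => E.point))
      = fun N => d' E.point - toMulti (E.ev (dxFree φ N)) Fin.elim0 := by
    funext N
    rw [ev_dxFree]
    congr 2
    refine Finset.sum_congr rfl fun j _ => ?_
    congr 1
    exact E.mOp_eq φ g hE (j + 2) (by omega) fun _ => E.point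
  rw [e, convTo_iff]
  · refine forall_congr' fun N => ?_
    have hb : ∀ w, toMulti ((tensEnd A V).bracket (diffOp d' hd) E.pt) w = d' E.point := by
      intro w
      rw [toMulti_bracket_apply (c := Fin.elim0) _ _ fun j => j.elim0, Finset.univ_eq_empty,
        Finset.sum_empty, smul_zero, sub_zero, toMulti_diffOp, toMulti_pt]
    rw [sub_zero]
    constructor
    · intro h w
      rw [map_sub, _root_.sub_apply, hb, ← neg_sub, Subsingleton.elim w Fin.elim0]
      exact neg_mem h
    · intro h
      have := neg_mem (h Fin.elim0)
      rwa [map_sub, _root_.sub_apply, hb, neg_sub] at this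
  · intro N
    rw [ev_dxFree, ev_dxFree, Finset.sum_range_succ, smul_add, sub_sub_sub_cancel_left,
      sub_add_cancel_left]
    exact neg_mem (zsmul_mem (Submodule.smul_mem _ _
      (fil_antitone (by omega) (E.mVal_const_mem_fil φ (N + 2)))) _)

/-- A Block algebra and an even element of `A_+ ⊗ ΠV`. -/
noncomputable def ofAlg {d' : Tens A V →ₗ[𝕜] Tens A V} (g : BlockAlg O.toPreOperad d')
    (ξ : Tens A V) (even : PiHomog A V 0 ξ) (plus : InPlus A V ξ) : TensRep O A V where
  hom := g.hom
  isEndA := g.mem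
  hom_act := g.hom_act
  hom_comp := g.hom_comp
  pt := ofMulti (MultilinearMap.constOfIsEmpty 𝕜 _ ξ) fun c _ _ =>
    (zero_add_sum_fin_zero c).symm ▸ piHomog_iff.1 even
  pt_isEndA :=
    { parity := fun c _ _ => (zero_add_sum_fin_zero c).symm ▸ even
      multilinear := fun _ _ _ _ _ _ j => j.elim0
      plus := fun _ => plus
      continuous := fun _ i => ⟨i, fun _ _ => rfl⟩ }

theorem diffOp_eq_add {d d' : Tens A V →ₗ[𝕜] Tens A V}
    (hd : ∀ p w, Homog A V p w → Homog A V (p + 1) (d w))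
    (hd' : ∀ p w, Homog A V p w → Homog A V (p + 1) (d' w)) {α : (tensEnd A V).obj 1 1}
    (h : ∀ w, d w = d' w + toMulti α fun _ => w) : diffOp d hd = diffOp d' hd' + α :=
  toMulti_injective (MultilinearMap.ext fun w => by
    rw [map_add, _root_.add_apply, toMulti_diffOp, toMulti_diffOp, h]
    congr 2
    funext k
    exact congrArg w (Subsingleton.elim 0 k))

/-- A Block `Tw O`-algebra, from a Block `O`-algebra and a solution of the Maurer–Cartan
equation. -/
noncomputable def toTw {d d' : Tens A V →ₗ[𝕜] Tens A V}
    (hd : ∀ p w, Homog A V p w → Homog A V (p + 1) (d w)) (hd' : IsBlock A V d')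
    (hO : ∀ {p n} (f : O.obj p n),
      E.hom (O.d f) = (tensEnd A V).bracket (diffOp d' hd'.odd) (E.hom f))
    (hx : ∀ N, E.ev (dxFree φ N) - (tensEnd A V).bracket (diffOp d' hd'.odd) E.pt
      ∈ filIdeal A V N (0 + 1) 0)
    (h : ∀ w, d w = d' w + toMulti (E.powHom (twistElt φ)) fun _ => w) : TwBlockAlg φ d where
  toBlockAlg := BlockAlg.ofHom hd (P := twOperad φ) (fun {p n} => E.powHom (p := p) (n := n))
    (fun y => E.isEndA_powHom y) (fun σ y => E.powHom_act σ y)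
    (fun i h hs y y' => E.powHom_comp i h hs y y')
    (fun y => by
      refine (congrArg E.powHom (twOperad_d φ y)).trans ?_
      refine (map_add E.powHom _ _).trans ?_
      rw [diffOp_eq_add hd hd'.odd h, PreOperad.bracket_add]
      exact congrArg₂ _
        (E.powHom_powD (diffOp d' hd'.odd) (isCont_unaryMulti hd'.continuous) hO hx y)
        (E.powHom_bracket (twistElt φ) y))
  continuous p n i := ⟨order A i, fun y hy w =>
    (E.toLevel_powHom (order_spec i) y (z := 0) (by rw [map_zero, hy]) w).trans (by
      rw [map_zero, map_zero]; rfl)⟩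

end TensRep

end

/-! ### Symmetric operations on repeated arguments -/

theorem koszul_eq_one {n : ℕ} (σ : Equiv.Perm (Fin n)) (c : Fin n → ZMod 2)
    (h : ∀ i j, i < j → σ j < σ i → c (σ i) * c (σ j) = 0) : koszul σ c = 1 :=
  Finset.prod_eq_one fun i _ => Finset.prod_eq_one fun j _ => by
    split_ifs with hij
    · rw [h i j hij.1 hij.2, sgn_zero]
    · rfl

theorem update_fin_val {α : Type*} {n : ℕ} (W : ℕ → α) (j : Fin n) (x : α) :
    Function.update (fun k : Fin n => W k.1) j x = fun k => Function.update W j.1 x k.1 :=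
  (Function.update_comp_eq_of_injective W Fin.val_injective j x).symm

/-- For each `l` there are n! permutations that carry `l` to `x`. Inversion and a translation by a
swap reduce the count to the fibres of σ ↦ σ 0. -/
theorem sum_perm_inv_apply {M : Type*} [AddCommMonoid M] {n : ℕ} (x : Fin (n + 1))
    (h : Fin (n + 1) → M) :
    ∑ σ : Equiv.Perm (Fin (n + 1)), h (σ⁻¹ x) = n.factorial • ∑ l, h l := by
  rw [Fintype.sum_equiv (Equiv.inv _) (fun σ : Equiv.Perm (Fin (n + 1)) => h (σ⁻¹ x))
    (fun σ => h (σ x)) fun σ => rfl]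
  rw [Fintype.sum_equiv (Equiv.mulRight (Equiv.swap 0 x))
    (fun σ : Equiv.Perm (Fin (n + 1)) => h (σ x)) (fun σ => h (σ 0)) fun σ => by simp]
  rw [Fintype.sum_equiv Equiv.Perm.decomposeFin (fun σ : Equiv.Perm (Fin (n + 1)) => h (σ 0))
    (fun x => h x.1) fun σ => by
      obtain ⟨⟨p, e⟩, rfl⟩ := Equiv.Perm.decomposeFin.symm.surjective σ
      rw [Equiv.Perm.decomposeFin_symm_apply_zero, Equiv.apply_symm_apply]]
  rw [Fintype.sum_prod_type]
  simp [Finset.smul_sum, Fintype.card_perm]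

section

variable {𝕜 : Type u} [Field 𝕜] [CharZero 𝕜]

theorem ins_first {T : Type v} [AddCommGroup T] [Module 𝕜 T] {θ : ParityInvolution 𝕜 T}
    {q : ZMod 2} {a b r : ℕ} (h : r + 1 = a + 1 + b) (f : Multi 𝕜 T (a + 1)) (g : Multi 𝕜 T b) :
    ins θ q 0 h f g = insRaw 0 h f g :=
  Multi.ext_part θ fun c w hw => by
    rw [ins_apply _ _ _ _ _ _ hw]
    simp only [Fin.val_zero, not_lt_zero, Finset.filter_false, Finset.sum_empty, mul_zero,
      sgn_zero, one_smul]
    rfl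

theorem update_mem_part {T : Type v} [AddCommGroup T] [Module 𝕜 T] {θ : ParityInvolution 𝕜 T}
    {ι : Type*} [DecidableEq ι] {c : ι → ZMod 2} {W : ι → T} (hW : ∀ k, W k ∈ θ.part (c k)) (j : ι)
    {p : ZMod 2} {x : T} (hx : x ∈ θ.part p) (k : ι) :
    Function.update W j x k ∈ θ.part (Function.update c j p k) := by
  by_cases h : k = j
  · subst h; simpa using hx
  · simpa [Function.update_of_ne h] using hW k

variable {O : DGOperad.{u, v} 𝕜} {A : FormalCDGA 𝕜} {V : DGSpace 𝕜}
variable {ε : ℤˣ} (φ : PreOperad.Hom (lInf 𝕜 ε) O.toPreOperad)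

theorem lInf_act_m {p : ZMod 2} {n : ℕ} (hp : p = 1) (hn : 2 ≤ n) (σ : Equiv.Perm (Fin n)) :
    (lInf 𝕜 ε).act σ (lInfM 𝕜 ε n hp hn) = lInfM 𝕜 ε n hp hn := by
  have := mkQ_rel (Rel.base (LRel.symm (𝕜 := 𝕜) hp hn σ))
  rw [map_sub, sub_eq_zero] at this
  exact (presAct_cls σ _).trans this

theorem lInf_d_m (n : ℕ) (hn : 2 ≤ n) : (lInf 𝕜 ε).d (lInfM 𝕜 ε n (p := 1) rfl hn)
    = (ε : ℤ) • ∑ a ∈ Finset.range n, if h : 2 ≤ a ∧ a < n then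
      ((a.factorial * (n - a).factorial : ℕ) : 𝕜)⁻¹ • ∑ σ : Equiv.Perm (Fin n),
        (lInf 𝕜 ε).act σ ((lInf 𝕜 ε).comp (p := 1) (q := 1) (a := n - a + 1) (b := a) 0 (by omega)
          rfl (lInfM 𝕜 ε (n - a + 1) rfl (by omega)) (lInfM 𝕜 ε a rfl h.1))
      else 0 := by
  refine (presD_cls (lInfD 𝕜 ε) (lInfD_rel 𝕜 ε) _).trans ?_
  rw [treeD, lInfD]
  refine congrArg (fun x => (ε : ℤ) • x) (Finset.sum_congr rfl fun a _ => ?_)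
  refine dite_congr rfl (fun h => ?_) fun _ => rfl
  refine congrArg (fun x => _ • x) (Finset.sum_congr rfl fun σ _ => ?_)
  refine (presAct_cls σ _).symm.trans ?_
  exact congrArg (presAct σ) (presComp_cls _ _ _ _ _).symm

namespace TensRep

variable (E : TensRep O A V)

/-- The action of `m_n`. -/
noncomputable def brOp (n : ℕ) (hn : 2 ≤ n) : (tensEnd A V).obj 1 n :=
  E.hom (φ.toFun (lInfM 𝕜 ε n rfl hn))

theorem mVal_of_le {n : ℕ} (hn : 2 ≤ n) (W : ℕ → Tens A V) :
    E.mVal φ n W = toMulti (E.brOp φ n hn) fun k => W k.1 := dif_pos hn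

theorem mVal_of_lt {n : ℕ} (hn : n < 2) (W : ℕ → Tens A V) : E.mVal φ n W = 0 :=
  dif_neg hn.not_ge

theorem act_brOp (n : ℕ) (hn : 2 ≤ n) (σ : Equiv.Perm (Fin n)) :
    (tensEnd A V).act σ (E.brOp φ n hn) = E.brOp φ n hn := by
  rw [brOp, ← E.hom_act, ← φ.map_act, lInf_act_m]

theorem hom_d_m (n : ℕ) (hn : 2 ≤ n) : E.hom (O.d (φ.toFun (lInfM 𝕜 ε n (p := 1) rfl hn)))
    = (ε : ℤ) • ∑ a ∈ Finset.range n, if h : 2 ≤ a ∧ a < n then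
      ((a.factorial * (n - a).factorial : ℕ) : 𝕜)⁻¹ • ∑ σ : Equiv.Perm (Fin n),
        (tensEnd A V).act σ ((tensEnd A V).comp (a := n - a + 1) (b := a) 0 (by omega)
          rfl (E.brOp φ (n - a + 1) (by omega)) (E.brOp φ a h.1))
      else 0 := by
  rw [← φ.map_d, lInf_d_m, map_zsmul, map_zsmul, map_sum, map_sum]
  congr 1
  refine Finset.sum_congr rfl fun a _ => ?_
  split_ifs with h
  · rw [map_smul, map_smul, map_sum, map_sum]
    congr 1
    refine Finset.sum_congr rfl fun σ _ => ?_
    rw [φ.map_act, φ.map_comp, E.hom_act, E.hom_comp]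
    rfl
  · rw [map_zero, map_zero]

theorem mVal_mem_part (n : ℕ) {c : ℕ → ZMod 2} {W : ℕ → Tens A V}
    (hW : ∀ k, W k ∈ (tensParity A V).part (c k)) :
    E.mVal φ n W ∈ (tensParity A V).part (1 + ∑ k ∈ Finset.range n, c k) := by
  by_cases h : 2 ≤ n
  · rw [E.mVal_of_le φ h, Finset.sum_range]
    exact toMulti_mem _ (fun k => c k.1) _ fun k => hW k.1
  · rw [mVal, dif_neg h]
    exact zero_mem _

/-- The operation is symmetric, and `hc` says that no inverted pair consists of two odd arguments,
so the Koszul sign is 1. -/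
theorem mVal_swap {n p q : ℕ} (hp : p < n) (hq : q < n) {c : ℕ → ZMod 2} {W : ℕ → Tens A V}
    (hW : ∀ k, W k ∈ (tensParity A V).part (c k))
    (hc : ∀ i j, i < j → j < n → Equiv.swap p q j < Equiv.swap p q i →
      c (Equiv.swap p q i) * c (Equiv.swap p q j) = 0) :
    E.mVal φ n W = E.mVal φ n (W ∘ Equiv.swap p q) := by
  by_cases h : 2 ≤ n
  · have e : ∀ k : Fin n, (Equiv.swap (⟨p, hp⟩ : Fin n) ⟨q, hq⟩ k).1 = Equiv.swap p q k.1 := by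
      intro k
      simp only [Equiv.swap_apply_def, Fin.ext_iff]
      split_ifs <;> rfl
    have hk : koszul (Equiv.swap (⟨p, hp⟩ : Fin n) ⟨q, hq⟩) (fun k => c k.1) = 1 :=
      koszul_eq_one _ _ fun i j hij hs => by
        rw [e, e]
        rw [Fin.lt_def, e, e] at hs
        exact hc _ _ hij j.2 hs
    have ha := congrArg (fun f => toMulti f fun k => W k.1)
      (E.act_brOp φ n h (Equiv.swap (⟨p, hp⟩ : Fin n) ⟨q, hq⟩))
    rw [toMulti_act, braid_apply _ _ _ (c := fun k => c k.1) fun k => hW k.1, hk, one_smul] at ha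
    rw [E.mVal_of_le φ h, E.mVal_of_le φ h, ← ha]
    congr 1
    funext k
    rw [Function.comp_apply, e]
  · rw [mVal, dif_neg h, mVal, dif_neg h]

/-- The sequence with `u` in position `j`, and `ξ` elsewhere. -/
noncomputable abbrev one (j : ℕ) (u : Tens A V) : ℕ → Tens A V :=
  Function.update (fun _ => E.point) j u

/-- The sequence with `u` in position `i`, `w` in position `j`, and `ξ` elsewhere. -/
noncomputable abbrev two (i : ℕ) (u : Tens A V) (j : ℕ) (w : Tens A V) : ℕ → Tens A V :=
  Function.update (E.one j w) i u

theorem one_mem_part (j : ℕ) {c : ZMod 2} {u : Tens A V} (hu : u ∈ (tensParity A V).part c)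
    (k : ℕ) : E.one j u k ∈ (tensParity A V).part (Function.update (fun _ : ℕ => (0 : ZMod 2)) j c k) :=
  update_mem_part (c := fun _ => 0) (fun _ => E.point_mem_part) j hu k

theorem two_mem_part (i j : ℕ) {c c' : ZMod 2} {u w : Tens A V}
    (hu : u ∈ (tensParity A V).part c) (hw : w ∈ (tensParity A V).part c') (k : ℕ) :
    E.two i u j w k
      ∈ (tensParity A V).part (Function.update (Function.update (fun _ : ℕ => (0 : ZMod 2)) j c') i c k) :=
  update_mem_part (E.one_mem_part j hw) i hu k

/-- All other arguments are the even element ξ, past which `u` moves freely. -/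
theorem mVal_one_congr {n j : ℕ} (hj : j ≤ n) {c : ZMod 2} {u : Tens A V}
    (hu : u ∈ (tensParity A V).part c) : E.mVal φ (n + 1) (E.one j u)
      = E.mVal φ (n + 1) (E.one n u) := by
  rw [E.mVal_swap φ (Nat.lt_succ_of_le hj) (Nat.lt_succ_self n) (E.one_mem_part j hu)]
  · congr 1
    funext k
    simp only [Function.comp_apply, Function.update_apply, Equiv.swap_apply_def]
    split_ifs <;> first | rfl | omega
  · intro i k hik _ _
    by_cases h : Equiv.swap j n i = j
    · rw [Function.update_of_ne (a := Equiv.swap j n k), mul_zero]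
      exact fun h' => hik.ne ((Equiv.swap j n).injective (h.trans h'.symm))
    · rw [Function.update_of_ne h, zero_mul]

/-- `u` keeps its place in slot 0, so `w` only passes copies of ξ. -/
theorem mVal_two_congr_right {n j : ℕ} (hj : 0 < j) (hjn : j ≤ n) {c c' : ZMod 2}
    {u w : Tens A V} (hu : u ∈ (tensParity A V).part c) (hw : w ∈ (tensParity A V).part c') :
    E.mVal φ (n + 1) (E.two 0 u j w) = E.mVal φ (n + 1) (E.two 0 u n w) := by
  have hs0 : ∀ k, Equiv.swap j n k = 0 → k = 0 := fun k hk =>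
    (Equiv.swap j n).injective (hk.trans (Equiv.swap_apply_of_ne_of_ne (by omega) (by omega)).symm)
  rw [E.mVal_swap φ (Nat.lt_succ_of_le hjn) (Nat.lt_succ_self n) (E.two_mem_part 0 j hu hw)]
  · congr 1
    funext k
    simp only [Function.comp_apply, Function.update_apply, Equiv.swap_apply_def]
    split_ifs <;> first | rfl | omega
  · intro i k hik _ hs
    have hk0 : Equiv.swap j n k ≠ 0 := fun h => by have := hs0 k h; omega
    by_cases hkj : Equiv.swap j n k = j
    · rw [Function.update_of_ne (a := Equiv.swap j n i) (by omega),
        Function.update_of_ne (a := Equiv.swap j n i) (by omega), zero_mul]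
    · rw [Function.update_of_ne hk0, Function.update_of_ne hkj, mul_zero]

/-- `w` keeps its place in the last slot, so `u` only passes copies of ξ. -/
theorem mVal_two_congr_left {n j : ℕ} (hjn : j < n) {c c' : ZMod 2}
    {u w : Tens A V} (hu : u ∈ (tensParity A V).part c) (hw : w ∈ (tensParity A V).part c') :
    E.mVal φ (n + 1) (E.two j u n w) = E.mVal φ (n + 1) (E.two 0 u n w) := by
  have hsn : ∀ k, Equiv.swap j 0 k = n → k = n := fun k hk =>
    (Equiv.swap j 0).injective (hk.trans (Equiv.swap_apply_of_ne_of_ne (by omega) (by omega)).symm)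
  rw [E.mVal_swap φ (Nat.lt_succ_of_lt hjn) (Nat.succ_pos n) (E.two_mem_part j n hu hw)]
  · congr 1
    funext k
    simp only [Function.comp_apply, Function.update_apply, Equiv.swap_apply_def]
    split_ifs <;> first | rfl | omega
  · intro i k hik hkn hs
    have hi : Equiv.swap j 0 i ≠ n := fun h => by have := hsn i h; omega
    by_cases hij : Equiv.swap j 0 i = j
    · rw [Function.update_of_ne (a := Equiv.swap j 0 k) (by omega),
        Function.update_of_ne (a := Equiv.swap j 0 k) (by omega), mul_zero]
    · rw [Function.update_of_ne hij, Function.update_of_ne hi, zero_mul]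

/-- The values on `(ξ, …, ξ, w)` of the composites in the differential of `m_n`. -/
theorem sum_act_comp_apply {a b n : ℕ} (hn : n + 1 = a + b) (ha : 2 ≤ a) (hb : 1 ≤ b)
    (h : n + 1 + 1 = b + 1 + a) {c : ZMod 2} {w : Tens A V}
    (hw : w ∈ (tensParity A V).part c) :
    ∑ σ : Equiv.Perm (Fin (n + 1)), toMulti ((tensEnd A V).act σ
      ((tensEnd A V).comp (s := 1 + 1) (0 : Fin (b + 1)) h rfl (E.brOp φ (b + 1) (by omega))
        (E.brOp φ a ha))) (fun k => E.one n w k.1)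
      = n.factorial • (a • E.mVal φ (b + 1) (E.one b (E.mVal φ a (E.one (a - 1) w)))
        + b • E.mVal φ (b + 1) (E.two 0 (E.mVal φ a fun _ => E.point) b w)) := by
  have key : ∀ l : ℕ, E.mVal φ (b + 1) (insNat 0 a (E.mVal φ a (E.one l w)) (E.one l w))
      = if l < a then E.mVal φ (b + 1) (E.one b (E.mVal φ a (E.one (a - 1) w)))
        else if l < a + b then E.mVal φ (b + 1) (E.two 0 (E.mVal φ a fun _ => E.point) b w)
        else E.mVal φ (b + 1) (insNat 0 a (E.mVal φ a (E.one l w)) (E.one l w)) := by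
    intro l
    obtain ⟨a, rfl⟩ : ∃ a', a = a' + 1 := ⟨a - 1, by omega⟩
    split_ifs with hl hl'
    · rw [E.mVal_one_congr φ (Nat.le_of_lt_succ hl) hw, Nat.add_sub_cancel,
        ← E.mVal_one_congr φ (Nat.zero_le b) (E.mVal_mem_part φ _ (E.one_mem_part a hw))]
      congr 1
      funext k
      simp only [insNat, Function.update_apply]
      split_ifs <;> first | rfl | omega
    · have e : E.mVal φ (a + 1) (E.one l w) = E.mVal φ (a + 1) fun _ => E.point :=
        E.mVal_congr φ fun k hk => Function.update_of_ne (by omega) _ _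
      rw [e, ← E.mVal_two_congr_right φ (j := l - (a + 1) + 1) (by omega) (by omega)
        (E.mVal_mem_part φ _ (c := fun _ => 0) fun _ => E.point_mem_part) hw]
      congr 1
      funext k
      simp only [insNat, Function.update_apply]
      split_ifs <;> first | rfl | omega
    · rfl
  -- At most one argument, `w`, can be odd, so no sign arises; the permutation only decides which
  -- input receives `w`.
  have hσ : ∀ σ : Equiv.Perm (Fin (n + 1)), toMulti ((tensEnd A V).act σ
      ((tensEnd A V).comp (s := 1 + 1) (0 : Fin (b + 1)) h rfl (E.brOp φ (b + 1) (by omega))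
        (E.brOp φ a ha))) (fun k => E.one n w k.1)
      = E.mVal φ (b + 1) (insNat 0 a (E.mVal φ a (E.one (σ⁻¹ (Fin.last n)).1 w))
          (E.one (σ⁻¹ (Fin.last n)).1 w)) := by
    intro σ
    have e : (fun k : Fin (n + 1) => E.one n w (σ k).1)
        = fun k => E.one (σ⁻¹ (Fin.last n)).1 w k.1 := by
      funext k
      have : (σ k).1 = n ↔ k.1 = (σ⁻¹ (Fin.last n)).1 := by
        rw [← Fin.ext_iff, Equiv.Perm.eq_inv_iff_eq, Fin.ext_iff, Fin.val_last]
      simp only [Function.update_apply, this]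
    rw [toMulti_act, braid_apply _ _ _ (c := fun k => Function.update (fun _ : ℕ => (0 : ZMod 2)) n c k.1)
      fun k => E.one_mem_part n hw k.1, koszul_eq_one, one_smul, e, toMulti_comp, ins_first,
      insRaw_apply, insArg_nat, E.mVal_of_le φ (by omega : 2 ≤ b + 1)]
    · rw [E.mVal_of_le φ ha]
      simp only [innerIdx, Fin.val_zero, zero_add]
    · intro i k hik _
      by_cases h : (σ i).1 = n
      · rw [Function.update_of_ne (a := (σ k).1), mul_zero]
        exact fun h' => hik.ne (σ.injective (Fin.ext (h.trans h'.symm)))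
      · rw [Function.update_of_ne h, zero_mul]
  -- Each input receives `w` under n! permutations; `a` of the inputs are inner and `b` are outer.
  rw [Finset.sum_congr rfl fun σ _ => hσ σ, sum_perm_inv_apply (Fin.last n) fun l : Fin (n + 1) =>
    E.mVal φ (b + 1) (insNat 0 a (E.mVal φ a (E.one l.1 w)) (E.one l.1 w))]
  congr 1
  rw [← Finset.sum_range fun l =>
    E.mVal φ (b + 1) (insNat 0 a (E.mVal φ a (E.one l w)) (E.one l w)), hn, Finset.sum_range_add]
  congr 1
  · rw [Finset.sum_congr rfl fun l hl => (key l).trans (if_pos (Finset.mem_range.1 hl))]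
    simp
  · rw [Finset.sum_congr rfl fun l hl => (key (a + l)).trans
      ((if_neg (by omega)).trans (if_pos (by have := Finset.mem_range.1 hl; omega)))]
    simp

end TensRep

end

/-! ### The generalized Jacobi identities -/

section

variable {𝕜 : Type u} [Field 𝕜] [CharZero 𝕜]
variable {O : DGOperad.{u, v} 𝕜} {A : FormalCDGA 𝕜} {V : DGSpace 𝕜}
variable {ε : ℤˣ} (φ : PreOperad.Hom (lInf 𝕜 ε) O.toPreOperad)

namespace TensRep

variable (E : TensRep O A V)

/-- The map `u ↦ (1/n!) m_{n+1}(ξ, …, ξ, u)`. -/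
noncomputable def lMap (n : ℕ) : Tens A V →ₗ[𝕜] Tens A V :=
  if h : 2 ≤ n + 1 then (n.factorial : 𝕜)⁻¹ •
    (toMulti (E.brOp φ (n + 1) h)).toLinearMap (fun _ => E.point) (Fin.last n) else 0

/-- The map `u ↦ (1/(n-1)!) m_{n+1}(u, ξ, …, ξ, w)`. -/
noncomputable def qMap (n : ℕ) (w : Tens A V) : Tens A V →ₗ[𝕜] Tens A V :=
  if h : 2 ≤ n + 1 then ((n - 1).factorial : 𝕜)⁻¹ •
    (toMulti (E.brOp φ (n + 1) h)).toLinearMap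
      (Function.update (fun _ => E.point) (Fin.last n) w) 0 else 0

/-- The element `(1/(n+1)!) m_{n+1}(ξ, …, ξ)`. -/
noncomputable def curv (n : ℕ) : Tens A V :=
  ((n + 1).factorial : 𝕜)⁻¹ • E.mVal φ (n + 1) fun _ => E.point

theorem lMap_apply (n : ℕ) (u : Tens A V) :
    E.lMap φ n u = (n.factorial : 𝕜)⁻¹ • E.mVal φ (n + 1) (E.one n u) := by
  rw [lMap]
  split_ifs with h
  · rw [E.mVal_of_le φ h, LinearMap.smul_apply, MultilinearMap.toLinearMap_apply]
    congr 2
    exact update_fin_val (fun _ => E.point) (Fin.last n) u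
  · rw [E.mVal_of_lt φ (by omega), smul_zero]; rfl

theorem qMap_apply (n : ℕ) (w u : Tens A V) :
    E.qMap φ n w u = ((n - 1).factorial : 𝕜)⁻¹ • E.mVal φ (n + 1) (E.two 0 u n w) := by
  rw [qMap]
  split_ifs with h
  · rw [E.mVal_of_le φ h, LinearMap.smul_apply, MultilinearMap.toLinearMap_apply]
    congr 2
    rw [update_fin_val (fun _ => E.point) (Fin.last n) w]
    exact update_fin_val (E.one n w) 0 u
  · rw [E.mVal_of_lt φ (by omega), smul_zero]; rfl

theorem lMap_zero : E.lMap φ 0 = 0 := dif_neg (by omega)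

theorem qMap_zero (w : Tens A V) : E.qMap φ 0 w = 0 := dif_neg (by omega)

theorem curv_zero : E.curv φ 0 = 0 := by
  rw [curv, E.mVal_of_lt φ (by omega), smul_zero]

theorem lMap_mem_fil (n m : ℕ) {u : Tens A V} (hu : u ∈ fil A V m) :
    E.lMap φ n u ∈ fil A V (n + m) := by
  rw [lMap_apply]
  refine Submodule.smul_mem _ _ ?_
  have := E.mVal_mem_fil φ (n + 1) (W := E.one n u) (m := Function.update (fun _ => 1) n m)
    fun k => by
      by_cases h : k = n
      · subst h; simpa using hu
      · simpa [Function.update_of_ne h] using E.point_mem_fil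
  rw [Finset.sum_range_succ, Function.update_self,
    Finset.sum_congr rfl fun k hk => Function.update_of_ne (Finset.mem_range.1 hk).ne _ _] at this
  simpa using this

/-- Among the arguments, n - 1 are ξ and contribute one power of A_+ each, while `w` contributes
none. For n = 0 the map vanishes, so truncated subtraction does no harm. -/
theorem qMap_mem_fil (n m : ℕ) (w : Tens A V) {u : Tens A V} (hu : u ∈ fil A V m) :
    E.qMap φ n w u ∈ fil A V (n - 1 + m) := by
  cases n with
  | zero => rw [qMap_zero]; exact zero_mem _
  | succ n =>
    rw [qMap_apply]
    refine Submodule.smul_mem _ _ ?_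
    have := E.mVal_mem_fil φ (n + 1 + 1) (W := E.two 0 u (n + 1) w)
      (m := Function.update (Function.update (fun _ => 1) (n + 1) 0) 0 m) fun k => by
        by_cases h : k = 0
        · subst h; simpa using hu
        · simp only [two, Function.update_of_ne h]
          by_cases h' : k = n + 1
          · subst h'; simpa using mem_fil_zero w
          · simpa [Function.update_of_ne h'] using E.point_mem_fil
    rw [Finset.sum_range_succ, Finset.sum_range_succ', Function.update_self,
      Function.update_of_ne (Nat.succ_ne_zero n), Function.update_self,
      Finset.sum_congr rfl fun k hk => (Function.update_of_ne (Nat.succ_ne_zero k) _ _).trans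
        (Function.update_of_ne (by have := Finset.mem_range.1 hk; omega) _ _)] at this
    simpa using this

theorem curv_mem_fil (n : ℕ) : E.curv φ n ∈ fil A V (n + 1) :=
  Submodule.smul_mem _ _ (E.mVal_const_mem_fil φ (n + 1))

theorem toMulti_mem_part (D : (tensEnd A V).obj 1 1) {c : ZMod 2} {u : Tens A V}
    (hu : u ∈ (tensParity A V).part c) :
    (toMulti D fun _ => u) ∈ (tensParity A V).part (1 + c) := by
  simpa using toMulti_mem D (fun _ => c) (fun _ => u) fun _ => hu

/-- The bracket's minus sign turns into a plus because the operation is odd, the Koszul signs are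
trivial because ξ is even, and the `n` slots holding ξ give equal terms by symmetry. -/
theorem bracket_brOp_apply (D : (tensEnd A V).obj 1 1) {n : ℕ} (hn : 2 ≤ n + 1) {c : ZMod 2}
    {w : Tens A V} (hw : w ∈ (tensParity A V).part c) :
    toMulti ((tensEnd A V).bracket D (E.brOp φ (n + 1) hn)) (fun k => E.one n w k.1)
      = (toMulti D fun _ => E.mVal φ (n + 1) (E.one n w))
        + n • E.mVal φ (n + 1) (E.two 0 (toMulti D fun _ => E.point) n w)
        + E.mVal φ (n + 1) (E.one n (toMulti D fun _ => w)) := by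
  rw [toMulti_bracket_apply _ _ (c := fun k => Function.update (fun _ : ℕ => (0 : ZMod 2)) n c k.1)
    fun k => E.one_mem_part n hw k.1, ← E.mVal_of_le φ hn, sgn_one, neg_one_zsmul, sub_neg_eq_add,
    add_assoc]
  congr 1
  have hs : ∀ j : Fin (n + 1), (∑ l with l < j,
      Function.update (fun _ : ℕ => (0 : ZMod 2)) n c l.1) = 0 := fun j =>
    Finset.sum_eq_zero fun l hl => Function.update_of_ne (by
      have h1 : l.1 < j.1 := (Finset.mem_filter.1 hl).2
      have := j.2
      omega) _ _
  simp only [hs, sgn_zero, one_smul, update_fin_val, ← E.mVal_of_le φ hn]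
  rw [Fin.sum_univ_castSucc]
  congr 1
  · rw [Finset.sum_congr rfl (g := fun _ =>
      E.mVal φ (n + 1) (E.two 0 (toMulti D fun _ => E.point) n w)) fun i _ => ?_]
    · simp
    · have e : E.one n w i.1 = E.point := Function.update_of_ne i.2.ne _ _
      rw [Fin.val_castSucc, e]
      exact E.mVal_two_congr_left φ i.2 (toMulti_mem_part D E.point_mem_part) hw
  · have e : E.one n w n = w := Function.update_self _ _ _
    rw [Fin.val_last, e, Function.update_idem]

/-- The hypothesis `hO` for m_{n+1} is evaluated at (ξ, …, ξ, w) and divided by n!. In a composite,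
`w` enters either the inner operation, giving a product of two `lMap`, or the outer one, giving
`qMap` of a `curv`. -/
theorem lInf_identity (D : (tensEnd A V).obj 1 1)
    (hO : ∀ {p n} (f : O.obj p n), E.hom (O.d f) = (tensEnd A V).bracket D (E.hom f))
    (n : ℕ) {c : ZMod 2} {w : Tens A V} (hw : w ∈ (tensParity A V).part c) :
    (toMulti D fun _ => E.lMap φ n w) + E.lMap φ n (toMulti D fun _ => w)
        + E.qMap φ n w (toMulti D fun _ => E.point)
      = (ε : ℤ) • ∑ x ∈ Finset.HasAntidiagonal.antidiagonal n,
        (E.lMap φ x.2 (E.lMap φ x.1 w) + E.qMap φ x.2 w (E.curv φ x.1)) := by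
  rcases Nat.eq_zero_or_pos n with rfl | hn0
  · simp only [Finset.Nat.antidiagonal_zero, Finset.sum_singleton, lMap_zero, qMap_zero,
      LinearMap.zero_apply, add_zero, smul_zero]
    exact (unaryLin (toMulti D)).map_zero
  have hn : 2 ≤ n + 1 := by omega
  have hf : (n.factorial : 𝕜) ≠ 0 := Nat.cast_ne_zero.2 n.factorial_ne_zero
  have h := congrArg (fun f => (n.factorial : 𝕜)⁻¹ • toMulti f fun k => E.one n w k.1)
    (hO (φ.toFun (lInfM 𝕜 ε (n + 1) (p := 1) rfl hn)))
  rw [E.hom_d_m φ] at h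
  have hb := E.bracket_brOp_apply φ D hn hw
  rw [brOp] at hb
  rw [hb] at h
  have hD : ∀ (k : 𝕜) u, (toMulti D fun _ => k • u) = k • toMulti D fun _ => u :=
    (unaryLin (toMulti D)).map_smul
  -- The factor `n` counts the slots holding ξ on which `D` can act.
  have hq : ((n - 1).factorial : 𝕜)⁻¹ = (n.factorial : 𝕜)⁻¹ * n := by
    obtain ⟨m, rfl⟩ : ∃ m, n = m + 1 := ⟨n - 1, by omega⟩
    have : ((m + 1 : ℕ) : 𝕜) ≠ 0 := Nat.cast_ne_zero.2 (Nat.succ_ne_zero m)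
    rw [Nat.factorial_succ, Nat.cast_mul, mul_inv, Nat.add_sub_cancel]
    field_simp
  have hlhs : (toMulti D fun _ => E.lMap φ n w) + E.lMap φ n (toMulti D fun _ => w)
        + E.qMap φ n w (toMulti D fun _ => E.point)
      = (n.factorial : 𝕜)⁻¹ • ((toMulti D fun _ => E.mVal φ (n + 1) (E.one n w))
        + n • E.mVal φ (n + 1) (E.two 0 (toMulti D fun _ => E.point) n w)
        + E.mVal φ (n + 1) (E.one n (toMulti D fun _ => w))) := by
    rw [lMap_apply, lMap_apply, qMap_apply, hD, hq, mul_smul, Nat.cast_smul_eq_nsmul, smul_add,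
      smul_add]
    abel
  rw [hlhs, ← h, map_zsmul, map_sum, _root_.smul_apply, _root_.sum_apply,
    smul_comm (n.factorial : 𝕜)⁻¹ (ε : ℤ)]
  congr 1
  -- Index shift: the inner operation of arity a + 1 corresponds to `a` on the antidiagonal. The
  -- summands with inner arity 0 on one side and with outer index 0 on the other vanish and are
  -- split off.
  rw [Finset.Nat.sum_antidiagonal_eq_sum_range_succ_mk, Finset.sum_range_succ',
    Finset.sum_range_succ, Nat.sub_self, lMap_zero, qMap_zero, LinearMap.zero_apply,
    LinearMap.zero_apply, dif_neg (by omega : ¬(2 ≤ 0 ∧ 0 < n + 1)), map_zero, _root_.zero_apply,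
    add_zero (0 : Tens A V), add_zero (_ : Tens A V), add_zero (_ : Tens A V), Finset.smul_sum]
  refine Finset.sum_congr rfl fun a ha => ?_
  have ha := Finset.mem_range.1 ha
  split_ifs with h'
  · rw [map_smul, _root_.smul_apply, map_sum, _root_.sum_apply,
      E.sum_act_comp_apply φ (a := a + 1) (b := n + 1 - (a + 1)) (by omega) (by omega) (by omega)
        (by omega) hw]
    obtain ⟨b, rfl⟩ : ∃ b, n = a + (b + 1) := ⟨n - a - 1, by omega⟩
    have e1 : a + (b + 1) + 1 - (a + 1) = b + 1 := by omega
    have e2 : a + (b + 1) - a = b + 1 := by omega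
    rw [e2]
    simp only [e1]
    rw [← Nat.cast_smul_eq_nsmul 𝕜, ← Nat.cast_smul_eq_nsmul 𝕜, ← Nat.cast_smul_eq_nsmul 𝕜,
      E.lMap_apply φ a w, map_smul, E.lMap_apply φ (b + 1), curv, map_smul, qMap_apply,
      Nat.add_sub_cancel, Nat.add_sub_cancel, smul_smul, smul_smul, smul_add, smul_smul,
      smul_smul, smul_smul, smul_smul]
    have hf' : ∀ k : ℕ, (k.factorial : 𝕜) ≠ 0 := fun k => Nat.cast_ne_zero.2 k.factorial_ne_zero
    have hs' : ∀ k : ℕ, (k : 𝕜) + 1 ≠ 0 := fun k => by exact_mod_cast Nat.succ_ne_zero k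
    have h1 := hf' a
    have h2 := hf' b
    have h3 := hs' a
    have h4 := hs' b
    -- The coefficient 1/((a+1)! (b+1)!) times a + 1 is 1/(a! (b+1)!), and times b + 1 it is
    -- 1/((a+1)! b!).
    congr 2
    · push_cast [Nat.factorial_succ]
      field_simp
    · push_cast [Nat.factorial_succ]
      field_simp
  -- This is inner arity 1, for which there is no bracket.
  · have : a = 0 := by omega
    subst this
    rw [map_zero, _root_.zero_apply, smul_zero, lMap_zero, curv_zero, LinearMap.zero_apply,
      map_zero, map_zero, add_zero]

end TensRep

end

/-! ### The square of the untwisted differential -/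

section

variable {𝕜 : Type u} [Field 𝕜] [CharZero 𝕜]
variable {O : DGOperad.{u, v} 𝕜} {A : FormalCDGA 𝕜} {V : DGSpace 𝕜}
variable {ε : ℤˣ} (φ : PreOperad.Hom (lInf 𝕜 ε) O.toPreOperad)

/-- A square of indices exceeds the triangle only by terms with a + b ≥ N. -/
theorem sum_range_sub_sum_antidiagonal_mem {X : ℕ → ℕ → Tens A V}
    (hX : ∀ a b, X a b ∈ fil A V (a + b)) (N : ℕ) :
    ∑ a ∈ Finset.range N, ∑ b ∈ Finset.range N, X a b
      - ∑ n ∈ Finset.range N, ∑ x ∈ Finset.HasAntidiagonal.antidiagonal n, X x.1 x.2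
      ∈ fil A V N := by
  simp only [Finset.Nat.sum_antidiagonal_eq_sum_range_succ X, Nat.succ_eq_add_one]
  rw [Finset.sum_range_diag_flip, ← Finset.sum_sub_distrib]
  refine sum_mem fun a _ => ?_
  rw [← Finset.sum_sdiff_eq_sub (Finset.range_mono (Nat.sub_le N a))]
  refine sum_mem fun b hb => fil_antitone ?_ (hX a b)
  rw [Finset.mem_sdiff, Finset.mem_range, Finset.mem_range] at hb
  omega

namespace TensRep

variable (E : TensRep O A V)

/-- The partial sums of the series `∑ (1/n!) m_{n+1}(ξ, …, ξ, -)`. -/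
noncomputable def lSum (N : ℕ) : Tens A V →ₗ[𝕜] Tens A V :=
  ∑ n ∈ Finset.range (N + 1), E.lMap φ n

/-- The action of the twisting element. -/
noncomputable def alphaLin : Tens A V →ₗ[𝕜] Tens A V :=
  unaryLin (toMulti (E.powHom (twistElt φ)))

/-- α acts as -ε ∑ l_n. As l_0 = 0, the sum up to n = N has the same terms as the truncation of α at
order N. -/
theorem alphaLin_add_mem (N : ℕ) (w : Tens A V) :
    E.alphaLin φ w + (ε : ℤ) • E.lSum φ N w ∈ fil A V N := by
  have h := E.powHom_sub_ev_mem (twistElt φ) (mkQ_alphaFree φ N) (fun _ => w)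
  rw [map_sub, _root_.sub_apply, ev_alphaFree, sub_neg_eq_add] at h
  suffices e : E.lSum φ N w = ∑ j ∈ Finset.range N, ((j + 1).factorial : 𝕜)⁻¹ •
      E.mVal φ (j + 2) fun k => if k < j + 1 then E.point else w by
    rw [e]; exact h
  rw [lSum, LinearMap.sum_apply, Finset.sum_range_succ', lMap_zero, LinearMap.zero_apply,
    add_zero]
  refine Finset.sum_congr rfl fun j _ => ?_
  rw [lMap_apply]
  congr 1
  refine E.mVal_congr φ fun k hk => ?_
  simp only [one, Function.update_apply]
  split_ifs <;> first | rfl | omega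

/-- The Maurer–Cartan equation Dξ = ε ∑ c_a, truncated; the added term at a = 0 vanishes. -/
theorem point_sub_mem (D : (tensEnd A V).obj 1 1)
    (hx : ∀ N, E.ev (dxFree φ N) - (tensEnd A V).bracket D E.pt ∈ filIdeal A V N (0 + 1) 0)
    (N : ℕ) : (ε : ℤ) • ∑ a ∈ Finset.range (N + 1), E.curv φ a - unaryLin (toMulti D) E.point
      ∈ fil A V N := by
  have h := hx N Fin.elim0
  rw [map_sub, _root_.sub_apply, ev_dxFree,
    toMulti_bracket_apply (c := Fin.elim0) _ _ fun j => j.elim0, Finset.univ_eq_empty,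
    Finset.sum_empty, smul_zero, sub_zero, toMulti_pt] at h
  rw [Finset.sum_range_succ', curv_zero, add_zero]
  exact h

/-- The Jacobi identities are summed over n ≤ N. Modulo A_+^N ⊗ V the sum over antidiagonals becomes
a double sum over a square, and there the terms with `qMap` cancel by the Maurer–Cartan equation. -/
theorem lSum_identity (D : (tensEnd A V).obj 1 1)
    (hO : ∀ {p n} (f : O.obj p n), E.hom (O.d f) = (tensEnd A V).bracket D (E.hom f))
    (hx : ∀ N, E.ev (dxFree φ N) - (tensEnd A V).bracket D E.pt ∈ filIdeal A V N (0 + 1) 0)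
    (N : ℕ) {c : ZMod 2} {w : Tens A V} (hw : w ∈ (tensParity A V).part c) :
    unaryLin (toMulti D) (E.lSum φ N w) + E.lSum φ N (unaryLin (toMulti D) w)
      - (ε : ℤ) • E.lSum φ N (E.lSum φ N w) ∈ fil A V N := by
  set X : ℕ → ℕ → Tens A V := fun a b =>
    E.lMap φ b (E.lMap φ a w) + E.qMap φ b w (E.curv φ a) with hX
  have hXm : ∀ a b, X a b ∈ fil A V (a + b) := fun a b => by
    -- The power that `qMap` lacks, with degree b - 1, is supplied by `curv`, which has degree a +
    -- 1.
    refine add_mem ?_ (fil_antitone (by omega) (E.qMap_mem_fil φ b _ w (E.curv_mem_fil φ a)))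
    have := E.lMap_mem_fil φ b _ (E.lMap_mem_fil φ a 0 (mem_fil_zero w))
    exact fil_antitone (by omega) this
  have h1 := Finset.sum_congr (s₁ := Finset.range (N + 1)) rfl fun n _ =>
    E.lInf_identity φ D hO n hw
  rw [Finset.sum_add_distrib, Finset.sum_add_distrib, ← Finset.smul_sum] at h1
  have e1 : ∑ n ∈ Finset.range (N + 1), (toMulti D fun _ => E.lMap φ n w)
      = unaryLin (toMulti D) (E.lSum φ N w) := by
    rw [lSum, LinearMap.sum_apply, map_sum]; rfl
  have e2 : ∑ n ∈ Finset.range (N + 1), E.lMap φ n (toMulti D fun _ => w)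
      = E.lSum φ N (unaryLin (toMulti D) w) := by
    rw [lSum, LinearMap.sum_apply]; rfl
  have e3 : ∑ a ∈ Finset.range (N + 1), ∑ b ∈ Finset.range (N + 1), X a b
      = E.lSum φ N (E.lSum φ N w) + ∑ b ∈ Finset.range (N + 1),
        E.qMap φ b w (∑ a ∈ Finset.range (N + 1), E.curv φ a) := by
    rw [Finset.sum_comm]
    simp only [hX, Finset.sum_add_distrib, lSum, LinearMap.sum_apply, map_sum]
    congr 1
    exact Finset.sum_comm
  have h2 := zsmul_mem (fil_antitone (Nat.le_succ N)
    (sum_range_sub_sum_antidiagonal_mem hXm (N + 1))) (ε : ℤ)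
  -- Inside `qMap`, the sum of the `curv` may be exchanged for `D ξ` by the Maurer–Cartan equation.
  have h3 : ∑ b ∈ Finset.range (N + 1), E.qMap φ b w
      ((ε : ℤ) • ∑ a ∈ Finset.range (N + 1), E.curv φ a - unaryLin (toMulti D) E.point)
      ∈ fil A V N := sum_mem fun b _ =>
    fil_antitone (Nat.le_add_left _ _) (E.qMap_mem_fil φ b N w (E.point_sub_mem φ D hx N))
  simp only [map_sub, map_zsmul, Finset.sum_sub_distrib, ← Finset.smul_sum] at h3
  rw [e1, e2] at h1
  rw [e3, smul_sub, smul_add, ← h1] at h2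
  have := sub_mem h3 h2
  convert this using 1
  simp only [unaryLin_apply]
  abel

theorem alphaLin_mem_fil {N : ℕ} {w : Tens A V} (hw : w ∈ fil A V N) :
    E.alphaLin φ w ∈ fil A V N := by
  have := (E.isEndA_powHom (twistElt φ)).map_fil (fun _ => N) (fun _ => w) fun _ => hw
  rwa [Fin.sum_univ_one] at this

/-- Adding the action of the twisting element to a differential does not change its square. -/
theorem alphaLin_square (D : (tensEnd A V).obj 1 1) (hD : IsCont (toMulti D))
    (hO : ∀ {p n} (f : O.obj p n), E.hom (O.d f) = (tensEnd A V).bracket D (E.hom f))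
    (hx : ∀ N, E.ev (dxFree φ N) - (tensEnd A V).bracket D E.pt ∈ filIdeal A V N (0 + 1) 0)
    (w : Tens A V) :
    unaryLin (toMulti D) (E.alphaLin φ w) + E.alphaLin φ (unaryLin (toMulti D) w)
      + E.alphaLin φ (E.alphaLin φ w) = 0 := by
  suffices H : ∀ c, ∀ w ∈ (tensParity A V).part c,
      unaryLin (toMulti D) (E.alphaLin φ w) + E.alphaLin φ (unaryLin (toMulti D) w)
      + E.alphaLin φ (E.alphaLin φ w) = 0 by
    rw [← (tensParity A V).sum_pr w]
    simp only [map_sum, ← Finset.sum_add_distrib]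
    exact Finset.sum_eq_zero fun c _ => H c _ ((tensParity A V).pr_mem c w)
  intro c w hw
  refine Tens.ext' fun i => ?_
  obtain ⟨j, hj⟩ := hD (fun _ => 0) i
  set N := max (order A i) (order A j)
  have hNi : augPow A N ≤ (A.K i).restrictScalars 𝕜 :=
    (augPow_antitone A (le_max_left _ _)).trans (order_spec i)
  have hNj : augPow A N ≤ (A.K j).restrictScalars 𝕜 :=
    (augPow_antitone A (le_max_right _ _)).trans (order_spec j)
  have hε : ∀ x : Tens A V, (ε : ℤ) • (ε : ℤ) • x = x := fun x => by
    rw [smul_smul, Int.units_coe_mul_self, one_smul]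
  have h1 := E.alphaLin_add_mem φ N w
  have h2 := E.alphaLin_add_mem φ N (unaryLin (toMulti D) w)
  have h3 := E.alphaLin_mem_fil φ h1
  have h4 := zsmul_mem (E.alphaLin_add_mem φ N (E.lSum φ N w)) (ε : ℤ)
  have h5 := zsmul_mem (E.lSum_identity φ D hO hx N hw) (ε : ℤ)
  -- Only continuity of `D` is assumed, so the truncation error is made to vanish at level `j` in
  -- order that its image vanishes at level `i`.
  have h6 : toLevel A V i (unaryLin (toMulti D) (E.alphaLin φ w + (ε : ℤ) • E.lSum φ N w)) = 0 := by
    have := hj (fun _ => E.alphaLin φ w + (ε : ℤ) • E.lSum φ N w) fun _ => by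
      rw [toLevel_eq_zero_of_mem_fil hNj h1, map_zero]
    refine this.trans ?_
    have h0 : (toMulti D fun _ => (0 : Tens A V)) = 0 := (unaryLin (toMulti D)).map_zero
    rw [h0, map_zero]
  -- In this combination, added to `h6`, all partial sums cancel because ε² = 1; what remains is the
  -- desired expression.
  have h7 := toLevel_eq_zero_of_mem_fil hNi (sub_mem (sub_mem (add_mem h2 h3) h4) h5)
  have h8 := congrArg₂ (· + ·) h6 h7
  simp only [← map_add, add_zero] at h8
  refine Eq.trans ?_ h8
  rw [← toLevel_apply]
  congr 1
  simp only [map_add, map_zsmul, smul_add, smul_sub, hε]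
  abel

end TensRep

end

/-! ### The correspondence -/

section

variable {𝕜 : Type u} [Field 𝕜] [CharZero 𝕜]
variable {O : DGOperad.{u, v} 𝕜} {A : FormalCDGA 𝕜} {V : DGSpace 𝕜}

theorem BlockAlg.ext_op {P : PreOperad.{u, v} 𝕜} {d : Tens A V →ₗ[𝕜] Tens A V}
    {F G : BlockAlg P d} (h : ∀ {p n} (f : P.obj p n), F.op f = G.op f) : F = G := by
  obtain ⟨f, _⟩ := F
  obtain ⟨g, _⟩ := G
  obtain rfl : @f = @g := by
    funext p n
    exact LinearMap.ext h
  rfl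

theorem TensRep.ext_hom {E E' : TensRep O A V}
    (h : ∀ {p n} (f : O.obj p n), E.hom f = E'.hom f) (hpt : E.pt = E'.pt) : E = E' := by
  obtain ⟨f, _, _, _, _, _⟩ := E
  obtain ⟨g, _, _, _, _, _⟩ := E'
  obtain rfl : @f = @g := by
    funext p n
    exact LinearMap.ext h
  obtain rfl := hpt
  rfl

/-- The inclusion of `O` in `O[[x]]`. -/
noncomputable def powOld {p : ZMod 2} {n : ℕ} : O.obj p n →ₗ[𝕜] powObj O p n where
  toFun f := ⟨fun _ => old f, fun _ _ _ => rfl⟩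
  map_add' f g := Subtype.ext (funext fun _ => map_add old f g)
  map_smul' c f := Subtype.ext (funext fun _ => map_smul old c f)

theorem powOld_eq {p : ZMod 2} {n : ℕ} (f : O.obj p n) :
    powOld f = powFree (tr 𝕜 (.gen (.old f))) := rfl

theorem powOld_act {p : ZMod 2} {n : ℕ} (σ : Equiv.Perm (Fin n)) (f : O.obj p n) :
    powOld (O.act σ f) = powAct σ (powOld f) := Subtype.ext (funext fun _ => old_act σ f)

theorem powOld_comp {p q s : ZMod 2} {a b r : ℕ} (i : Fin a) (h : r + 1 = a + b)
    (hs : s = p + q) (f : O.obj p a) (g : O.obj q b) :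
    powOld (O.comp i h hs f g) = powComp i h hs (powOld f) (powOld g) :=
  Subtype.ext (funext fun _ => old_comp i h hs f g)

variable {ε : ℤˣ} {φ : PreOperad.Hom (lInf 𝕜 ε) O.toPreOperad}

theorem powD_powOld {p : ZMod 2} {n : ℕ} (f : O.obj p n) :
    powD φ (powOld f) = powOld (O.d f) :=
  Subtype.ext (funext fun N => presD_cls (adjD φ N) (adjD_rel φ N) (.gen (.old f)))

theorem MCData.ext_op {d : Tens A V →ₗ[𝕜] Tens A V} {m m' : MCData φ d} (hd : m.d' = m'.d')
    (hop : ∀ {p n} (f : O.obj p n), m.alg.op f = m'.alg.op f) (hξ : m.ξ = m'.ξ) : m = m' := by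
  obtain ⟨d₁, _, alg, ξ, _, _⟩ := m
  obtain ⟨d₂, _, alg', ξ', _, _⟩ := m'
  obtain rfl : d₁ = d₂ := hd
  obtain rfl : alg = alg' := BlockAlg.ext_op hop
  obtain rfl : ξ = ξ' := hξ
  rfl

namespace TensRep

theorem powHom_powOld (E : TensRep O A V) {p : ZMod 2} {n : ℕ} (f : O.obj p n) :
    E.powHom (powOld f) = E.hom f := by
  rw [powOld_eq, powHom_powFree, evalFree_tr]
  rfl

theorem powHom_x (E : TensRep O A V) : E.powHom (powFree (tr 𝕜 (.gen .x))) = E.pt := by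
  rw [powHom_powFree, evalFree_tr]
  rfl

end TensRep

/-! ### From Block Tw O-algebras to Maurer–Cartan data -/

namespace TwBlockAlg

variable {d : Tens A V →ₗ[𝕜] Tens A V} (F : TwBlockAlg φ d)

theorem ext_op {F G : TwBlockAlg φ d}
    (h : ∀ {p n} (f : (twOperad φ).obj p n), F.op f = G.op f) : F = G := by
  obtain ⟨F, _⟩ := F
  obtain ⟨G, _⟩ := G
  obtain rfl : F = G := BlockAlg.ext_op h
  rfl

/-- The action of the elements of `O[[x]]`. -/
noncomputable def powMap {p : ZMod 2} {n : ℕ} : powObj O p n →ₗ[𝕜] (tensEnd A V).obj p n :=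
  F.toBlockAlg.hom (P := twOperad φ)

theorem powMap_act {p : ZMod 2} {n : ℕ} (σ : Equiv.Perm (Fin n)) (y : powObj O p n) :
    F.powMap (powAct σ y) = (tensEnd A V).act σ (F.powMap y) := F.toBlockAlg.hom_act σ y

theorem powMap_comp {p q s : ZMod 2} {a b r : ℕ} (i : Fin a) (h : r + 1 = a + b)
    (hs : s = p + q) (y : powObj O p a) (y' : powObj O q b) :
    F.powMap (powComp i h hs y y') = (tensEnd A V).comp i h hs (F.powMap y) (F.powMap y') :=
  F.toBlockAlg.hom_comp i h hs y y'

theorem isEndA_powMap {p : ZMod 2} {n : ℕ} (y : powObj O p n) :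
    IsEndA A V p (toMulti (F.powMap y)) := F.mem y

/-- The restriction to `O` and the value of `x`. -/
noncomputable def rep : TensRep O A V where
  hom := F.powMap ∘ₗ powOld
  isEndA f := F.isEndA_powMap (powOld f)
  hom_act σ f := by
    rw [LinearMap.comp_apply, powOld_act, powMap_act]; rfl
  hom_comp i h hs f g := by
    rw [LinearMap.comp_apply, powOld_comp, powMap_comp]; rfl
  pt := F.powMap (powFree (tr 𝕜 (.gen .x)))
  pt_isEndA := F.isEndA_powMap _

/-- Finite composites need no continuity: a map that respects actions and compositions is fixed on
them by the generators. -/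
theorem powMap_powFree {p : ZMod 2} {n : ℕ} (z : Free 𝕜 (AdjGen O.obj) p n) :
    F.powMap (powFree z) = F.rep.ev z := by
  induction z using Free.induct with
  | h0 => rw [map_zero, map_zero, map_zero]
  | ha x y hx hy => rw [map_add, map_add, map_add, hx, hy]
  | hs c x hx => rw [map_smul, map_smul, map_smul, hx]
  | ht t =>
    rw [evalFree_tr]
    induction t with
    | gen g => cases g <;> rfl
    | act σ t ih => rw [← freeAct_tr, powFree_act, powMap_act, ih]; rfl
    | comp i h hs t t' ih ih' => rw [← freeComp_tr, powFree_comp, powMap_comp, ih, ih']; rfl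

/-- A continuous action of `O[[x]]` is determined by the actions of `O` and of `x`. -/
theorem powMap_eq {p : ZMod 2} {n : ℕ} (y : powObj O p n) : F.powMap y = F.rep.powHom y := by
  refine toMulti_injective (MultilinearMap.ext fun w => Tens.ext' fun i => ?_)
  obtain ⟨N, hN⟩ := F.continuous p n i
  -- Truncation at `M` is invisible at level `i` both to the given action, by continuity, and to the
  -- evaluation of series.
  set M := max N (TensRep.order A i)
  have hM : augPow A M ≤ (A.K i).restrictScalars 𝕜 :=
    (augPow_antitone A (le_max_right _ _)).trans (TensRep.order_spec i)
  have h1 := F.rep.toLevel_powHom hM y (TensRep.rep_spec y M) w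
  have h2 := hN (y - powFree (TensRep.rep y M)) (by
    change y.1 N - (presIdeal (AdjRel O N) p n).mkQ (TensRep.rep y M) = 0
    rw [TensRep.mkQ_of_le (le_max_left _ _) (TensRep.rep_spec y M), sub_self]) w
  change toLevel A V i (toMulti (F.powMap (y - powFree (TensRep.rep y M))) w) = 0 at h2
  rw [map_sub, map_sub, _root_.sub_apply, map_sub, sub_eq_zero, powMap_powFree, ← h1] at h2
  exact h2

/-- The differential before twisting. -/
noncomputable def untwist : Tens A V →ₗ[𝕜] Tens A V := d - F.rep.alphaLin φ

theorem eq_untwist_add (w : Tens A V) :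
    d w = F.untwist w + toMulti (F.rep.powHom (twistElt φ)) fun _ => w :=
  (sub_add_cancel (d w) _).symm

theorem alphaLin_mem_part (E : TensRep O A V) {c : ZMod 2} {w : Tens A V}
    (hw : w ∈ (tensParity A V).part c) : E.alphaLin φ w ∈ (tensParity A V).part (1 + c) :=
  TensRep.toMulti_mem_part (E.powHom (twistElt φ)) hw

variable (hd : IsBlock A V d)
include hd

theorem untwist_odd (p : ZMod 2) (w : Tens A V) (hw : Homog A V p w) :
    Homog A V (p + 1) (F.untwist w) := by
  rw [homog_iff]
  refine sub_mem (homog_iff.1 (hd.odd p w hw)) ?_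
  have := alphaLin_mem_part (φ := φ) F.rep (homog_iff.1 hw)
  rwa [add_comm] at this

/-- The differential of Tw O goes to [d, -]. Subtracting the bracket with α on the source and with
its action on the target leaves the differential of O_MC and the bracket with d - α. -/
theorem powHom_powD {p : ZMod 2} {n : ℕ} (y : powObj O p n) :
    F.rep.powHom (powD φ y)
      = (tensEnd A V).bracket (diffOp F.untwist (F.untwist_odd hd)) (F.rep.powHom y) := by
  have h : F.rep.powHom ((twOperad φ).d y)
      = (tensEnd A V).bracket (diffOp d hd.odd) (F.rep.powHom y) :=
    (F.powMap_eq ((twOperad φ).d y)).symm.trans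
      ((F.toBlockAlg.hom_d hd.odd y).trans (congrArg _ (F.powMap_eq y)))
  rw [TensRep.diffOp_eq_add hd.odd (F.untwist_odd hd) F.eq_untwist_add, PreOperad.bracket_add] at h
  have h' := (congrArg F.rep.powHom (twOperad_d φ y)).symm.trans h
  have h2 := F.rep.powHom_bracket (φ := φ) (twistElt φ) y
  have h3 := (map_add F.rep.powHom _ _).symm.trans h'
  rw [h2] at h3
  exact add_right_cancel h3

theorem rep_hom_d {p : ZMod 2} {n : ℕ} (f : O.obj p n) : F.rep.hom (O.d f)
    = (tensEnd A V).bracket (diffOp F.untwist (F.untwist_odd hd)) (F.rep.hom f) := by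
  rw [← TensRep.powHom_powOld, ← TensRep.powHom_powOld, ← F.powHom_powD hd, powD_powOld]

/-- Compatibility with the differential of O_MC, applied to x itself and truncated, is the
Maurer–Cartan equation. -/
theorem ev_dxFree_sub_mem (N : ℕ) : F.rep.ev (dxFree φ N)
    - (tensEnd A V).bracket (diffOp F.untwist (F.untwist_odd hd)) F.rep.pt
      ∈ TensRep.filIdeal A V N (0 + 1) 0 := by
  rw [← TensRep.powHom_x, ← F.powHom_powD hd, ← neg_sub]
  exact neg_mem (F.rep.powHom_sub_ev_mem _ (powD_x φ N))

theorem untwist_continuous (i : A.index) :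
    ∃ j, ∀ w : Tens A V, w.1 j = 0 → (F.untwist w).1 i = 0 := by
  obtain ⟨j, hj⟩ := hd.continuous i
  obtain ⟨j', hj'⟩ := (F.rep.isEndA_powHom (twistElt φ)).continuous (fun _ => 0) i
  obtain ⟨k, hk, hk'⟩ := exists_K_le₂ j j'
  refine ⟨k, fun w hw => ?_⟩
  have hw' : toLevel A V k w = toLevel A V k 0 := by rw [map_zero]; exact hw
  have h1 := hj w (by
    have := toLevel_eq_of_le hk hw'
    rwa [map_zero] at this)
  have h2 := hj' (fun _ => w) fun _ => toLevel_eq_of_le hk' hw'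
  have h3 : toLevel A V i (F.rep.alphaLin φ w) = 0 := by
    refine h2.trans ?_
    change toLevel A V i (F.rep.alphaLin φ 0) = 0
    rw [map_zero, map_zero]
  change toLevel A V i (d w - F.rep.alphaLin φ w) = 0
  rw [map_sub, h3, sub_zero]
  exact h1

/-- The action of α is odd, continuous and graded A-linear with values in A_+ ⊗ V, so subtracting it
affects neither the Leibniz rule nor formality. Only the square needs the `l_∞` relations. -/
theorem isBlock_untwist : IsBlock A V F.untwist where
  odd := F.untwist_odd hd
  leibniz q a w ha := by
    have key : F.rep.alphaLin φ (a • w) = sgn q • (a • F.rep.alphaLin φ w) := by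
      suffices H : ∀ c, ∀ w ∈ (tensParity A V).part c,
          F.rep.alphaLin φ (a • w) = sgn q • (a • F.rep.alphaLin φ w) by
        rw [← (tensParity A V).sum_pr w]
        simp only [Finset.smul_sum, map_sum]
        exact Finset.sum_congr rfl fun c _ => H c _ ((tensParity A V).pr_mem c w)
      intro c w hw
      have := (F.rep.isEndA_powHom (twistElt φ)).multilinear (fun _ => c) (fun _ => w)
        (fun _ => piHomog_iff.2 hw) q a ha 0
      rw [Function.update_eq_const_of_subsingleton] at this
      refine this.trans ?_
      simp
      rfl
    change d (a • w) - F.rep.alphaLin φ (a • w)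
      = A.d a • w + sgn q • (a • (d w - F.rep.alphaLin φ w))
    rw [hd.leibniz q a w ha, key, smul_sub, smul_sub, add_sub_assoc]
  -- Expanding the square of d = d' + α gives d'² plus the expression that `alphaLin_square` shows
  -- to vanish.
  square w := by
    have h := F.rep.alphaLin_square φ (diffOp F.untwist (F.untwist_odd hd))
      (isCont_unaryMulti (F.untwist_continuous hd)) (F.rep_hom_d hd) (F.ev_dxFree_sub_mem hd) w
    have e : ∀ w, d w = F.untwist w + F.rep.alphaLin φ w := F.eq_untwist_add
    have h' := hd.square w
    rw [e w, e, map_add, map_add] at h'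
    change F.untwist (F.rep.alphaLin φ w) + F.rep.alphaLin φ (F.untwist w)
      + F.rep.alphaLin φ (F.rep.alphaLin φ w) = 0 at h
    rw [← h] at h'
    have := sub_eq_zero.2 h'
    rw [← this]
    abel
  continuous := F.untwist_continuous hd
  formal v := by
    have h1 := inPlus_iff.1 (hd.formal v)
    have h2 := inPlus_iff.1 ((F.rep.isEndA_powHom (twistElt φ)).plus fun _ => incl A V v)
    rw [inPlus_iff]
    change d (incl A V v) - F.rep.alphaLin φ (incl A V v) - _ ∈ _
    rw [sub_right_comm]
    exact sub_mem h1 h2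

/-- The restriction to `O`, and the action of `x`. -/
noncomputable def toMC : MCData φ d where
  d' := F.untwist
  isBlock := F.isBlock_untwist hd
  alg := BlockAlg.ofHom (F.untwist_odd hd) F.rep.hom F.rep.isEndA F.rep.hom_act F.rep.hom_comp
    (F.rep_hom_d hd)
  ξ := F.rep.point
  isMC :=
    { even := piHomog_iff.2 F.rep.point_mem_part
      plus := inPlus_iff.2 F.rep.point_mem_fil
      eqn := (F.rep.mc_eqn_iff φ (F.untwist_odd hd) _ fun _ => rfl).2 (F.ev_dxFree_sub_mem hd) }
  isTwisted := (F.rep.isTwisted_iff φ _ fun _ => rfl).2 F.eq_untwist_add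

end TwBlockAlg

/-! ### From Maurer–Cartan data to Block Tw O-algebras -/

namespace MCData

variable {d : Tens A V →ₗ[𝕜] Tens A V} (m : MCData φ d)

/-- The action of `O`, and the element `ξ`. -/
noncomputable def rep : TensRep O A V := TensRep.ofAlg m.alg m.ξ m.isMC.even m.isMC.plus

theorem eq_add (w : Tens A V) :
    d w = m.d' w + toMulti (m.rep.powHom (twistElt φ)) fun _ => w :=
  (m.rep.isTwisted_iff φ m.alg fun _ => rfl).1 m.isTwisted w

/-- The action of `O[[x]]`. -/
noncomputable def toTw (hd : IsBlock A V d) : TwBlockAlg φ d :=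
  m.rep.toTw φ hd.odd m.isBlock (fun f => m.alg.hom_d m.isBlock.odd f)
    ((m.rep.mc_eqn_iff φ m.isBlock.odd m.alg fun _ => rfl).1 m.isMC.eqn) m.eq_add

/-- Both constructions preserve the underlying `TensRep`, that is, the action of O and ξ. Everything
else in either structure is determined by it and `d`. -/
theorem rep_toTw (hd : IsBlock A V d) : (m.toTw hd).rep = m.rep :=
  TensRep.ext_hom (fun f => m.rep.powHom_powOld f) m.rep.powHom_x

end MCData

variable {d : Tens A V →ₗ[𝕜] Tens A V}

theorem TwBlockAlg.rep_toMC (F : TwBlockAlg φ d) (hd : IsBlock A V d) :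
    (F.toMC hd).rep = F.rep :=
  TensRep.ext_hom (fun _ => rfl) (toMulti_injective (MultilinearMap.ext fun w =>
    (F.rep.toMulti_pt w).symm))

/-- Block `Tw O`-algebras are Block `O`-algebras with a solution of the Maurer–Cartan equation. -/
noncomputable def twEquiv (hd : IsBlock A V d) : TwBlockAlg φ d ≃ MCData φ d where
  toFun F := F.toMC hd
  invFun m := m.toTw hd
  left_inv F := TwBlockAlg.ext_op fun {p n} y => by
    have h : toMulti ((F.toMC hd).rep.powHom y) = toMulti (F.powMap y) := by
      rw [F.rep_toMC hd]
      exact (congrArg toMulti (F.powMap_eq y)).symm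
    exact h
  right_inv m := by
    refine MCData.ext_op (LinearMap.ext fun w => ?_) (fun {p n} f => ?_) ?_
    -- The untwisted differential is `d` minus the action of α, and the latter depends only on the
    -- `TensRep`.
    · have h := (m.toTw hd).eq_untwist_add w
      rw [m.rep_toTw hd, m.eq_add] at h
      exact (add_right_cancel h).symm
    · exact congrArg toMulti (m.rep.powHom_powOld f)
    · exact congrArg (fun E => TensRep.point E) (m.rep_toTw hd)

end

end BlockTw

/-- A Block `Tw O`-algebra structure on a formal Block module `(A ⊗ V, d)` is the same as a Block
`O`-algebra structure on `(A ⊗ V, d')` together with `ξ ∈ MC_φ(V, A)` such that `d` is the twist of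
`d'` by `ξ`; the bijection restricts the structure to `O` and takes `ξ` to be the action of `x`. -/
theorem theorem7p11 {𝕜 : Type*} [Field 𝕜] [CharZero 𝕜] (ε : ℤˣ) (O : BlockTw.DGOperad 𝕜)
    (φ : BlockTw.PreOperad.Hom (BlockTw.lInf 𝕜 ε) O.toPreOperad)
    (A : BlockTw.FormalCDGA 𝕜) (V : BlockTw.DGSpace 𝕜)
    (d : BlockTw.Tens A V →ₗ[𝕜] BlockTw.Tens A V) (hd : BlockTw.IsBlock A V d) :
    ∃ e : BlockTw.TwBlockAlg φ d ≃ BlockTw.MCData φ d, ∀ F : BlockTw.TwBlockAlg φ d,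
      (∀ (p : ZMod 2) (n : ℕ) (f : O.obj p n), (e F).alg.op f = F.op (BlockTw.twOld φ f)) ∧
      (e F).ξ = F.op (BlockTw.twX φ) Fin.elim0 := by
  -- Both identities are definitional: the data was built from the values of the given structure on
  -- the constant series and on x.
  exact ⟨BlockTw.twEquiv hd, fun F => ⟨fun p n f => rfl, rfl⟩⟩
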